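/- Conventions. An étale groupoid $\mathcal G$ over a Hausdorff space $X$ is a topological groupoid with unit space $X$ whose source and range maps $\mathsf s,\mathsf r\colon\mathcal G\to X$ are local homeomorphisms ($\mathcal G$ itself need not be Hausdorff). A bisection is an open set $T\subseteq\mathcal G$ on which $\mathsf s$ and $\mathsf r$ are injective; the bisections, with set-wise product and inverse, form the pseudogroup $\widetilde{\mathcal G}$, whose zero is $\varnothing$ and whose unit is $X$. Two bisections $S,T$ are compatible if $ST^{-1}$ and $S^{-1}T$ are idempotent. A continuous morphism $\widetilde{\mathcal G}\to\widetilde{\mathcal H}$ is a semigroup homomorphism preserving zero, unit and unions of compatible families. $\mathcal G$ is minimal if every orbit is dense in $X$; effective if every bisection $T$ is determined by the partial homeomorphism $\mathsf r|_T\circ(\mathsf s|_T)^{-1}$; compactly generated (for $X$ compact) if there is a compact $K\subseteq\mathcal G$ such that every element of $\mathcal G$ is a product of elements of $K\cup K^{-1}$. The full group $\mathsf F(\mathcal G)$ is the group of bisections $g$ with $\mathsf s(g)=\mathsf r(g)=X$. A multisection of degree $d$ is a map $F\colon\{1,\dots,d\}^2\to\widetilde{\mathcal G}$ such that the $F(i,i)$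 are pairwise disjoint compact open subsets of $X$ and $F(i,j)F(j,l)=F(i,l)$ for all $i,j,l$; for a permutation $\sigma$ put $F(\sigma)=\bigcup_iF(\sigma(i),i)\sqcup\bigl(X\setminus\bigcup_iF(i,i)\bigr)$. The alternating full group $\mathsf A(\mathcal G)\le\mathsf F(\mathcal G)$ is generated by all $F(\sigma)$ with $F$ a multisection of some degree $d\ge3$ and $\sigma$ an even permutation of $\{1,\dots,d\}$. For $r\ge1$, $X^{[r]}$ is the set of non-empty subsets of $X$ of cardinality at most $r$, with the quotient topology from $X^r$. The symmetric power $\mathcal G^{[r]}$ is the étale groupoid over $X^{[r]}$ of all non-empty subsets $Q\subseteq\mathcal G$ of cardinality at most $r$ whose distinct elements have distinct sources and distinct ranges; source, range, product and inverse are set-wise, and the topology is the quotient of the topology of the set of tuples $(\gamma_1,\dots,\gamma_r)\in\mathcal G^r$ whose distinct entries have distinct sources and distinct ranges. For $g\in\mathsf F(\mathcal G)$ let $g^{[r]}=\{Q\in\mathcal G^{[r]}: Q\subseteq g\}\in\widetilde{\mathcal G^{[r]}}$. For a groupoid $\mathcal H$ over a compact space $Y$ and $y\in Y$, the leaf $\mathcal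 H_y=\mathsf s^{-1}(y)$ is a coarse space, where $E\subseteq\mathcal H_y\times\mathcal H_y$ is controlled if $\{\gamma\delta^{-1}:(\gamma,\delta)\in E\}$ is contained in a compact subset of $\mathcal H$. A coarse space $\Gamma$ has asymptotic dimension at most $n$ if for every controlled set $E$ there are families $\mathcal D_0,\dots,\mathcal D_n$ of subsets of $\Gamma$ which together cover $\Gamma$, such that for every $i$ the set $\bigcup_{A\in\mathcal D_i}A\times A$ is controlled and $(A\times B)\cap E=\varnothing$ for all distinct $A,B\in\mathcal D_i$; $\operatorname{asdim}\Gamma$ is the least such $n$, or $\infty$. The support of $h\in\mathsf F(\mathcal H)$ is the set of those $y\in Y$ such that the unit at $y$ does not belong to $h$; the support of a subgroup is the closure of the union of the supports of its elements. For $Z\subseteq Y$, $\mathcal H|Z$ consists of the arrows with source and range in $Z$; for clopen $Z$, $\mathsf F(\mathcal H|Z)$ is identified with a subgroup of $\mathsf F(\mathcal H)$ by $S\mapsto S\cup(Y\setminus Z)$. Theorem. Let $\mathcal G$ be a compactly generated, effective, minimal étale groupoid over a Cantor space $X$. Let $\mathcal H$ be an étale groupoid over a compact Hausdorff space $Y$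 such that $\operatorname{asdim}(\mathcal H_y)<\infty$ for every $y\in Y$. Let $\rho\colon\mathsf A(\mathcal G)\to\mathsf F(\mathcal H)$ be a non-trivial group homomorphism. Then the support $Z$ of $\rho(\mathsf A(\mathcal G))$ is clopen in $Y$, and there exists $r\ge1$ for which there is a unique continuous morphism $\widetilde\rho\colon\widetilde{\mathcal G^{[r]}}\to\widetilde{\mathcal H|Z}$ extending $\rho$, that is, with $\widetilde\rho(g^{[r]})=\rho(g)$ for all $g\in\mathsf A(\mathcal G)$. If moreover $d:=\sup_{y\in Y}\operatorname{asdim}(\mathcal H_y)<\infty$, such an $r$ exists with $r\le d$. -/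

import Mathlib

open Set Filter Topology

/-! ## Étale groupoids -/

/-- An étale groupoid with space of arrows `G` over the Hausdorff unit space `X`. Products are
defined exactly for composable pairs, `mul γ δ` meaning "first `δ`, then `γ`". The unit space is
identified with its image under `unit`; since `src` and `unit` are continuous and
`src ∘ unit = id`, the topology of `X` is the one induced by `X ⊆ G`.
The space `G` is not assumed to be Hausdorff. -/
structure EtaleGroupoid (G X : Type*) [TopologicalSpace G] [TopologicalSpace X] where
  src : G → X
  rng : G → X
  unit : X → G
  mul : (γ δ : G) → src γ = rng δ → G
  inv : G → G
  src_unit : ∀ x, src (unit x) = x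
  rng_unit : ∀ x, rng (unit x) = x
  src_mul : ∀ γ δ h, src (mul γ δ h) = src δ
  rng_mul : ∀ γ δ h, rng (mul γ δ h) = rng γ
  mul_assoc : ∀ γ δ η (h₁ : src γ = rng δ) (h₂ : src δ = rng η),
    mul (mul γ δ h₁) η ((src_mul γ δ h₁).trans h₂) =
      mul γ (mul δ η h₂) (h₁.trans (rng_mul δ η h₂).symm)
  unit_mul : ∀ γ, mul (unit (rng γ)) γ (src_unit (rng γ)) = γ
  mul_unit : ∀ γ, mul γ (unit (src γ)) (rng_unit (src γ)).symm = γ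
  src_inv : ∀ γ, src (inv γ) = rng γ
  rng_inv : ∀ γ, rng (inv γ) = src γ
  inv_mul : ∀ γ, mul (inv γ) γ (src_inv γ) = unit (src γ)
  mul_inv : ∀ γ, mul γ (inv γ) (rng_inv γ).symm = unit (rng γ)
  t2 : T2Space X
  continuous_unit : Continuous unit
  continuous_inv : Continuous inv
  continuous_mul : Continuous fun p : {p : G × G // src p.1 = rng p.2} => mul p.1.1 p.1.2 p.2
  isLocalHomeomorph_src : IsLocalHomeomorph src
  isLocalHomeomorph_rng : IsLocalHomeomorph rng

/-- A function into `P` is continuous at `w` if near `w` it takes values in an open set on which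
some open map `s` is injective, and its composition with `s` is continuous at `w`. -/
theorem continuousAt_of_isOpenMap_injOn {W P B : Type*} [TopologicalSpace W] [TopologicalSpace P]
    [TopologicalSpace B] {s : P → B} (hs : IsOpenMap s) {O : Set P} (hO : IsOpen O)
    (hinj : InjOn s O) {f : W → P} {w : W} (hf : ∀ᶠ v in 𝓝 w, f v ∈ O)
    (hsf : ContinuousAt (fun v => s (f v)) w) : ContinuousAt f w := by
  intro N hN
  have h1 : N ∩ O ∈ 𝓝 (f w) := inter_mem hN (hO.mem_nhds hf.self_of_nhds)
  have h2 : s '' (N ∩ O) ∈ 𝓝 (s (f w)) := hs.image_mem_nhds h1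
  change ∀ᶠ v in 𝓝 w, f v ∈ N
  filter_upwards [hf, hsf.eventually_mem h2] with v hv1 hv2
  obtain ⟨p, ⟨hpN, hpO⟩, hps⟩ := hv2
  have := hinj hpO hv1 hps
  exact this ▸ hpN

namespace EtaleGroupoid

variable {G X : Type*} [TopologicalSpace G] [TopologicalSpace X] (𝒢 : EtaleGroupoid G X)

theorem mul_congr {γ γ' δ δ' : G} (h₁ : γ = γ') (h₂ : δ = δ') (h : 𝒢.src γ = 𝒢.rng δ)
    (h' : 𝒢.src γ' = 𝒢.rng δ') : 𝒢.mul γ δ h = 𝒢.mul γ' δ' h' := by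
  subst h₁ h₂; rfl

theorem mul_unit_of {γ η : G} {x : X} (hη : η = 𝒢.unit x) (h : 𝒢.src γ = 𝒢.rng η) :
    𝒢.mul γ η h = γ := by
  subst hη
  have hx : x = 𝒢.src γ := by rw [h, 𝒢.rng_unit]
  subst hx
  exact 𝒢.mul_unit γ

theorem unit_mul_of {γ η : G} {x : X} (hη : η = 𝒢.unit x) (h : 𝒢.src η = 𝒢.rng γ) :
    𝒢.mul η γ h = γ := by
  subst hη
  have hx : x = 𝒢.rng γ := by rw [← h, 𝒢.src_unit]
  subst hx
  exact 𝒢.unit_mul γ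

theorem inv_inv (γ : G) : 𝒢.inv (𝒢.inv γ) = γ := by
  have h1 : 𝒢.src (𝒢.inv (𝒢.inv γ)) = 𝒢.rng (𝒢.inv γ) := 𝒢.src_inv _
  have h2 : 𝒢.src (𝒢.inv γ) = 𝒢.rng γ := 𝒢.src_inv _
  have := 𝒢.mul_assoc _ _ _ h1 h2
  rw [𝒢.mul_unit_of (𝒢.inv_mul γ), 𝒢.unit_mul_of (𝒢.inv_mul (𝒢.inv γ))] at this
  exact this.symm

/-- Left cancellation: `γ (γ⁻¹ η) = η`. -/
theorem mul_inv_cancel_left (γ η : G) (h : 𝒢.rng γ = 𝒢.rng η) :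
    𝒢.mul γ (𝒢.mul (𝒢.inv γ) η ((𝒢.src_inv γ).trans h))
      ((𝒢.rng_inv γ).symm.trans (𝒢.rng_mul _ _ _).symm) = η := by
  rw [← 𝒢.mul_assoc γ (𝒢.inv γ) η (𝒢.rng_inv γ).symm ((𝒢.src_inv γ).trans h)]
  exact 𝒢.unit_mul_of (𝒢.mul_inv γ) _

theorem eq_of_mul_inv_eq_unit {γ δ : G} {x : X} (h : 𝒢.src γ = 𝒢.rng (𝒢.inv δ))
    (hx : 𝒢.mul γ (𝒢.inv δ) h = 𝒢.unit x) : γ = δ := by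
  have h' : 𝒢.src (𝒢.inv δ) = 𝒢.rng δ := 𝒢.src_inv δ
  have := 𝒢.mul_assoc γ (𝒢.inv δ) δ h h'
  rw [𝒢.mul_unit_of (𝒢.inv_mul δ), 𝒢.unit_mul_of hx] at this
  exact this.symm

/-! ### Products and inverses of sets of arrows -/

/-- The set-wise product `{γδ : γ ∈ A, δ ∈ B, s(γ) = r(δ)}`. -/
def setMul (A B : Set G) : Set G :=
  {η | ∃ γ ∈ A, ∃ δ ∈ B, ∃ h : 𝒢.src γ = 𝒢.rng δ, 𝒢.mul γ δ h = η}

/-- The set-wise inverse `{γ⁻¹ : γ ∈ A}`. -/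
def setInv (A : Set G) : Set G := 𝒢.inv '' A

theorem mem_setInv {A : Set G} {γ : G} : γ ∈ 𝒢.setInv A ↔ 𝒢.inv γ ∈ A := by
  constructor
  · rintro ⟨δ, hδ, rfl⟩
    rwa [𝒢.inv_inv]
  · intro h
    exact ⟨_, h, 𝒢.inv_inv γ⟩

theorem setMul_assoc (A B C : Set G) :
    𝒢.setMul (𝒢.setMul A B) C = 𝒢.setMul A (𝒢.setMul B C) := by
  ext η
  constructor
  · rintro ⟨_, ⟨a, ha, b, hb, h, rfl⟩, c, hc, h', rfl⟩
    have hbc : 𝒢.src b = 𝒢.rng c := (𝒢.src_mul a b h).symm.trans h'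
    exact ⟨a, ha, 𝒢.mul b c hbc, ⟨b, hb, c, hc, hbc, rfl⟩, h.trans (𝒢.rng_mul b c hbc).symm,
      (𝒢.mul_assoc a b c h hbc).symm⟩
  · rintro ⟨a, ha, _, ⟨b, hb, c, hc, h, rfl⟩, h', rfl⟩
    have hab : 𝒢.src a = 𝒢.rng b := h'.trans (𝒢.rng_mul b c h)
    exact ⟨𝒢.mul a b hab, ⟨a, ha, b, hb, hab, rfl⟩, c, hc, (𝒢.src_mul a b hab).trans h,
      𝒢.mul_assoc a b c hab h⟩

theorem setMul_mono {A A' B B' : Set G} (hA : A ⊆ A') (hB : B ⊆ B') :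
    𝒢.setMul A B ⊆ 𝒢.setMul A' B' := by
  rintro _ ⟨a, ha, b, hb, h, rfl⟩
  exact ⟨a, hA ha, b, hB hb, h, rfl⟩

theorem injOn_src_setMul {A B : Set G} (hA : InjOn 𝒢.src A) (hB : InjOn 𝒢.src B) :
    InjOn 𝒢.src (𝒢.setMul A B) := by
  rintro _ ⟨a, ha, b, hb, h, rfl⟩ _ ⟨a', ha', b', hb', h', rfl⟩ heq
  rw [𝒢.src_mul, 𝒢.src_mul] at heq
  have hbb := hB hb hb' heq
  subst hbb
  exact 𝒢.mul_congr (hA ha ha' (h.trans h'.symm)) rfl _ _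

theorem injOn_rng_setMul {A B : Set G} (hA : InjOn 𝒢.rng A) (hB : InjOn 𝒢.rng B) :
    InjOn 𝒢.rng (𝒢.setMul A B) := by
  rintro _ ⟨a, ha, b, hb, h, rfl⟩ _ ⟨a', ha', b', hb', h', rfl⟩ heq
  rw [𝒢.rng_mul, 𝒢.rng_mul] at heq
  have haa := hA ha ha' heq
  subst haa
  exact 𝒢.mul_congr rfl (hB hb hb' (h.symm.trans h')) _ _

theorem injOn_src_setInv {A : Set G} (hA : InjOn 𝒢.rng A) : InjOn 𝒢.src (𝒢.setInv A) := by
  rintro _ ⟨a, ha, rfl⟩ _ ⟨b, hb, rfl⟩ h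
  rw [𝒢.src_inv, 𝒢.src_inv] at h
  rw [hA ha hb h]

theorem injOn_rng_setInv {A : Set G} (hA : InjOn 𝒢.src A) : InjOn 𝒢.rng (𝒢.setInv A) := by
  rintro _ ⟨a, ha, rfl⟩ _ ⟨b, hb, rfl⟩ h
  rw [𝒢.rng_inv, 𝒢.rng_inv] at h
  rw [hA ha hb h]

theorem src_image_setInv (A : Set G) : 𝒢.src '' 𝒢.setInv A = 𝒢.rng '' A := by
  simp [setInv, image_image, 𝒢.src_inv]

theorem rng_image_setInv (A : Set G) : 𝒢.rng '' 𝒢.setInv A = 𝒢.src '' A := by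
  simp [setInv, image_image, 𝒢.rng_inv]

theorem src_image_setMul {A B : Set G} (h : 𝒢.rng '' B ⊆ 𝒢.src '' A) :
    𝒢.src '' 𝒢.setMul A B = 𝒢.src '' B := by
  apply Subset.antisymm
  · rintro _ ⟨_, ⟨a, ha, b, hb, h, rfl⟩, rfl⟩
    exact ⟨b, hb, (𝒢.src_mul _ _ _).symm⟩
  · rintro _ ⟨b, hb, rfl⟩
    obtain ⟨a, ha, hab⟩ := h ⟨b, hb, rfl⟩
    exact ⟨_, ⟨a, ha, b, hb, hab, rfl⟩, 𝒢.src_mul _ _ _⟩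

theorem rng_image_setMul {A B : Set G} (h : 𝒢.src '' A ⊆ 𝒢.rng '' B) :
    𝒢.rng '' 𝒢.setMul A B = 𝒢.rng '' A := by
  apply Subset.antisymm
  · rintro _ ⟨_, ⟨a, ha, b, hb, h, rfl⟩, rfl⟩
    exact ⟨a, ha, (𝒢.rng_mul _ _ _).symm⟩
  · rintro _ ⟨a, ha, rfl⟩
    obtain ⟨b, hb, hab⟩ := h ⟨a, ha, rfl⟩
    exact ⟨_, ⟨a, ha, b, hb, hab.symm, rfl⟩, 𝒢.rng_mul _ _ _⟩

theorem setMul_unit {A : Set G} {C : Set X} (h : 𝒢.src '' A ⊆ C) :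
    𝒢.setMul A (𝒢.unit '' C) = A := by
  apply Subset.antisymm
  · rintro _ ⟨a, ha, _, ⟨x, hx, rfl⟩, h, rfl⟩
    rwa [𝒢.mul_unit_of rfl]
  · intro a ha
    exact ⟨a, ha, _, ⟨_, h ⟨a, ha, rfl⟩, rfl⟩, (𝒢.rng_unit _).symm, 𝒢.mul_unit a⟩

theorem unit_setMul {A : Set G} {C : Set X} (h : 𝒢.rng '' A ⊆ C) :
    𝒢.setMul (𝒢.unit '' C) A = A := by
  apply Subset.antisymm
  · rintro _ ⟨_, ⟨x, hx, rfl⟩, a, ha, h, rfl⟩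
    rwa [𝒢.unit_mul_of rfl]
  · intro a ha
    exact ⟨_, ⟨_, h ⟨a, ha, rfl⟩, rfl⟩, a, ha, 𝒢.src_unit _, 𝒢.unit_mul a⟩

theorem setInv_setMul {A : Set G} (hA : InjOn 𝒢.rng A) :
    𝒢.setMul (𝒢.setInv A) A = 𝒢.unit '' (𝒢.src '' A) := by
  apply Subset.antisymm
  · rintro _ ⟨_, ⟨a, ha, rfl⟩, b, hb, h, rfl⟩
    have hab : a = b := hA ha hb (by rw [← h, 𝒢.src_inv])
    subst hab
    exact ⟨_, ⟨a, ha, rfl⟩, (𝒢.inv_mul a).symm⟩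
  · rintro _ ⟨_, ⟨a, ha, rfl⟩, rfl⟩
    exact ⟨_, ⟨a, ha, rfl⟩, a, ha, 𝒢.src_inv a, 𝒢.inv_mul a⟩

theorem setMul_setInv {A : Set G} (hA : InjOn 𝒢.src A) :
    𝒢.setMul A (𝒢.setInv A) = 𝒢.unit '' (𝒢.rng '' A) := by
  apply Subset.antisymm
  · rintro _ ⟨a, ha, _, ⟨b, hb, rfl⟩, h, rfl⟩
    have hab : a = b := hA ha hb (by rw [h, 𝒢.rng_inv])
    subst hab
    exact ⟨_, ⟨a, ha, rfl⟩, (𝒢.mul_inv a).symm⟩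
  · rintro _ ⟨_, ⟨a, ha, rfl⟩, rfl⟩
    exact ⟨a, ha, _, ⟨a, ha, rfl⟩, (𝒢.rng_inv a).symm, 𝒢.mul_inv a⟩

/-! ### Bisections and the pseudogroup -/

/-- Bisections: open sets of arrows on which source and range are injective. As source and range
are continuous open maps, this says that they restrict to homeomorphisms onto their images. The
set of all bisections, with the operations below, is the pseudogroup of the groupoid. -/
@[ext]
structure Bisection where
  carrier : Set G
  isOpen : IsOpen carrier
  injOn_src : InjOn 𝒢.src carrier
  injOn_rng : InjOn 𝒢.rng carrier

variable {𝒢}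

namespace Bisection

instance : SetLike 𝒢.Bisection G where
  coe := carrier
  coe_injective T S h := by
    cases T; cases S; congr

theorem coe_ext {T S : 𝒢.Bisection} (h : (T : Set G) = (S : Set G)) : T = S :=
  SetLike.coe_injective h

theorem isOpen_setMul (T S : 𝒢.Bisection) : IsOpen (𝒢.setMul (T : Set G) (S : Set G)) := by
  rw [isOpen_iff_mem_nhds]
  rintro _ ⟨γ, hγ, δ, hδ, h, rfl⟩
  obtain ⟨B, hBo, hmB, hBinj⟩ := 𝒢.isLocalHomeomorph_src.isLocallyInjective (𝒢.mul γ δ h)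
  have hc := 𝒢.continuous_mul.continuousAt (x := ⟨(γ, δ), h⟩)
  have h1 := hc (hBo.mem_nhds hmB)
  obtain ⟨N, hN, hNB⟩ := mem_nhds_subtype _ _ _ |>.1 h1
  obtain ⟨N₁, hN₁, N₂, hN₂, hNN⟩ := mem_nhds_prod_iff.1 hN
  have ho := 𝒢.isLocalHomeomorph_src.isOpenMap
  have hT : 𝒢.src '' ((T : Set G) ∩ N₁) ∈ 𝓝 (𝒢.rng δ) := by
    rw [← h]
    exact ho.image_mem_nhds (inter_mem (T.isOpen.mem_nhds hγ) hN₁)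
  have hS : (S : Set G) ∩ N₂ ∩ 𝒢.rng ⁻¹' (𝒢.src '' ((T : Set G) ∩ N₁)) ∈ 𝓝 δ :=
    inter_mem (inter_mem (S.isOpen.mem_nhds hδ) hN₂)
      (𝒢.isLocalHomeomorph_rng.continuous.continuousAt hT)
  have hX := ho.image_mem_nhds hS
  rw [← 𝒢.src_mul γ δ h] at hX
  filter_upwards [hBo.mem_nhds hmB, 𝒢.isLocalHomeomorph_src.continuous.continuousAt hX]
    with η hη hη'
  obtain ⟨δ', ⟨⟨hδS, hδN⟩, ⟨γ', ⟨hγT, hγN⟩, hγδ⟩⟩, hδη⟩ := hη'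
  have hmem : 𝒢.mul γ' δ' hγδ ∈ B :=
    hNB (show (⟨(γ', δ'), hγδ⟩ : {p : G × G // 𝒢.src p.1 = 𝒢.rng p.2}) ∈ Subtype.val ⁻¹' N from
      hNN ⟨hγN, hδN⟩)
  exact ⟨γ', hγT, δ', hδS, hγδ, hBinj hmem hη ((𝒢.src_mul _ _ _).trans hδη)⟩

theorem isOpen_setInv {A : Set G} (hA : IsOpen A) : IsOpen (𝒢.setInv A) := by
  have : 𝒢.setInv A = 𝒢.inv ⁻¹' A := by
    ext γ; exact 𝒢.mem_setInv
  rw [this]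
  exact hA.preimage 𝒢.continuous_inv

theorem isOpen_unit_image {U : Set X} (hU : IsOpen U) : IsOpen (𝒢.unit '' U) := by
  have h : IsLocalHomeomorph (𝒢.src ∘ 𝒢.unit) := by
    have : 𝒢.src ∘ 𝒢.unit = id := funext 𝒢.src_unit
    rw [this]
    exact (Homeomorph.refl X).isLocalHomeomorph
  exact (h.of_comp 𝒢.isLocalHomeomorph_src 𝒢.continuous_unit).isOpenMap U hU

instance : Mul 𝒢.Bisection where
  mul T S :=
    { carrier := 𝒢.setMul T S
      isOpen := isOpen_setMul T S
      injOn_src := 𝒢.injOn_src_setMul T.injOn_src S.injOn_src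
      injOn_rng := 𝒢.injOn_rng_setMul T.injOn_rng S.injOn_rng }

instance : Inv 𝒢.Bisection where
  inv T :=
    { carrier := 𝒢.setInv T
      isOpen := isOpen_setInv T.isOpen
      injOn_src := 𝒢.injOn_src_setInv T.injOn_rng
      injOn_rng := 𝒢.injOn_rng_setInv T.injOn_src }

/-- The idempotent given by an open subset of the unit space. -/
def ofOpen (U : Set X) (hU : IsOpen U) : 𝒢.Bisection where
  carrier := 𝒢.unit '' U
  isOpen := isOpen_unit_image hU
  injOn_src := by
    rintro _ ⟨x, _, rfl⟩ _ ⟨y, _, rfl⟩ h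
    rw [𝒢.src_unit, 𝒢.src_unit] at h
    rw [h]
  injOn_rng := by
    rintro _ ⟨x, _, rfl⟩ _ ⟨y, _, rfl⟩ h
    rw [𝒢.rng_unit, 𝒢.rng_unit] at h
    rw [h]

instance : One 𝒢.Bisection where
  one := ofOpen univ isOpen_univ

/-- The zero of the pseudogroup. -/
instance : EmptyCollection 𝒢.Bisection where
  emptyCollection := ⟨∅, isOpen_empty, injOn_empty _, injOn_empty _⟩

theorem coe_mul (T S : 𝒢.Bisection) : ((T * S : 𝒢.Bisection) : Set G) = 𝒢.setMul T S := rfl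

theorem coe_inv (T : 𝒢.Bisection) : ((T⁻¹ : 𝒢.Bisection) : Set G) = 𝒢.setInv T := rfl

theorem coe_one : ((1 : 𝒢.Bisection) : Set G) = 𝒢.unit '' univ := rfl

instance : Monoid 𝒢.Bisection where
  mul_assoc T S R := coe_ext (𝒢.setMul_assoc _ _ _)
  one_mul T := coe_ext (𝒢.unit_setMul (subset_univ _))
  mul_one T := coe_ext (𝒢.setMul_unit (subset_univ _))

/-- Two elements of the pseudogroup are compatible if `T S⁻¹` and `T⁻¹ S` are idempotent. -/
def Compatible (T S : 𝒢.Bisection) : Prop :=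
  IsIdempotentElem (T * S⁻¹) ∧ IsIdempotentElem (T⁻¹ * S)

theorem mem_unit_of_isIdempotentElem {E : 𝒢.Bisection} (hE : IsIdempotentElem E) {e : G}
    (he : e ∈ E) : ∃ x, e = 𝒢.unit x := by
  have he' : e ∈ 𝒢.setMul (E : Set G) (E : Set G) := by
    rw [← coe_mul, hE.eq]; exact he
  obtain ⟨a, ha, b, hb, h, hab⟩ := he'
  have hae : a = e := E.injOn_rng ha he (by rw [← hab, 𝒢.rng_mul])
  have hbe : b = e := E.injOn_src hb he (by rw [← hab, 𝒢.src_mul])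
  subst hae
  subst hbe
  refine ⟨𝒢.src b, ?_⟩
  have h3 : 𝒢.src (𝒢.inv b) = 𝒢.rng (𝒢.mul b b h) := by rw [𝒢.src_inv, 𝒢.rng_mul]
  have h1 := 𝒢.mul_assoc (𝒢.inv b) b b (𝒢.src_inv b) h
  rw [𝒢.unit_mul_of (𝒢.inv_mul b)] at h1
  exact h1.trans ((𝒢.mul_congr rfl hab _ (𝒢.src_inv b)).trans (𝒢.inv_mul b))

/-- The union (join) of a compatible family of bisections. -/
def sUnion (𝒯 : Set 𝒢.Bisection) (h𝒯 : ∀ T ∈ 𝒯, ∀ S ∈ 𝒯, Compatible T S) : 𝒢.Bisection where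
  carrier := ⋃ T ∈ 𝒯, (T : Set G)
  isOpen := isOpen_biUnion fun T _ => T.isOpen
  injOn_src := by
    intro γ hγ δ hδ hs
    simp only [mem_iUnion] at hγ hδ
    obtain ⟨T, hT, hγ⟩ := hγ
    obtain ⟨S, hS, hδ⟩ := hδ
    have h : 𝒢.src γ = 𝒢.rng (𝒢.inv δ) := hs.trans (𝒢.rng_inv δ).symm
    obtain ⟨x, hx⟩ := mem_unit_of_isIdempotentElem (h𝒯 T hT S hS).1
      (e := 𝒢.mul γ (𝒢.inv δ) h) ⟨γ, hγ, _, ⟨δ, hδ, rfl⟩, h, rfl⟩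
    exact 𝒢.eq_of_mul_inv_eq_unit h hx
  injOn_rng := by
    intro γ hγ δ hδ hs
    simp only [mem_iUnion] at hγ hδ
    obtain ⟨T, hT, hγ⟩ := hγ
    obtain ⟨S, hS, hδ⟩ := hδ
    have h : 𝒢.src (𝒢.inv γ) = 𝒢.rng δ := (𝒢.src_inv γ).trans hs
    obtain ⟨x, hx⟩ := mem_unit_of_isIdempotentElem (h𝒯 T hT S hS).2
      (e := 𝒢.mul (𝒢.inv γ) δ h) ⟨_, ⟨γ, hγ, rfl⟩, δ, hδ, h, rfl⟩
    have h1 := 𝒢.mul_inv_cancel_left γ δ hs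
    rw [𝒢.mul_unit_of hx] at h1
    exact h1

theorem src_image_mul_inv (T : 𝒢.Bisection) (hT : 𝒢.src '' T = univ) : T⁻¹ * T = 1 := by
  apply coe_ext
  have := 𝒢.setInv_setMul T.injOn_rng
  exact this.trans (congrArg (𝒢.unit '' ·) hT)

end Bisection

/-! ### The topological full group and the alternating full group -/

variable (𝒢)

/-- The topological full group: bisections whose source and range are the whole unit space. -/
def FullGroup : Type _ :=
  {T : 𝒢.Bisection // 𝒢.src '' (T : Set G) = univ ∧ 𝒢.rng '' (T : Set G) = univ}

variable {𝒢}

namespace FullGroup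

instance : Mul 𝒢.FullGroup where
  mul g h := ⟨g.1 * h.1,
    (𝒢.src_image_setMul (by rw [g.2.1]; exact subset_univ _)).trans h.2.1,
    (𝒢.rng_image_setMul (by rw [h.2.2]; exact subset_univ _)).trans g.2.2⟩

instance : Inv 𝒢.FullGroup where
  inv g := ⟨g.1⁻¹, (𝒢.src_image_setInv _).trans g.2.2, (𝒢.rng_image_setInv _).trans g.2.1⟩

instance : One 𝒢.FullGroup where
  one := ⟨1, by simp [Bisection.coe_one, ← range_comp, Function.comp_def, 𝒢.src_unit],
    by simp [Bisection.coe_one, ← range_comp, Function.comp_def, 𝒢.rng_unit]⟩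

instance : Group 𝒢.FullGroup :=
  Group.ofLeftAxioms (fun g h k => Subtype.ext (_root_.mul_assoc g.1 h.1 k.1))
    (fun g => Subtype.ext (one_mul g.1))
    (fun g => Subtype.ext (Bisection.src_image_mul_inv g.1 g.2.1))

end FullGroup

variable (𝒢)

/-- A multisection of degree `d`. -/
structure Multisection (d : ℕ) where
  toFun : Fin d → Fin d → 𝒢.Bisection
  diag_subset : ∀ i, (toFun i i : Set G) ⊆ range 𝒢.unit
  diag_compact : ∀ i, IsCompact (toFun i i : Set G)
  diag_disjoint : ∀ i j, i ≠ j → Disjoint (toFun i i : Set G) (toFun j j : Set G)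
  mul_eq : ∀ i j l, toFun i j * toFun j l = toFun i l

variable {𝒢} in
/-- The set of arrows `⋃ᵢ F(σ(i), i) ⊔ (X ∖ ⋃ᵢ F(i, i))` of the element `F(σ)` of the full group. -/
def Multisection.permCarrier {d : ℕ} (F : 𝒢.Multisection d) (σ : Equiv.Perm (Fin d)) : Set G :=
  (⋃ i, (F.toFun (σ i) i : Set G)) ∪ (range 𝒢.unit \ ⋃ i, (F.toFun i i : Set G))

/-- The alternating full group: the subgroup of the full group generated by the elements `F(σ)`,
for `F` a multisection of degree `d ≥ 3` and `σ` an even permutation. -/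
def alternatingFullGroup : Subgroup 𝒢.FullGroup :=
  Subgroup.closure {g | ∃ d : ℕ, 3 ≤ d ∧ ∃ F : 𝒢.Multisection d, ∃ σ ∈ alternatingGroup (Fin d),
    (g.1 : Set G) = F.permCarrier σ}

/-! ### Minimal, effective and compactly generated groupoids -/

/-- Every orbit is dense in the unit space. -/
def IsMinimal : Prop := ∀ x, Dense {y | ∃ γ, 𝒢.src γ = x ∧ 𝒢.rng γ = y}

/-- Every bisection `T` is determined by the partial homeomorphism `τ(T) = r|_T ∘ (s|_T)⁻¹`,
given here by its graph. -/
def IsEffective : Prop := ∀ T S : 𝒢.Bisection,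
  (fun γ => (𝒢.src γ, 𝒢.rng γ)) '' (T : Set G) = (fun γ => (𝒢.src γ, 𝒢.rng γ)) '' (S : Set G) →
    T = S

/-- `𝒢.Generated K γ` says that `γ` is a product of elements of `K ∪ K⁻¹`. -/
inductive Generated (K : Set G) : G → Prop
  | of_mem (γ : G) : γ ∈ K → Generated K γ
  | of_inv_mem (γ : G) : γ ∈ K → Generated K (𝒢.inv γ)
  | mul (γ δ : G) (h : 𝒢.src γ = 𝒢.rng δ) :
      Generated K γ → Generated K δ → Generated K (𝒢.mul γ δ h)

/-- Compact generation, for a groupoid over a compact unit space. -/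
def IsCompactlyGenerated : Prop := ∃ K : Set G, IsCompact K ∧ ∀ γ, 𝒢.Generated K γ

end EtaleGroupoid

/-! ## Coarse spaces and asymptotic dimension -/

/-- A coarse structure on `Γ`. -/
structure CoarseStructure (Γ : Type*) where
  Controlled : Set (Γ × Γ) → Prop
  diag : Controlled {p | p.1 = p.2}
  mono : ∀ E F, Controlled F → E ⊆ F → Controlled E
  union : ∀ E F, Controlled E → Controlled F → Controlled (E ∪ F)
  symm : ∀ E, Controlled E → Controlled {p | (p.2, p.1) ∈ E}
  comp : ∀ E F, Controlled E → Controlled F →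
    Controlled {p | ∃ y, (p.1, y) ∈ E ∧ (y, p.2) ∈ F}

namespace CoarseStructure

variable {Γ : Type*} (𝒞 : CoarseStructure Γ)

/-- A family of subsets is `E`-separated if `(A × B) ∩ E = ∅` for any two distinct members. -/
def Separated (E : Set (Γ × Γ)) (𝒟 : Set (Set Γ)) : Prop :=
  ∀ A ∈ 𝒟, ∀ B ∈ 𝒟, A ≠ B → (A ×ˢ B) ∩ E = ∅

/-- A family of subsets is uniformly bounded if the union of the squares is controlled. -/
def UniformlyBounded (𝒟 : Set (Set Γ)) : Prop := 𝒞.Controlled (⋃ A ∈ 𝒟, A ×ˢ A)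

/-- The asymptotic dimension is at most `n`. -/
def AsdimLE (n : ℕ) : Prop := ∀ E, 𝒞.Controlled E → ∃ 𝒟 : Fin (n + 1) → Set (Set Γ),
  (∀ i, Separated E (𝒟 i) ∧ 𝒞.UniformlyBounded (𝒟 i)) ∧ ∀ γ, ∃ i, ∃ A ∈ 𝒟 i, γ ∈ A

/-- The asymptotic dimension: the least `n` with `AsdimLE n`, or `⊤` if there is none. -/
noncomputable def asdim : ℕ∞ := ⨅ (n : ℕ) (_ : 𝒞.AsdimLE n), (n : ℕ∞)

end CoarseStructure

namespace EtaleGroupoid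

variable {G X : Type*} [TopologicalSpace G] [TopologicalSpace X] (𝒢 : EtaleGroupoid G X)

/-- The leaf at `x`: all arrows with source `x`. -/
abbrev Leaf (x : X) : Type _ := {γ : G // 𝒢.src γ = x}

/-- The arrow `γ δ⁻¹`, for `γ` and `δ` in the same leaf. -/
def leafDiv {x : X} (γ δ : 𝒢.Leaf x) : G :=
  𝒢.mul γ.1 (𝒢.inv δ.1) (by rw [γ.2, 𝒢.rng_inv, δ.2])

theorem leafDiv_symm {x : X} (γ δ : 𝒢.Leaf x) : 𝒢.leafDiv δ γ = 𝒢.inv (𝒢.leafDiv γ δ) := by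
  have hs : 𝒢.src (𝒢.leafDiv γ δ) = 𝒢.rng δ.1 := by rw [leafDiv, 𝒢.src_mul, 𝒢.src_inv]
  have hs' : 𝒢.src (𝒢.leafDiv δ γ) = 𝒢.rng (𝒢.leafDiv γ δ) := by
    rw [leafDiv, leafDiv, 𝒢.src_mul, 𝒢.src_inv, 𝒢.rng_mul]
  have hδ : 𝒢.src δ.1 = 𝒢.rng (𝒢.inv γ.1) := by rw [𝒢.rng_inv, γ.2, δ.2]
  have hγ : 𝒢.src γ.1 = 𝒢.rng (𝒢.inv δ.1) := by rw [𝒢.rng_inv, γ.2, δ.2]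
  have h1 : 𝒢.mul (𝒢.leafDiv δ γ) (𝒢.leafDiv γ δ) hs' = 𝒢.unit (𝒢.rng δ.1) := by
    have e1 := 𝒢.mul_assoc δ.1 (𝒢.inv γ.1) (𝒢.leafDiv γ δ) hδ
      (by rw [𝒢.src_inv, leafDiv, 𝒢.rng_mul])
    have e2 := 𝒢.mul_assoc (𝒢.inv γ.1) γ.1 (𝒢.inv δ.1) (𝒢.src_inv _) hγ
    rw [𝒢.unit_mul_of (𝒢.inv_mul _)] at e2
    refine e1.trans (Eq.trans (𝒢.mul_congr rfl e2.symm _ (𝒢.rng_inv _).symm) (𝒢.mul_inv _))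
  have h2 : 𝒢.src (𝒢.leafDiv δ γ) = 𝒢.rng (𝒢.inv (𝒢.inv (𝒢.leafDiv γ δ))) := by
    rw [𝒢.inv_inv]; exact hs'
  exact 𝒢.eq_of_mul_inv_eq_unit h2 ((𝒢.mul_congr rfl (𝒢.inv_inv _) _ _).trans h1)

theorem leafDiv_mul {x : X} (γ δ η : 𝒢.Leaf x) (h : 𝒢.src (𝒢.leafDiv γ δ) = 𝒢.rng (𝒢.leafDiv δ η)) :
    𝒢.mul (𝒢.leafDiv γ δ) (𝒢.leafDiv δ η) h = 𝒢.leafDiv γ η := by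
  have hγ : 𝒢.src γ.1 = 𝒢.rng (𝒢.inv δ.1) := by rw [𝒢.rng_inv, γ.2, δ.2]
  have hδ : 𝒢.src δ.1 = 𝒢.rng (𝒢.inv η.1) := by rw [𝒢.rng_inv, η.2, δ.2]
  have e1 := 𝒢.mul_assoc γ.1 (𝒢.inv δ.1) (𝒢.leafDiv δ η) hγ
    (by rw [𝒢.src_inv, leafDiv, 𝒢.rng_mul])
  have e2 := 𝒢.mul_assoc (𝒢.inv δ.1) δ.1 (𝒢.inv η.1) (𝒢.src_inv _) hδ
  rw [𝒢.unit_mul_of (𝒢.inv_mul _)] at e2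
  exact e1.trans (𝒢.mul_congr rfl e2.symm _ _)

/-- The natural coarse structure on a leaf of a groupoid over a compact space: `E` is controlled
if `{γ δ⁻¹ : (γ, δ) ∈ E}` is contained in a compact set of arrows. -/
def leafCoarse [CompactSpace X] (x : X) : CoarseStructure (𝒢.Leaf x) where
  Controlled E := ∃ K : Set G, IsCompact K ∧ ∀ p ∈ E, 𝒢.leafDiv p.1 p.2 ∈ K
  diag := by
    refine ⟨range 𝒢.unit, isCompact_range 𝒢.continuous_unit, ?_⟩
    rintro ⟨γ, δ⟩ h
    have h' : γ = δ := h
    subst h'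
    exact ⟨_, (𝒢.mul_inv γ.1).symm⟩
  mono E F := by
    rintro ⟨K, hK, hF⟩ hEF
    exact ⟨K, hK, fun p hp => hF p (hEF hp)⟩
  union E F := by
    rintro ⟨K, hK, hE⟩ ⟨L, hL, hF⟩
    refine ⟨K ∪ L, hK.union hL, ?_⟩
    rintro p (hp | hp)
    · exact Or.inl (hE p hp)
    · exact Or.inr (hF p hp)
  symm E := by
    rintro ⟨K, hK, hE⟩
    refine ⟨𝒢.inv '' K, hK.image 𝒢.continuous_inv, ?_⟩
    rintro ⟨γ, δ⟩ hp
    exact ⟨_, hE _ hp, (𝒢.leafDiv_symm δ γ).symm⟩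
  comp E F := by
    rintro ⟨K, hK, hE⟩ ⟨L, hL, hF⟩
    have := 𝒢.t2
    have hcl : IsClosed {p : G × G | 𝒢.src p.1 = 𝒢.rng p.2} :=
      isClosed_eq (𝒢.isLocalHomeomorph_src.continuous.comp continuous_fst)
        (𝒢.isLocalHomeomorph_rng.continuous.comp continuous_snd)
    have hc := (hcl.isClosedEmbedding_subtypeVal.isCompact_preimage (hK.prod hL)).image
      𝒢.continuous_mul
    refine ⟨_, hc, ?_⟩
    rintro ⟨γ, η⟩ ⟨δ, h1, h2⟩
    have h : 𝒢.src (𝒢.leafDiv γ δ) = 𝒢.rng (𝒢.leafDiv δ η) := by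
      rw [leafDiv, leafDiv, 𝒢.src_mul, 𝒢.src_inv, 𝒢.rng_mul]
    exact ⟨⟨(𝒢.leafDiv γ δ, 𝒢.leafDiv δ η), h⟩, ⟨hE _ h1, hF _ h2⟩, 𝒢.leafDiv_mul γ δ η h⟩

/-- The asymptotic dimension of the leaf at `x`. -/
noncomputable def leafAsdim [CompactSpace X] (x : X) : ℕ∞ := (𝒢.leafCoarse x).asdim

/-! ## Restriction to an open set of units -/

/-- Arrows with source and range in `Z`. -/
abbrev RestrictArrow (Z : Set X) : Type _ := {γ : G // 𝒢.src γ ∈ Z ∧ 𝒢.rng γ ∈ Z}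

/-- The restriction of an étale groupoid to an open subset `Z` of the unit space. -/
def restrict (Z : Set X) (hZ : IsOpen Z) : EtaleGroupoid (𝒢.RestrictArrow Z) Z where
  src γ := ⟨𝒢.src γ.1, γ.2.1⟩
  rng γ := ⟨𝒢.rng γ.1, γ.2.2⟩
  unit x := ⟨𝒢.unit x.1, by rw [𝒢.src_unit]; exact x.2, by rw [𝒢.rng_unit]; exact x.2⟩
  mul γ δ h := ⟨𝒢.mul γ.1 δ.1 (congrArg Subtype.val h), by rw [𝒢.src_mul]; exact δ.2.1,
    by rw [𝒢.rng_mul]; exact γ.2.2⟩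
  inv γ := ⟨𝒢.inv γ.1, by rw [𝒢.src_inv]; exact γ.2.2, by rw [𝒢.rng_inv]; exact γ.2.1⟩
  src_unit x := Subtype.ext (𝒢.src_unit _)
  rng_unit x := Subtype.ext (𝒢.rng_unit _)
  src_mul γ δ h := Subtype.ext (𝒢.src_mul _ _ _)
  rng_mul γ δ h := Subtype.ext (𝒢.rng_mul _ _ _)
  mul_assoc γ δ η h₁ h₂ := Subtype.ext (𝒢.mul_assoc _ _ _ _ _)
  unit_mul γ := Subtype.ext (𝒢.unit_mul _)
  mul_unit γ := Subtype.ext (𝒢.mul_unit _)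
  src_inv γ := Subtype.ext (𝒢.src_inv _)
  rng_inv γ := Subtype.ext (𝒢.rng_inv _)
  inv_mul γ := Subtype.ext (𝒢.inv_mul _)
  mul_inv γ := Subtype.ext (𝒢.mul_inv _)
  t2 := haveI := 𝒢.t2; inferInstance
  continuous_unit := (𝒢.continuous_unit.comp continuous_subtype_val).subtype_mk _
  continuous_inv := (𝒢.continuous_inv.comp continuous_subtype_val).subtype_mk _
  continuous_mul := by
    refine Continuous.subtype_mk ?_ _
    let f : {p : 𝒢.RestrictArrow Z × 𝒢.RestrictArrow Z //
        (⟨𝒢.src p.1.1, p.1.2.1⟩ : {x // x ∈ Z}) = ⟨𝒢.rng p.2.1, p.2.2.2⟩} →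
        {p : G × G // 𝒢.src p.1 = 𝒢.rng p.2} :=
      fun p => ⟨(p.1.1.1, p.1.2.1), congrArg Subtype.val p.2⟩
    have hf : Continuous f :=
      ((continuous_subtype_val.comp (continuous_fst.comp continuous_subtype_val)).prodMk
        (continuous_subtype_val.comp (continuous_snd.comp continuous_subtype_val))).subtype_mk _
    exact 𝒢.continuous_mul.comp hf
  isLocalHomeomorph_src := by
    have ho : IsOpen {γ : G | 𝒢.src γ ∈ Z ∧ 𝒢.rng γ ∈ Z} :=
      (hZ.preimage 𝒢.isLocalHomeomorph_src.continuous).inter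
        (hZ.preimage 𝒢.isLocalHomeomorph_rng.continuous)
    have h1 := 𝒢.isLocalHomeomorph_src.comp ho.isOpenEmbedding_subtypeVal.isLocalHomeomorph
    exact IsLocalHomeomorph.of_comp (g := Subtype.val) h1
      hZ.isOpenEmbedding_subtypeVal.isLocalHomeomorph (h1.continuous.subtype_mk _)
  isLocalHomeomorph_rng := by
    have ho : IsOpen {γ : G | 𝒢.src γ ∈ Z ∧ 𝒢.rng γ ∈ Z} :=
      (hZ.preimage 𝒢.isLocalHomeomorph_src.continuous).inter
        (hZ.preimage 𝒢.isLocalHomeomorph_rng.continuous)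
    have h1 := 𝒢.isLocalHomeomorph_rng.comp ho.isOpenEmbedding_subtypeVal.isLocalHomeomorph
    exact IsLocalHomeomorph.of_comp (g := Subtype.val) h1
      hZ.isOpenEmbedding_subtypeVal.isLocalHomeomorph (h1.continuous.subtype_mk _)

end EtaleGroupoid

/-! ## Symmetric powers -/

/-- The symmetric power `X^{[r]}`: subsets of `X` of the form `{x₁, …, x_r}`. For `r ≥ 1` these are
the non-empty finite subsets with at most `r` elements. -/
def SymPow (X : Type*) (r : ℕ) : Type _ := {A : Set X // ∃ x : Fin r → X, range x = A}

/-- The quotient map `X^r → X^{[r]}`. -/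
def SymPow.mk {X : Type*} {r : ℕ} (x : Fin r → X) : SymPow X r := ⟨range x, x, rfl⟩

/-- The quotient of the product topology on `X^r`. -/
instance {X : Type*} [TopologicalSpace X] {r : ℕ} : TopologicalSpace (SymPow X r) :=
  TopologicalSpace.coinduced SymPow.mk inferInstance

theorem SymPow.isOpen_subset {X : Type*} [TopologicalSpace X] {r : ℕ} {U : Set X} (hU : IsOpen U) :
    IsOpen {A : SymPow X r | A.1 ⊆ U} := by
  rw [isOpen_coinduced]
  have : (SymPow.mk ⁻¹' {A : SymPow X r | A.1 ⊆ U}) = ⋂ i, (fun x : Fin r → X => x i) ⁻¹' U := by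
    ext x
    simp [SymPow.mk, range_subset_iff]
  rw [this]
  exact isOpen_iInter_of_finite fun i => hU.preimage (continuous_apply i)

theorem SymPow.isOpen_inter {X : Type*} [TopologicalSpace X] {r : ℕ} {U : Set X} (hU : IsOpen U) :
    IsOpen {A : SymPow X r | (A.1 ∩ U).Nonempty} := by
  rw [isOpen_coinduced]
  have : (SymPow.mk ⁻¹' {A : SymPow X r | (A.1 ∩ U).Nonempty}) =
      ⋃ i, (fun x : Fin r → X => x i) ⁻¹' U := by
    ext x
    simp [SymPow.mk, Set.Nonempty]
  rw [this]
  exact isOpen_iUnion fun i => hU.preimage (continuous_apply i)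

instance {X : Type*} [TopologicalSpace X] [T2Space X] {r : ℕ} : T2Space (SymPow X r) := by
  have key : ∀ A B : SymPow X r, ¬ A.1 ⊆ B.1 → ∃ U V : Set (SymPow X r),
      IsOpen U ∧ IsOpen V ∧ A ∈ U ∧ B ∈ V ∧ Disjoint U V := by
    intro A B hAB
    obtain ⟨a, haA, haB⟩ := not_subset.1 hAB
    obtain ⟨f, hf⟩ := B.2
    have hB : B.1.Finite := by rw [← hf]; exact finite_range f
    obtain ⟨U, V, hU, hV, haU, hBV, hd⟩ := hB.isCompact.separation_of_notMem haB
    refine ⟨{C | (C.1 ∩ V).Nonempty}, {C | C.1 ⊆ U}, SymPow.isOpen_inter hV,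
      SymPow.isOpen_subset hU, ⟨a, haA, hBV⟩, haU, ?_⟩
    rw [Set.disjoint_left]
    rintro C ⟨c, hc, hcV⟩ hCU
    exact Set.disjoint_left.1 hd (hCU hc) hcV
  refine ⟨fun A B hAB => ?_⟩
  by_cases h : A.1 ⊆ B.1
  · have h' : ¬ B.1 ⊆ A.1 := fun h' => hAB (Subtype.ext (Subset.antisymm h h'))
    obtain ⟨U, V, hU, hV, hBU, hAV, hd⟩ := key B A h'
    exact ⟨V, U, hV, hU, hAV, hBU, hd.symm⟩
  · exact key A B h

namespace EtaleGroupoid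

variable {G X : Type*} [TopologicalSpace G] [TopologicalSpace X] (𝒢 : EtaleGroupoid G X)

/-- Arrows of the symmetric power: sets `{γ₁, …, γ_r}` of arrows such that distinct elements have
distinct sources and distinct ranges. -/
def SymPowArrow (r : ℕ) : Type _ :=
  {Q : Set G // (∃ γ : Fin r → G, range γ = Q) ∧ InjOn 𝒢.src Q ∧ InjOn 𝒢.rng Q}

/-- Tuples of arrows such that distinct entries have distinct sources and distinct ranges. -/
def SymPowTuple (r : ℕ) : Type _ :=
  {γ : Fin r → G // InjOn 𝒢.src (range γ) ∧ InjOn 𝒢.rng (range γ)}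

instance (r : ℕ) : TopologicalSpace (𝒢.SymPowTuple r) :=
  inferInstanceAs (TopologicalSpace
    {γ : Fin r → G // InjOn 𝒢.src (range γ) ∧ InjOn 𝒢.rng (range γ)})

/-- The surjection sending a tuple to the set of its entries. -/
def SymPowArrow.mk {r : ℕ} (γ : 𝒢.SymPowTuple r) : 𝒢.SymPowArrow r :=
  ⟨range γ.1, ⟨γ.1, rfl⟩, γ.2⟩

/-- The quotient topology. -/
instance (r : ℕ) : TopologicalSpace (𝒢.SymPowArrow r) :=
  TopologicalSpace.coinduced (SymPowArrow.mk 𝒢) inferInstance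

namespace SymPowArrow

variable {𝒢} {r : ℕ}

/-- The source of an arrow of the symmetric power. -/
def src (Q : 𝒢.SymPowArrow r) : SymPow X r :=
  ⟨𝒢.src '' Q.1, by
    obtain ⟨γ, hγ⟩ := Q.2.1
    exact ⟨𝒢.src ∘ γ, by rw [range_comp, hγ]⟩⟩

/-- The range of an arrow of the symmetric power. -/
def rng (Q : 𝒢.SymPowArrow r) : SymPow X r :=
  ⟨𝒢.rng '' Q.1, by
    obtain ⟨γ, hγ⟩ := Q.2.1
    exact ⟨𝒢.rng ∘ γ, by rw [range_comp, hγ]⟩⟩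

/-- The set-wise inverse. -/
def inv (Q : 𝒢.SymPowArrow r) : 𝒢.SymPowArrow r :=
  ⟨𝒢.setInv Q.1, by
    obtain ⟨γ, hγ⟩ := Q.2.1
    exact ⟨𝒢.inv ∘ γ, by rw [range_comp, hγ]; rfl⟩,
    𝒢.injOn_src_setInv Q.2.2.2, 𝒢.injOn_rng_setInv Q.2.2.1⟩

variable (𝒢) in
/-- The set of units at the elements of `A`. -/
def unit (A : SymPow X r) : 𝒢.SymPowArrow r :=
  ⟨𝒢.unit '' A.1, by
    obtain ⟨x, hx⟩ := A.2
    exact ⟨𝒢.unit ∘ x, by rw [range_comp, hx]⟩, by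
    rintro _ ⟨x, _, rfl⟩ _ ⟨y, _, rfl⟩ h
    rw [𝒢.src_unit, 𝒢.src_unit] at h
    rw [h], by
    rintro _ ⟨x, _, rfl⟩ _ ⟨y, _, rfl⟩ h
    rw [𝒢.rng_unit, 𝒢.rng_unit] at h
    rw [h]⟩

/-- The set-wise product. -/
def mul (Q P : 𝒢.SymPowArrow r) (h : src Q = rng P) : 𝒢.SymPowArrow r :=
  ⟨𝒢.setMul Q.1 P.1, by
    obtain ⟨δ, hδ⟩ := P.2.1
    have h' : 𝒢.src '' Q.1 = 𝒢.rng '' P.1 := congrArg Subtype.val h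
    have hex : ∀ i, ∃ γ ∈ Q.1, 𝒢.src γ = 𝒢.rng (δ i) := by
      intro i
      have : 𝒢.rng (δ i) ∈ 𝒢.src '' Q.1 := by
        rw [h', ← hδ]
        exact ⟨_, ⟨i, rfl⟩, rfl⟩
      exact this
    choose γ hγ hγs using hex
    refine ⟨fun i => 𝒢.mul (γ i) (δ i) (hγs i), ?_⟩
    apply Subset.antisymm
    · rintro _ ⟨i, rfl⟩
      exact ⟨γ i, hγ i, δ i, by rw [← hδ]; exact ⟨i, rfl⟩, hγs i, rfl⟩
    · rintro _ ⟨a, ha, b, hb, hab, rfl⟩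
      rw [← hδ] at hb
      obtain ⟨i, rfl⟩ := hb
      exact ⟨i, 𝒢.mul_congr (Q.2.2.1 (hγ i) ha ((hγs i).trans hab.symm)) rfl _ _⟩,
    𝒢.injOn_src_setMul Q.2.2.1 P.2.2.1, 𝒢.injOn_rng_setMul Q.2.2.2 P.2.2.2⟩

theorem continuous_mk : Continuous (SymPowArrow.mk 𝒢 (r := r)) := continuous_coinduced_rng

theorem mk_surjective : Function.Surjective (SymPowArrow.mk 𝒢 (r := r)) := by
  rintro ⟨Q, ⟨γ, rfl⟩, h⟩
  exact ⟨⟨γ, h⟩, rfl⟩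

theorem continuous_src : Continuous (src : 𝒢.SymPowArrow r → SymPow X r) := by
  rw [continuous_coinduced_dom]
  have : (src ∘ SymPowArrow.mk 𝒢 : 𝒢.SymPowTuple r → SymPow X r) =
      SymPow.mk ∘ fun γ i => 𝒢.src (γ.1 i) := by
    funext γ
    exact Subtype.ext (range_comp _ _).symm
  rw [this]
  exact continuous_coinduced_rng.comp (continuous_pi fun i =>
    𝒢.isLocalHomeomorph_src.continuous.comp ((continuous_apply i).comp continuous_subtype_val))

theorem continuous_inv : Continuous (inv : 𝒢.SymPowArrow r → 𝒢.SymPowArrow r) := by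
  rw [continuous_coinduced_dom]
  let f : 𝒢.SymPowTuple r → 𝒢.SymPowTuple r := fun γ => ⟨𝒢.inv ∘ γ.1, by
    rw [range_comp]
    exact ⟨𝒢.injOn_src_setInv γ.2.2, 𝒢.injOn_rng_setInv γ.2.1⟩⟩
  have hf : Continuous f := (continuous_pi fun i =>
    𝒢.continuous_inv.comp ((continuous_apply i).comp continuous_subtype_val)).subtype_mk _
  have : (inv ∘ SymPowArrow.mk 𝒢 : 𝒢.SymPowTuple r → 𝒢.SymPowArrow r) =
      SymPowArrow.mk 𝒢 ∘ f := by
    funext γ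
    exact Subtype.ext (range_comp _ _).symm
  rw [this]
  exact continuous_mk.comp hf

theorem continuous_unit : Continuous (unit 𝒢 : SymPow X r → 𝒢.SymPowArrow r) := by
  rw [continuous_coinduced_dom]
  let f : (Fin r → X) → 𝒢.SymPowTuple r := fun x => ⟨𝒢.unit ∘ x, by
    rw [range_comp]
    exact (unit 𝒢 (SymPow.mk x)).2.2⟩
  have hf : Continuous f := (continuous_pi fun i =>
    𝒢.continuous_unit.comp (continuous_apply i)).subtype_mk _
  have : (unit 𝒢 ∘ SymPow.mk : (Fin r → X) → 𝒢.SymPowArrow r) = SymPowArrow.mk 𝒢 ∘ f := by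
    funext x
    exact Subtype.ext (range_comp _ _).symm
  rw [this]
  exact continuous_mk.comp hf

theorem isOpen_subset {T : Set G} (hT : IsOpen T) : IsOpen {Q : 𝒢.SymPowArrow r | Q.1 ⊆ T} := by
  rw [isOpen_coinduced]
  have : (SymPowArrow.mk 𝒢 ⁻¹' {Q : 𝒢.SymPowArrow r | Q.1 ⊆ T}) =
      ⋂ i, (fun γ : 𝒢.SymPowTuple r => γ.1 i) ⁻¹' T := by
    ext γ
    simp [SymPowArrow.mk, range_subset_iff]
  rw [this]
  exact isOpen_iInter_of_finite fun i =>
    hT.preimage ((continuous_apply i).comp continuous_subtype_val)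

theorem injOn_src_subset {T : Set G} (hT : InjOn 𝒢.src T) :
    InjOn (src : 𝒢.SymPowArrow r → SymPow X r) {Q | Q.1 ⊆ T} := by
  intro Q hQ P hP h
  exact Subtype.ext ((hT.image_eq_image_iff hQ hP).1 (congrArg Subtype.val h))

theorem injOn_rng_subset {T : Set G} (hT : InjOn 𝒢.rng T) :
    InjOn (rng : 𝒢.SymPowArrow r → SymPow X r) {Q | Q.1 ⊆ T} := by
  intro Q hQ P hP h
  exact Subtype.ext ((hT.image_eq_image_iff hQ hP).1 (congrArg Subtype.val h))

/-- Every arrow of the symmetric power is contained in a bisection. -/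
theorem exists_bisection (Q : 𝒢.SymPowArrow r) : ∃ T : 𝒢.Bisection, Q.1 ⊆ T := by
  have := 𝒢.t2
  obtain ⟨γ, hγ⟩ := Q.2.1
  have hfin : Q.1.Finite := by rw [← hγ]; exact finite_range γ
  obtain ⟨U, hU, hUd⟩ := (hfin.image 𝒢.src).t2_separation
  obtain ⟨V, hV, hVd⟩ := (hfin.image 𝒢.rng).t2_separation
  choose A hAo hAm hA using 𝒢.isLocalHomeomorph_src.isLocallyInjective
  choose B hBo hBm hB using 𝒢.isLocalHomeomorph_rng.isLocallyInjective
  let N : G → Set G := fun γ => A γ ∩ B γ ∩ 𝒢.src ⁻¹' U (𝒢.src γ) ∩ 𝒢.rng ⁻¹' V (𝒢.rng γ)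
  refine ⟨⟨⋃ γ ∈ Q.1, N γ, ?_, ?_, ?_⟩, ?_⟩
  · exact isOpen_biUnion fun γ _ => (((hAo γ).inter (hBo γ)).inter
      ((hU _).2.preimage 𝒢.isLocalHomeomorph_src.continuous)).inter
      ((hV _).2.preimage 𝒢.isLocalHomeomorph_rng.continuous)
  · intro a ha b hb hab
    simp only [mem_iUnion] at ha hb
    obtain ⟨γ, hγQ, haγ⟩ := ha
    obtain ⟨δ, hδQ, hbδ⟩ := hb
    have hs : 𝒢.src γ = 𝒢.src δ := by
      by_contra hne
      refine Set.disjoint_left.1 (hUd ⟨γ, hγQ, rfl⟩ ⟨δ, hδQ, rfl⟩ hne) haγ.1.2 ?_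
      rw [hab]
      exact hbδ.1.2
    have := Q.2.2.1 hγQ hδQ hs
    subst this
    exact hA γ haγ.1.1.1 hbδ.1.1.1 hab
  · intro a ha b hb hab
    simp only [mem_iUnion] at ha hb
    obtain ⟨γ, hγQ, haγ⟩ := ha
    obtain ⟨δ, hδQ, hbδ⟩ := hb
    have hs : 𝒢.rng γ = 𝒢.rng δ := by
      by_contra hne
      refine Set.disjoint_left.1 (hVd ⟨γ, hγQ, rfl⟩ ⟨δ, hδQ, rfl⟩ hne) haγ.2 ?_
      rw [hab]
      exact hbδ.2
    have := Q.2.2.2 hγQ hδQ hs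
    subst this
    exact hB γ haγ.1.1.2 hbδ.1.1.2 hab
  · intro γ hγQ
    exact mem_biUnion hγQ ⟨⟨⟨hAm γ, hBm γ⟩, (hU _).1⟩, (hV _).1⟩

/-- The source map of the symmetric power is open on arrows contained in a bisection. -/
theorem isOpen_src_image (T : 𝒢.Bisection) {V : Set (𝒢.SymPowArrow r)} (hV : IsOpen V) :
    IsOpen (src '' (V ∩ {Q | Q.1 ⊆ T})) := by
  rw [isOpen_coinduced]
  have hTo : IsOpen (𝒢.src '' (T : Set G)) := 𝒢.isLocalHomeomorph_src.isOpenMap _ T.isOpen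
  let W : Set (Fin r → X) := {x | ∀ i, x i ∈ 𝒢.src '' (T : Set G)}
  have hW : IsOpen W := by
    have : W = ⋂ i, (fun x : Fin r → X => x i) ⁻¹' (𝒢.src '' (T : Set G)) := by
      ext x; simp [W]
    rw [this]
    exact isOpen_iInter_of_finite fun i => hTo.preimage (continuous_apply i)
  have hex : ∀ (x : W) (i : Fin r), ∃ γ ∈ (T : Set G), 𝒢.src γ = x.1 i := fun x i => x.2 i
  choose σ hσT hσs using hex
  have hσ : ∀ x, range (σ x) ⊆ (T : Set G) := fun x => range_subset_iff.2 (hσT x)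
  let f : W → 𝒢.SymPowTuple r := fun x =>
    ⟨σ x, T.injOn_src.mono (hσ x), T.injOn_rng.mono (hσ x)⟩
  have hf : Continuous f := by
    refine Continuous.subtype_mk (continuous_pi fun i => ?_) _
    rw [continuous_iff_continuousAt]
    intro x
    refine continuousAt_of_isOpenMap_injOn 𝒢.isLocalHomeomorph_src.isOpenMap T.isOpen T.injOn_src
      (Eventually.of_forall fun y => hσT y i) ?_
    simp only [hσs]
    exact ((continuous_apply i).comp continuous_subtype_val).continuousAt
  have hfs : ∀ x, src (SymPowArrow.mk 𝒢 (f x)) = SymPow.mk x.1 := by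
    intro x
    refine Subtype.ext ((range_comp _ _).symm.trans ?_)
    exact congrArg range (funext fun i => hσs x i)
  have himg : SymPow.mk ⁻¹' (src '' (V ∩ {Q | Q.1 ⊆ T})) =
      Subtype.val '' (f ⁻¹' (SymPowArrow.mk 𝒢 ⁻¹' V)) := by
    ext x
    constructor
    · rintro ⟨Q, ⟨hQV, hQT⟩, hQx⟩
      have hsx : 𝒢.src '' Q.1 = range x := congrArg Subtype.val hQx
      have hx : x ∈ W := by
        intro i
        have : x i ∈ 𝒢.src '' Q.1 := by rw [hsx]; exact ⟨i, rfl⟩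
        exact image_mono hQT this
      refine ⟨⟨x, hx⟩, ?_, rfl⟩
      have : SymPowArrow.mk 𝒢 (f ⟨x, hx⟩) = Q :=
        injOn_src_subset T.injOn_src (hσ ⟨x, hx⟩) hQT ((hfs ⟨x, hx⟩).trans hQx.symm)
      change SymPowArrow.mk 𝒢 (f ⟨x, hx⟩) ∈ V
      rw [this]
      exact hQV
    · rintro ⟨y, hy, rfl⟩
      exact ⟨_, ⟨hy, hσ y⟩, hfs y⟩
  rw [himg]
  exact hW.isOpenMap_subtype_val _ ((hV.preimage continuous_mk).preimage hf)

theorem isOpenMap_src : IsOpenMap (src : 𝒢.SymPowArrow r → SymPow X r) := by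
  intro V hV
  have : src '' V = ⋃ T : 𝒢.Bisection, src '' (V ∩ {Q | Q.1 ⊆ T}) := by
    rw [← image_iUnion, ← inter_iUnion]
    congr 1
    refine (inter_eq_left.2 fun Q _ => ?_).symm
    obtain ⟨T, hT⟩ := exists_bisection Q
    exact mem_iUnion.2 ⟨T, hT⟩
  rw [this]
  exact isOpen_iUnion fun T => isOpen_src_image T hV

theorem isLocalHomeomorph_src : IsLocalHomeomorph (src : 𝒢.SymPowArrow r → SymPow X r) := by
  rw [isLocalHomeomorph_iff_isOpenEmbedding_restrict]
  intro Q
  obtain ⟨T, hT⟩ := exists_bisection Q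
  have ho : IsOpen {P : 𝒢.SymPowArrow r | P.1 ⊆ T} := isOpen_subset T.isOpen
  refine ⟨_, ho.mem_nhds hT, IsOpenEmbedding.of_continuous_injective_isOpenMap
    (continuous_src.comp continuous_subtype_val) ?_ (isOpenMap_src.comp ho.isOpenMap_subtype_val)⟩
  intro P P' h
  exact Subtype.ext (injOn_src_subset T.injOn_src P.2 P'.2 h)

theorem inv_inv (Q : 𝒢.SymPowArrow r) : inv (inv Q) = Q := by
  apply Subtype.ext
  ext γ
  change γ ∈ 𝒢.setInv (𝒢.setInv Q.1) ↔ _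
  rw [𝒢.mem_setInv, 𝒢.mem_setInv, 𝒢.inv_inv]

theorem isLocalHomeomorph_rng : IsLocalHomeomorph (rng : 𝒢.SymPowArrow r → SymPow X r) := by
  let e : 𝒢.SymPowArrow r ≃ₜ 𝒢.SymPowArrow r :=
    { toFun := inv
      invFun := inv
      left_inv := inv_inv
      right_inv := inv_inv
      continuous_toFun := continuous_inv
      continuous_invFun := continuous_inv }
  have : (rng : 𝒢.SymPowArrow r → SymPow X r) = src ∘ e := by
    funext Q
    exact Subtype.ext (𝒢.src_image_setInv Q.1).symm
  rw [this]
  exact isLocalHomeomorph_src.comp e.isLocalHomeomorph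

theorem src_mul (Q P : 𝒢.SymPowArrow r) (h : src Q = rng P) : src (mul Q P h) = src P :=
  Subtype.ext (𝒢.src_image_setMul (congrArg Subtype.val h).symm.subset)

theorem rng_mul (Q P : 𝒢.SymPowArrow r) (h : src Q = rng P) : rng (mul Q P h) = rng Q :=
  Subtype.ext (𝒢.rng_image_setMul (congrArg Subtype.val h).subset)

theorem continuous_mul : Continuous
    fun p : {p : 𝒢.SymPowArrow r × 𝒢.SymPowArrow r // src p.1 = rng p.2} =>
      mul p.1.1 p.1.2 p.2 := by
  rw [continuous_iff_continuousAt]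
  rintro ⟨⟨Q, P⟩, h⟩
  obtain ⟨T, hT⟩ := exists_bisection Q
  obtain ⟨S, hS⟩ := exists_bisection P
  refine continuousAt_of_isOpenMap_injOn isOpenMap_src (isOpen_subset (T * S).isOpen)
    (injOn_src_subset (T * S).injOn_src) ?_ ?_
  · have h1 : ∀ᶠ p : {p : 𝒢.SymPowArrow r × 𝒢.SymPowArrow r // src p.1 = rng p.2} in
        𝓝 ⟨(Q, P), h⟩, p.1.1.1 ⊆ T :=
      ((isOpen_subset T.isOpen).preimage
        (continuous_fst.comp continuous_subtype_val)).mem_nhds hT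
    have h2 : ∀ᶠ p : {p : 𝒢.SymPowArrow r × 𝒢.SymPowArrow r // src p.1 = rng p.2} in
        𝓝 ⟨(Q, P), h⟩, p.1.2.1 ⊆ S :=
      ((isOpen_subset S.isOpen).preimage
        (continuous_snd.comp continuous_subtype_val)).mem_nhds hS
    filter_upwards [h1, h2] with p hp1 hp2
    exact 𝒢.setMul_mono hp1 hp2
  · simp only [src_mul]
    exact (continuous_src.comp (continuous_snd.comp continuous_subtype_val)).continuousAt

end SymPowArrow

/-- The symmetric power `𝒢^{[r]}`, an étale groupoid over `X^{[r]}`. -/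
def symPow (r : ℕ) : EtaleGroupoid (𝒢.SymPowArrow r) (SymPow X r) where
  src := SymPowArrow.src
  rng := SymPowArrow.rng
  unit := SymPowArrow.unit 𝒢
  mul := SymPowArrow.mul
  inv := SymPowArrow.inv
  src_unit A := Subtype.ext (by simp [SymPowArrow.src, SymPowArrow.unit, image_image, 𝒢.src_unit])
  rng_unit A := Subtype.ext (by simp [SymPowArrow.rng, SymPowArrow.unit, image_image, 𝒢.rng_unit])
  src_mul := SymPowArrow.src_mul
  rng_mul := SymPowArrow.rng_mul
  mul_assoc Q P R _ _ := Subtype.ext (𝒢.setMul_assoc Q.1 P.1 R.1)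
  unit_mul Q := Subtype.ext (𝒢.unit_setMul Subset.rfl)
  mul_unit Q := Subtype.ext (𝒢.setMul_unit Subset.rfl)
  src_inv Q := Subtype.ext (𝒢.src_image_setInv Q.1)
  rng_inv Q := Subtype.ext (𝒢.rng_image_setInv Q.1)
  inv_mul Q := Subtype.ext (𝒢.setInv_setMul Q.2.2.2)
  mul_inv Q := Subtype.ext (𝒢.setMul_setInv Q.2.2.1)
  t2 := haveI := 𝒢.t2; inferInstance
  continuous_unit := SymPowArrow.continuous_unit
  continuous_inv := SymPowArrow.continuous_inv
  continuous_mul := SymPowArrow.continuous_mul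
  isLocalHomeomorph_src := SymPowArrow.isLocalHomeomorph_src
  isLocalHomeomorph_rng := SymPowArrow.isLocalHomeomorph_rng

variable {𝒢} in
/-- The bisection `T^{[r]} = {Q ∈ 𝒢^{[r]} : Q ⊆ T}` of the symmetric power. -/
def Bisection.symPow (T : 𝒢.Bisection) (r : ℕ) : (𝒢.symPow r).Bisection where
  carrier := {Q | Q.1 ⊆ T}
  isOpen := SymPowArrow.isOpen_subset T.isOpen
  injOn_src := SymPowArrow.injOn_src_subset T.injOn_src
  injOn_rng := SymPowArrow.injOn_rng_subset T.injOn_rng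

end EtaleGroupoid

/-! ## Continuous morphisms, supports and extensions -/

/-- A continuous morphism between the pseudogroups of two étale groupoids: a homomorphism of
monoids preserving the zero and the unions of compatible families. -/
structure ContinuousMorphism {G X H Y : Type*} [TopologicalSpace G] [TopologicalSpace X]
    [TopologicalSpace H] [TopologicalSpace Y] (𝒢 : EtaleGroupoid G X) (ℋ : EtaleGroupoid H Y)
    extends 𝒢.Bisection →* ℋ.Bisection where
  map_empty : toFun ∅ = ∅
  map_sUnion : ∀ (𝒯 : Set 𝒢.Bisection)
    (h𝒯 : ∀ T ∈ 𝒯, ∀ S ∈ 𝒯, EtaleGroupoid.Bisection.Compatible T S),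
    (toFun (EtaleGroupoid.Bisection.sUnion 𝒯 h𝒯) : Set H) = ⋃ T ∈ 𝒯, (toFun T : Set H)

namespace EtaleGroupoid

variable {G X H Y : Type*} [TopologicalSpace G] [TopologicalSpace X] [TopologicalSpace H]
  [TopologicalSpace Y] {𝒢 : EtaleGroupoid G X} {ℋ : EtaleGroupoid H Y}

/-- The support `{y : [g]_y ≠ y}` of an element of the full group, where the germ `[g]_y` is the
arrow of `g` with source `y`; it is the unit at `y` exactly if `g` contains this unit. -/
def FullGroup.support (g : ℋ.FullGroup) : Set Y := {y | ℋ.unit y ∉ g.1}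

/-- The support of a subgroup of the full group. -/
def supportOf (K : Subgroup ℋ.FullGroup) : Set Y := closure (⋃ k ∈ K, FullGroup.support k)

/-- The morphism `φ` extends `ρ`: for all `g ∈ A(𝒢)`, viewed as the bisection `g^{[r]}` of `𝒢^{[r]}`,
`φ(g^{[r]})` is `ρ(g)`. Here a bisection `S` of `ℋ|Z` with full source and range is identified with
the element `S ∪ (Y ∖ Z)` of the full group of `ℋ`. -/
def Extends (ρ : 𝒢.alternatingFullGroup →* ℋ.FullGroup) {Z : Set Y} {hZ : IsOpen Z} {r : ℕ}
    (φ : ContinuousMorphism (𝒢.symPow r) (ℋ.restrict Z hZ)) : Prop :=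
  ∀ g : 𝒢.alternatingFullGroup, ((ρ g).1 : Set H) =
    (Subtype.val : ℋ.RestrictArrow Z → H) ''
      (φ.toMonoidHom (g.1.1.symPow r) : Set (ℋ.RestrictArrow Z)) ∪ ℋ.unit '' Zᶜ

end EtaleGroupoid

/-!
Write `A` for the alternating full group of `𝒢`. For a point `y` of `Y` let `L y ≤ A` be the group of
those `g` for which `ρ g` has the trivial germ at `y` (`germStabilizer`). The idea is that the
group `L y` is governed by germs at a finite set `S y ⊆ X`, so that `y ↦ S y` is the map on unit
spaces underlying the wanted morphism, and that finiteness is forced by asymptotic dimension.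

*Finite dimension.* The map `a ↦ germ of ρ a at y` embeds `A ⧸ L y` coarsely into the leaf at `y`, so
this coset space has finite dimension in the sense of `CosetDimLE`
(`EtaleGroupoid.cosetDimLE_germStabilizer`). For an open set `U ⊆ X` let `altRist A U` be the group
generated by the three-cycles supported in `U`; it is simple (`altRist_eq_bot_or_eq_top`). If the
groups `altRist A (U i)` of `n + 1` disjoint clopen sets were all not contained in a subgroup `L`,
then, by simplicity, finitely generated subgroups of them would have arbitrarily long paths in the
coset spaces (`exists_long_path`). The products of these paths are `(n + 1)`-dimensional grids in
`A ⧸ L`. The discrete Poincaré–Miranda theorem `CubicalGrid.exists_unitCube`, which is proved with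
cup products of `0`-cochains modulo two, shows that such a space does not have dimension `n`
(`not_cosetDimLE_of_grid`). Hence `L` contains one of any `n + 1` such groups
(`exists_altRist_le_of_cosetDimLE`).

*The finite set.* Let `S y` be the set of points of `X` all of whose clopen neighbourhoods `O` have
`altRist A O` not contained in `L y` (`subgroupSupport`). By the previous paragraph `S y` has at most
as many points as the dimension of the leaf (`encard_subgroupSupport_le`), and `L y` contains
`altRist A V` for every clopen `V` disjoint from `S y` (`altRist_le_of_disjoint_subgroupSupport`).
Elements of `A` acting trivially near a finite set `S` are products of three-cycles supported off `S`
(`mem_altStabilizer_of_eventually`), so `L y` contains everything that acts trivially near `S y`: the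
germ of `ρ g` at `y` depends only on the germs of `g` at the points of `S y`. The sets `S y` are
equivariant, depend continuously on `y`, and have bounded cardinality, since otherwise compactness
of `Y` would produce a dense one (`IsStabilizerField.exists_encard_support_le`). They are empty
exactly where `L y = A`; so the support `Z` of `ρ` is the clopen set on which `S y` is not empty, and
`r` is the largest cardinality that occurs.

*The morphism.* A bisection `T` of `𝒢.symPow r` is sent to the set of germs of elements `ρ g` at
points `y` of `Z` for which the set of germs of `g` at the points of `S y` belongs to `T`
(`EtaleGroupoid.exists_continuousMorphism_extends`). Conversely, a continuous morphism is given on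
idempotents by a map between the unit spaces, which for an extension of `ρ` has to be `y ↦ S y`
(`EtaleGroupoid.Extends.unit_mem_iff`). Since every element of `𝒢.symPow r` is contained in an
element of `A`, each bisection is a union of restrictions of bisections `g ^ [r]`, and the extension
is unique (`EtaleGroupoid.Extends.unique`).
-/

set_option linter.unusedSectionVars false

/-! ### A discrete Poincaré–Miranda theorem -/

namespace CubicalGrid

/-- Sum of the cochain `W` over the faces of the ordered simplex `l`. -/
def boundarySum {V : Type*} : List V → (List V → ZMod 2) → ZMod 2
  | [], _ => 0
  | u :: l, W => W l + boundarySum l fun τ => W (u :: τ)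

/-- Sum of the cochain `W` over the standard triangulation of the prism with base the simplex `l`,
in which the coordinate `k` runs from `t` to `t + 1`. -/
def prismSum (k t : ℕ) : List (ℕ → ℕ) → (List (ℕ → ℕ) → ZMod 2) → ZMod 2
  | [], _ => 0
  | u :: l, W => W (Function.update u k t :: Function.update u k (t + 1) ::
      l.map fun v => Function.update v k (t + 1)) +
      prismSum k t l fun τ => W (Function.update u k t :: τ)

/-- Sum of the cochain `W` over the triangulation of `[0, m] ^ k` obtained from a point by taking
prisms successively in the coordinates `0, …, k - 1`. -/
def gridSum (m : ℕ) : ℕ → (List (ℕ → ℕ) → ZMod 2) → ZMod 2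
  | 0, W => W [fun _ => 0]
  | k + 1, W => gridSum m k fun l => ∑ t ∈ Finset.range m, prismSum k t l W

/-- The cup product `δa₍ₖ₋₁₎ ∪ ⋯ ∪ δa₀` of coboundaries of `0`-cochains, defined recursively as the
coboundary of `a₍ₖ₋₁₎ ∪ (δa₍ₖ₋₂₎ ∪ ⋯ ∪ δa₀)`. -/
def cupSum (a : ℕ → (ℕ → ℕ) → ZMod 2) : ℕ → List (ℕ → ℕ) → ZMod 2
  | 0, l => if l.length = 1 then 1 else 0
  | k + 1, l => boundarySum l fun τ => match τ with
    | [] => 0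
    | v :: τ' => a k v * cupSum a k (v :: τ')

/-- The cochain whose coboundary is `cupSum a (k + 1)`. -/
def cupPrimitive (a : ℕ → (ℕ → ℕ) → ZMod 2) (k : ℕ) : List (ℕ → ℕ) → ZMod 2
  | [] => 0
  | v :: τ => a k v * cupSum a k (v :: τ)

theorem cupSum_succ (a : ℕ → (ℕ → ℕ) → ZMod 2) (k : ℕ) (l : List (ℕ → ℕ)) :
    cupSum a (k + 1) l = boundarySum l (cupPrimitive a k) := by
  rw [cupSum]
  congr 1

theorem boundarySum_add {V : Type*} (l : List V) (W W' : List V → ZMod 2) :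
    boundarySum l (fun τ => W τ + W' τ) = boundarySum l W + boundarySum l W' := by
  induction l generalizing W W' with
  | nil => simp [boundarySum]
  | cons u l ih => simp only [boundarySum, ih]; ring

theorem boundarySum_mul {V : Type*} (l : List V) (c : ZMod 2) (W : List V → ZMod 2) :
    boundarySum l (fun τ => c * W τ) = c * boundarySum l W := by
  induction l generalizing W with
  | nil => simp [boundarySum]
  | cons u l ih => simp only [boundarySum, ih]; ring

theorem boundarySum_zero {V : Type*} (l : List V) : boundarySum l (fun _ => 0) = 0 := by
  induction l with
  | nil => simp [boundarySum]
  | cons u l ih => simp only [boundarySum, ih]; ring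

theorem boundarySum_finsetSum {V ι : Type*} (l : List V) (s : Finset ι)
    (W : ι → List V → ZMod 2) :
    boundarySum l (fun τ => ∑ t ∈ s, W t τ) = ∑ t ∈ s, boundarySum l (W t) := by
  classical
  induction s using Finset.induction_on with
  | empty => simp [boundarySum_zero]
  | insert i s hi ih => simp only [Finset.sum_insert hi, boundarySum_add, ih]

theorem boundarySum_map {V : Type*} (f : V → V) (l : List V) (W : List V → ZMod 2) :
    boundarySum (l.map f) W = boundarySum l fun τ => W (τ.map f) := by
  induction l generalizing W with
  | nil => simp [boundarySum]
  | cons u l ih => simp [boundarySum, ih]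

theorem boundarySum_boundarySum {V : Type*} (l : List V) (W : List V → ZMod 2) :
    boundarySum l (fun τ => boundarySum τ W) = 0 := by
  induction l generalizing W with
  | nil => simp [boundarySum]
  | cons u l ih =>
    simp only [boundarySum, boundarySum_add, ih, add_zero]
    exact CharTwo.add_self_eq_zero _

theorem prismSum_add (k t : ℕ) (l : List (ℕ → ℕ)) (W W' : List (ℕ → ℕ) → ZMod 2) :
    prismSum k t l (fun τ => W τ + W' τ) = prismSum k t l W + prismSum k t l W' := by
  induction l generalizing W W' with
  | nil => simp [prismSum]
  | cons u l ih => simp only [prismSum, ih]; ring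

theorem gridSum_add (m k : ℕ) (W W' : List (ℕ → ℕ) → ZMod 2) :
    gridSum m k (fun τ => W τ + W' τ) = gridSum m k W + gridSum m k W' := by
  induction k generalizing W W' with
  | zero => rfl
  | succ k ih => simp only [gridSum, prismSum_add, Finset.sum_add_distrib, ih]

/-- The boundary of a prism: its top, its bottom, and the prism over the boundary of the base. -/
theorem prismSum_boundarySum (k t : ℕ) (l : List (ℕ → ℕ)) (W : List (ℕ → ℕ) → ZMod 2) :
    prismSum k t l (fun σ => boundarySum σ W) =
      W (l.map fun v => Function.update v k (t + 1)) + W (l.map fun v => Function.update v k t) +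
        boundarySum l fun τ => prismSum k t τ W := by
  induction l generalizing W with
  | nil => simp [prismSum, boundarySum, CharTwo.add_self_eq_zero]
  | cons u l ih =>
    simp only [prismSum, boundarySum, prismSum_add, ih, boundarySum_add, List.map_cons,
      boundarySum_map]
    linear_combination (norm := ring_nf) CharTwo.add_self_eq_zero
      (W (Function.update u k t :: l.map fun v => Function.update v k (t + 1)))

theorem prismSum_eq_zero {k t : ℕ} {l : List (ℕ → ℕ)} {W : List (ℕ → ℕ) → ZMod 2}
    (h : ∀ σ, (∀ v ∈ σ, ∃ u ∈ l, ∃ s, (s = t ∨ s = t + 1) ∧ v = Function.update u k s) →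
      W σ = 0) : prismSum k t l W = 0 := by
  induction l generalizing W with
  | nil => rfl
  | cons u l ih =>
    rw [prismSum, h, ih, add_zero]
    · intro σ hσ
      apply h
      intro v hv
      rcases List.mem_cons.1 hv with rfl | hv
      · exact ⟨u, by simp, t, by simp, rfl⟩
      · obtain ⟨w, hw, s, hs, rfl⟩ := hσ v hv
        exact ⟨w, by simp [hw], s, hs, rfl⟩
    · intro v hv
      simp only [List.mem_cons, List.mem_map] at hv
      rcases hv with rfl | rfl | ⟨w, hw, rfl⟩
      · exact ⟨u, by simp, t, by simp, rfl⟩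
      · exact ⟨u, by simp, t + 1, by simp, rfl⟩
      · exact ⟨w, by simp [hw], t + 1, by simp, rfl⟩

/-- A cochain vanishing on all simplices contained in unit cubes has sum zero over the grid. -/
theorem gridSum_eq_zero {m k : ℕ} {W : List (ℕ → ℕ) → ZMod 2}
    (h : ∀ σ : List (ℕ → ℕ), (∃ b : ℕ → ℕ, ∀ j < k, b j < m ∧ ∀ v ∈ σ, b j ≤ v j ∧ v j ≤ b j + 1) →
      W σ = 0) : gridSum m k W = 0 := by
  induction k generalizing W with
  | zero => exact h _ ⟨0, by simp⟩
  | succ k ih =>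
    apply ih
    rintro l ⟨b, hb⟩
    refine Finset.sum_eq_zero fun t ht => prismSum_eq_zero fun σ hσ => h σ
      ⟨Function.update b k t, fun j hj => ?_⟩
    rcases eq_or_ne j k with rfl | hjk
    · refine ⟨by simpa using ht, fun v hv => ?_⟩
      obtain ⟨u, -, s, hs, rfl⟩ := hσ v hv
      simp only [Function.update_self]
      omega
    · have hj' := hb j (by omega)
      simp only [Function.update_of_ne hjk]
      refine ⟨hj'.1, fun v hv => ?_⟩
      obtain ⟨u, hu, s, hs, rfl⟩ := hσ v hv
      rw [Function.update_of_ne hjk]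
      exact hj'.2 u hu

theorem gridSum_succ_boundarySum (m k : ℕ) (W : List (ℕ → ℕ) → ZMod 2) :
    gridSum m (k + 1) (fun σ => boundarySum σ W) =
      gridSum m k (fun l => W (l.map fun v => Function.update v k m) +
        W (l.map fun v => Function.update v k 0)) +
      gridSum m k (fun l => boundarySum l
        fun τ => ∑ t ∈ Finset.range m, prismSum k t τ W) := by
  rw [gridSum, ← gridSum_add]
  congr 1
  funext l
  simp only [prismSum_boundarySum, Finset.sum_add_distrib, boundarySum_finsetSum]
  congr 1
  rw [← Finset.sum_add_distrib]
  induction m with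
  | zero => simp [CharTwo.add_self_eq_zero]
  | succ m ih =>
    rw [Finset.sum_range_succ, ih]
    linear_combination (norm := ring_nf) CharTwo.add_self_eq_zero
      (W (l.map fun v => Function.update v k m))

/-- The boundary of the grid is supported on its faces. -/
theorem gridSum_boundarySum_eq_zero {m k : ℕ} {W : List (ℕ → ℕ) → ZMod 2} (h0 : W [] = 0)
    (h : ∀ j < k, ∀ c, (c = 0 ∨ c = m) → ∀ σ : List (ℕ → ℕ), (∀ v ∈ σ, v j = c) → W σ = 0) :
    gridSum m k (fun σ => boundarySum σ W) = 0 := by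
  induction k generalizing W with
  | zero => simpa [gridSum, boundarySum] using h0
  | succ k ih =>
    rw [gridSum_succ_boundarySum, ih, add_zero]
    · refine gridSum_eq_zero fun l _ => ?_
      rw [h k (by omega) m (Or.inr rfl), h k (by omega) 0 (Or.inl rfl), add_zero]
      · simp
      · simp
    · exact Finset.sum_eq_zero fun _ _ => rfl
    · intro j hj c hc σ hσ
      refine Finset.sum_eq_zero fun t _ => prismSum_eq_zero fun τ hτ =>
        h j (by omega) c hc τ fun v hv => ?_
      obtain ⟨u, hu, s, -, rfl⟩ := hτ v hv
      rw [Function.update_of_ne (by omega)]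
      exact hσ u hu

theorem boundarySum_cupSum (a : ℕ → (ℕ → ℕ) → ZMod 2) (k : ℕ) (l : List (ℕ → ℕ)) :
    boundarySum l (cupSum a k) = 0 := by
  cases k with
  | zero =>
    match l with
    | [] => rfl
    | [v] => simp [boundarySum, cupSum]
    | [v, w] => simp only [boundarySum, cupSum, List.length]; decide
    | v :: w :: x :: l =>
      suffices ∀ (l l' : List (ℕ → ℕ)), 3 ≤ l.length + l'.length →
          boundarySum l (fun τ => cupSum a 0 (l' ++ τ)) = 0 from
            this (v :: w :: x :: l) [] (by simp)
      intro l
      induction l with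
      | nil => intros; rfl
      | cons u l ih =>
        intro l' hl
        have := ih (l' ++ [u]) (by simp at hl ⊢; omega)
        simp only [List.append_assoc, List.singleton_append] at this
        rw [boundarySum, this, add_zero, cupSum, if_neg]
        simp at hl ⊢
        omega
  | succ k =>
    have : cupSum a (k + 1) = fun l => boundarySum l (cupPrimitive a k) :=
      funext fun l => cupSum_succ a k l
    rw [this]
    exact boundarySum_boundarySum _ _

theorem cupSum_cons_cons (a : ℕ → (ℕ → ℕ) → ZMod 2) (k : ℕ) (v w : ℕ → ℕ) (l : List (ℕ → ℕ)) :
    cupSum a (k + 1) (v :: w :: l) = (a k v + a k w) * cupSum a k (w :: l) := by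
  have h := boundarySum_cupSum a k (v :: w :: l)
  rw [boundarySum] at h
  rw [cupSum_succ, boundarySum]
  have : (fun τ => cupPrimitive a k (v :: τ)) = fun τ => a k v * cupSum a k (v :: τ) := rfl
  rw [this, boundarySum_mul, cupPrimitive, eq_neg_of_add_eq_zero_right h, ZMod.neg_eq_self_mod_two]
  ring

theorem cupSum_eq_zero {a : ℕ → (ℕ → ℕ) → ZMod 2} {k j : ℕ} (hj : j < k) {l : List (ℕ → ℕ)}
    (h : ∀ v ∈ l, ∀ w ∈ l, a j v = a j w) : cupSum a k l = 0 := by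
  induction k generalizing l with
  | zero => omega
  | succ k ih =>
    match l with
    | [] => rfl
    | [v] => simp [cupSum, boundarySum]
    | v :: w :: l =>
      rw [cupSum_cons_cons]
      rcases Nat.lt_succ_iff_lt_or_eq.1 hj with hj | rfl
      · rw [ih hj fun v hv w hw => h v (by simp [hv]) w (by simp [hw]), mul_zero]
      · rw [h v (by simp) w (by simp), CharTwo.add_self_eq_zero, zero_mul]

theorem cupSum_congr {a a' : ℕ → (ℕ → ℕ) → ZMod 2} {k : ℕ} {f : (ℕ → ℕ) → ℕ → ℕ}
    (h : ∀ j < k, ∀ v, a j (f v) = a' j v) (l : List (ℕ → ℕ)) :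
    cupSum a k (l.map f) = cupSum a' k l := by
  induction k generalizing l with
  | zero => simp [cupSum]
  | succ k ih =>
    match l with
    | [] => rfl
    | [v] => simp [cupSum, boundarySum]
    | v :: w :: l =>
      simp only [List.map_cons, cupSum_cons_cons]
      rw [h k (by omega), h k (by omega), ← List.map_cons, ih fun j hj => h j (by omega)]

/-- The cup product of the coboundaries, evaluated on the grid, is the product of the winding
numbers in the coordinate directions. -/
theorem gridSum_cupSum {m k : ℕ} {a : ℕ → (ℕ → ℕ) → ZMod 2}
    (h0 : ∀ j < k, ∀ v : ℕ → ℕ, v j = 0 → a j v = 0)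
    (h1 : ∀ j < k, ∀ v : ℕ → ℕ, v j = m → a j v = 1) : gridSum m k (cupSum a k) = 1 := by
  induction k generalizing a with
  | zero => simp [gridSum, cupSum]
  | succ k ih =>
    have hc : ∀ j < k, ∀ c, (c = 0 ∨ c = m) → ∀ σ : List (ℕ → ℕ), (∀ v ∈ σ, v j = c) →
        cupPrimitive a k σ = 0 := by
      intro j hj c hc σ hσ
      match σ with
      | [] => rfl
      | v :: σ =>
        rw [cupPrimitive, cupSum_eq_zero hj, mul_zero]
        intro u hu w hw
        rcases hc with rfl | rfl
        · rw [h0 j (by omega) u (hσ u hu), h0 j (by omega) w (hσ w hw)]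
        · rw [h1 j (by omega) u (hσ u hu), h1 j (by omega) w (hσ w hw)]
    have hcup : cupSum a (k + 1) = fun l => boundarySum l (cupPrimitive a k) :=
      funext fun l => cupSum_succ a k l
    rw [hcup, gridSum_succ_boundarySum, gridSum_boundarySum_eq_zero, add_zero]
    · let a' : ℕ → (ℕ → ℕ) → ZMod 2 := fun j v => a j (Function.update v k m)
      rw [← ih (a := a')]
      · congr 1
        funext l
        have e0 : cupPrimitive a k (l.map fun v => Function.update v k 0) = 0 := by
          match l with
          | [] => rfl
          | v :: l =>
            simp only [List.map_cons, cupPrimitive]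
            rw [h0 k (by omega) _ (by simp), zero_mul]
        have e1 : cupPrimitive a k (l.map fun v => Function.update v k m) =
            cupSum a k (l.map fun v => Function.update v k m) := by
          match l with
          | [] => simp only [List.map_nil, cupPrimitive]; cases k <;> rfl
          | v :: l =>
            simp only [List.map_cons, cupPrimitive]
            rw [h1 k (by omega) _ (by simp), one_mul]
        rw [e0, e1, add_zero]
        exact cupSum_congr (fun j _ v => rfl) l
      · intro j hj v hv
        exact h0 j (by omega) _ (by rwa [Function.update_of_ne (by omega)])
      · intro j hj v hv
        exact h1 j (by omega) _ (by rwa [Function.update_of_ne (by omega)])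
    · exact Finset.sum_eq_zero fun _ _ => rfl
    · intro j hj c hc' σ hσ
      refine Finset.sum_eq_zero fun t _ => prismSum_eq_zero fun τ hτ =>
        hc j hj c hc' τ fun v hv => ?_
      obtain ⟨u, hu, s, -, rfl⟩ := hτ v hv
      rw [Function.update_of_ne (by omega)]
      exact hσ u hu

/-- Discrete Poincaré–Miranda theorem: if the `i`-th of `k` two-valued functions on the grid
`{0, …, m} ^ k` separates the two faces orthogonal to the `i`-th direction, for every `i`, then on
some unit cube none of these functions is constant. -/
theorem exists_unitCube {k m : ℕ} (p : Fin k → (Fin k → ℕ) → Prop)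
    (h0 : ∀ i x, x i = 0 → ¬ p i x) (h1 : ∀ i x, x i = m → p i x) :
    ∃ b : Fin k → ℕ, (∀ j, b j < m) ∧ ∀ i, ¬ ∃ c : Prop, ∀ x : Fin k → ℕ,
      (∀ j, b j ≤ x j ∧ x j ≤ b j + 1) → (p i x ↔ c) := by
  classical
  by_contra! hcon
  let a : ℕ → (ℕ → ℕ) → ZMod 2 := fun j v =>
    if h : j < k then (if p ⟨j, h⟩ (fun i => v i) then 1 else 0) else 0
  have hs := gridSum_cupSum (m := m) (k := k) (a := a)
    (by
      intro j hj v hv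
      simp only [a, dif_pos hj]
      rw [if_neg (h0 ⟨j, hj⟩ _ hv)])
    (by
      intro j hj v hv
      simp only [a, dif_pos hj]
      rw [if_pos (h1 ⟨j, hj⟩ _ hv)])
  rw [gridSum_eq_zero] at hs
  · exact zero_ne_one hs
  · rintro σ ⟨b, hb⟩
    obtain ⟨i, c, hc⟩ := hcon (fun j => b j) fun j => (hb j j.2).1
    refine cupSum_eq_zero i.2 fun v hv w hw => ?_
    have hv' := hc (fun j => v j) fun j => (hb j j.2).2 v hv
    have hw' := hc (fun j => w j) fun j => (hb j j.2).2 w hw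
    simp only [a, dif_pos i.2, Fin.eta, hv', hw']

end CubicalGrid

/-! ### Group actions generated by three-cycles -/

section ThreeCycle

variable {A X : Type*} [Group A] [TopologicalSpace X] [MulAction A X]

/-- The group element `c` permutes the three disjoint clopen sets `B`, `c B`, `c² B` cyclically, and
fixes all other points. -/
structure IsThreeCycle (c : A) (B : Set X) : Prop where
  isClopen : IsClopen B
  smul_notMem : ∀ x ∈ B, c • x ∉ B
  smul_smul_notMem : ∀ x ∈ B, c • c • x ∉ B
  smul_cube : ∀ x ∈ B, c • c • c • x = x
  smul_eq : ∀ x, x ∉ B → c • x ∉ B → c • c • x ∉ B → c • x = x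

variable (A X) in
/-- An action by homeomorphisms which behaves like the one of an alternating full group: it is
faithful with dense orbits, any two group elements can be combined into a three-cycle over a clopen
set on which this makes sense, and the three-cycles generate. Moreover some finitely generated
subgroup has the same orbits as the whole group. -/
class IsAlternatingAction : Prop extends ContinuousConstSMul A X, FaithfulSMul A X where
  exists_isThreeCycle : ∀ (f h : A) (B : Set X), IsClopen B → (∀ x ∈ B, f • x ∉ B) →
    (∀ x ∈ B, h • x ∉ B) → (∀ x ∈ B, ∀ y ∈ B, f • x ≠ h • y) →
    ∃ c : A, IsThreeCycle c B ∧ ∀ x ∈ B, c • x = f • x ∧ c • c • x = h • x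
  closure_isThreeCycle : Subgroup.closure {c : A | ∃ B : Set X, IsThreeCycle c B} = ⊤
  dense_orbit : ∀ x : X, Dense (MulAction.orbit A x)
  exists_finite : ∃ S : Set A, S.Finite ∧ ∀ (x : X) (a : A), ∃ s ∈ Subgroup.closure S, s • x = a • x

variable (A) in
/-- The subgroup generated by the three-cycles supported in `V`. -/
def altRist (V : Set X) : Subgroup A :=
  Subgroup.closure {c | (∃ B : Set X, IsThreeCycle c B) ∧ ∀ x ∉ V, c • x = x}

namespace IsThreeCycle

variable {c : A} {B : Set X}

theorem smul_eq_of_forall_ne (h : IsThreeCycle c B) {x : X} (h0 : x ∉ B) (h1 : ∀ z ∈ B, c • z ≠ x)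
    (h2 : ∀ z ∈ B, c • c • z ≠ x) : c • x = x := by
  refine h.smul_eq x h0 (fun hx => h2 _ hx ?_) (fun hx => h1 _ hx ?_)
  · have := h.smul_cube _ hx
    exact smul_left_cancel c this
  · have := h.smul_cube _ hx
    exact smul_left_cancel c (smul_left_cancel c this)

theorem smul_cube' (h : IsThreeCycle c B) (x : X) : c • c • c • x = x := by
  by_cases h0 : x ∈ B
  · exact h.smul_cube x h0
  by_cases h1 : c • x ∈ B
  · exact smul_left_cancel c (h.smul_cube _ h1)
  by_cases h2 : c • c • x ∈ B
  · exact smul_left_cancel c (smul_left_cancel c (h.smul_cube _ h2))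
  have := h.smul_eq x h0 h1 h2
  rw [this, this, this]

theorem smul_ne (h : IsThreeCycle c B) {x : X} (hx : x ∈ B ∨ c • x ∈ B ∨ c • c • x ∈ B) :
    c • x ≠ x := by
  intro he
  have hB : x ∈ B := by
    rcases hx with hx | hx | hx
    · exact hx
    · rwa [he] at hx
    · rwa [he, he] at hx
  exact h.smul_notMem x hB (by rwa [he])

theorem inv_smul (h : IsThreeCycle c B) (x : X) : c⁻¹ • x = c • c • x := by
  rw [inv_smul_eq_iff, h.smul_cube']

theorem inv (h : IsThreeCycle c B) : IsThreeCycle c⁻¹ B where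
  isClopen := h.isClopen
  smul_notMem x hx := by rw [h.inv_smul]; exact h.smul_smul_notMem x hx
  smul_smul_notMem x hx := by
    rw [h.inv_smul, h.inv_smul, h.smul_cube']; exact h.smul_notMem x hx
  smul_cube x hx := by simp only [h.inv_smul, h.smul_cube']
  smul_eq x h0 h1 h2 := by
    rw [h.inv_smul] at h1 h2 ⊢
    rw [h.inv_smul, h.smul_cube'] at h2
    rw [h.smul_eq x h0 h2 h1, h.smul_eq x h0 h2 h1]

theorem conj [ContinuousConstSMul A X] (h : IsThreeCycle c B) (g : A) :
    IsThreeCycle (g * c * g⁻¹) ((fun x => g⁻¹ • x) ⁻¹' B) where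
  isClopen := h.isClopen.preimage (continuous_const_smul _)
  smul_notMem x hx := by simpa [mul_smul] using h.smul_notMem _ hx
  smul_smul_notMem x hx := by simpa [mul_smul] using h.smul_smul_notMem _ hx
  smul_cube x hx := by
    have := h.smul_cube _ hx
    simp only [mul_smul, inv_smul_smul, this, smul_inv_smul]
  smul_eq x h0 h1 h2 := by
    simp only [mem_preimage, mul_smul, inv_smul_smul] at h0 h1 h2
    rw [mul_smul, mul_smul, h.smul_eq _ h0 h1 h2, smul_inv_smul]

end IsThreeCycle

theorem smul_eq_of_mem_altRist {V : Set X} {g : A} (hg : g ∈ altRist A V) :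
    ∀ x ∉ V, g • x = x := by
  induction hg using Subgroup.closure_induction with
  | mem g hg => exact hg.2
  | one => simp
  | mul a b _ _ ha hb => intro x hx; rw [mul_smul, hb x hx, ha x hx]
  | inv a _ ha => intro x hx; rw [inv_smul_eq_iff, ha x hx]

theorem smul_mem_of_mem_altRist {V : Set X} {g : A} (hg : g ∈ altRist A V) {x : X} (hx : x ∈ V) :
    g • x ∈ V := by
  by_contra h
  have := smul_eq_of_mem_altRist ((altRist A V).inv_mem hg) _ h
  rw [inv_smul_smul] at this
  exact h (this ▸ hx)

theorem altRist_mono {V W : Set X} (h : V ⊆ W) : altRist A V ≤ altRist A W :=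
  Subgroup.closure_mono fun _ hc => ⟨hc.1, fun x hx => hc.2 x fun hV => hx (h hV)⟩

theorem IsThreeCycle.mem_altRist {c : A} {B V : Set X} (h : IsThreeCycle c B)
    (hV : ∀ x ∈ B, x ∈ V ∧ c • x ∈ V ∧ c • c • x ∈ V) : c ∈ altRist A V :=
  Subgroup.subset_closure ⟨⟨B, h⟩, fun _ hx => h.smul_eq_of_forall_ne (fun hB => hx (hV _ hB).1)
    (fun z hz e => hx (e ▸ (hV z hz).2.1)) fun z hz e => hx (e ▸ (hV z hz).2.2)⟩

theorem conj_mem_altRist [ContinuousConstSMul A X] {V : Set X} {c : A} (hc : c ∈ altRist A V)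
    (g : A) : g * c * g⁻¹ ∈ altRist A ((fun x => g⁻¹ • x) ⁻¹' V) := by
  induction hc using Subgroup.closure_induction with
  | mem c hc =>
    obtain ⟨⟨B, hB⟩, hV⟩ := hc
    refine Subgroup.subset_closure ⟨⟨_, hB.conj g⟩, fun x hx => ?_⟩
    rw [mul_smul, mul_smul, hV _ hx, smul_inv_smul]
  | one => simp
  | mul a b _ _ ha hb =>
    have := mul_mem ha hb
    simpa [mul_assoc] using this
  | inv a _ ha =>
    have := inv_mem ha
    simpa [mul_assoc] using this

theorem commute_of_forall_smul_eq [FaithfulSMul A X] {V : Set X} {g h : A}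
    (hgV : ∀ x ∉ V, g • x = x) (hhV : ∀ x ∈ V, h • x = x) : Commute g h := by
  have hmem : ∀ x ∈ V, g • x ∈ V := by
    intro x hx
    by_contra hn
    have h1 := hgV _ hn
    have h2 := smul_left_cancel g h1
    exact hn (h2.symm ▸ hx)
  have hmem' : ∀ x ∉ V, h • x ∉ V := by
    intro x hx hn
    have h1 := hhV _ hn
    have h2 := smul_left_cancel h h1
    exact hx (h2 ▸ hn)
  refine eq_of_smul_eq_smul (α := X) fun x => ?_
  rw [mul_smul, mul_smul]
  by_cases hx : x ∈ V
  · rw [hhV x hx, hhV _ (hmem x hx)]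
  · rw [hgV x hx, hgV _ (hmem' x hx)]

theorem commute_of_mem_altRist [FaithfulSMul A X] {V W : Set X} (hVW : Disjoint V W) {g h : A}
    (hg : g ∈ altRist A V) (hh : h ∈ altRist A W) : Commute g h :=
  commute_of_forall_smul_eq (smul_eq_of_mem_altRist hg) fun x hx =>
    smul_eq_of_mem_altRist hh x (Set.disjoint_left.1 hVW hx)

end ThreeCycle

/-- Finitely many distinct points of a Stone space have disjoint clopen neighbourhoods. -/
theorem exists_disjoint_isClopen {X ι : Type*} [TopologicalSpace X] [CompactSpace X] [T2Space X]
    [TotallyDisconnectedSpace X] [Finite ι] {x : ι → X} (hx : Function.Injective x)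
    {O : ι → Set X} (hO : ∀ i, IsOpen (O i)) (hxO : ∀ i, x i ∈ O i) :
    ∃ U : ι → Set X, (∀ i, IsClopen (U i)) ∧ (∀ i, x i ∈ U i) ∧ (∀ i, U i ⊆ O i) ∧
      Pairwise (Function.onFun Disjoint U) := by
  obtain ⟨W, hW, hWd⟩ := (finite_range x).t2_separation
  have hex : ∀ i, ∃ U : Set X, IsClopen U ∧ x i ∈ U ∧ U ⊆ O i ∩ W (x i) := fun i =>
    compact_exists_isClopen_in_isOpen ((hO i).inter (hW _).2) ⟨hxO i, (hW _).1⟩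
  choose U hU hxU hUO using hex
  refine ⟨U, hU, hxU, fun i => (hUO i).trans inter_subset_left, fun i j hij => ?_⟩
  exact (hWd ⟨i, rfl⟩ ⟨j, rfl⟩ (hx.ne hij)).mono ((hUO i).trans inter_subset_right)
    ((hUO j).trans inter_subset_right)

theorem infinite_of_isOpen (A : Type*) {X : Type*} [Group A] [TopologicalSpace X] [MulAction A X]
    [IsAlternatingAction A X] [CompactSpace X] [T1Space X] [Infinite X] {U : Set X} (hU : IsOpen U)
    (hne : U.Nonempty) : U.Infinite := by
  intro hfin
  obtain ⟨x, hx⟩ := hne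
  have hxo : IsOpen ({x} : Set X) := by
    have : ({x} : Set X) = U ∩ (U \ {x})ᶜ := by
      ext y; constructor
      · rintro rfl; simp [hx]
      · rintro ⟨h1, h2⟩; by_contra h; exact h2 ⟨h1, h⟩
    rw [this]
    exact hU.inter (hfin.subset sdiff_subset).isClosed.isOpen_compl
  have hdisc : ∀ y : X, IsOpen ({y} : Set X) := by
    intro y
    obtain ⟨z, hz, a, rfl⟩ :=
      (IsAlternatingAction.dense_orbit (A := A) y).inter_open_nonempty _ hxo ⟨x, rfl⟩
    have : ({y} : Set X) = (fun z => a • z) ⁻¹' {x} := by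
      ext w
      have hz' : a • y = x := hz
      rw [mem_preimage, mem_singleton_iff, mem_singleton_iff, ← hz', smul_left_cancel_iff]
    rw [this]
    exact hxo.preimage (continuous_const_smul a)
  have : DiscreteTopology X := discreteTopology_iff_forall_isOpen.2 fun s => by
    rw [← biUnion_of_singleton s]
    exact isOpen_biUnion fun y _ => hdisc y
  exact not_finite_iff_infinite.2 ‹Infinite X› finite_of_compact_of_discrete

section AlternatingAction

variable {A X : Type*} [Group A] [TopologicalSpace X] [MulAction A X] [IsAlternatingAction A X]
  [CompactSpace X] [T2Space X] [TotallyDisconnectedSpace X] [Infinite X]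

open IsAlternatingAction

variable (A) in
theorem exists_smul_mem (x : X) {O : Set X} (hO : IsOpen O) (hne : O.Nonempty) {F : Set X}
    (hF : F.Finite) : ∃ a : A, a • x ∈ O ∧ a • x ∉ F := by
  have h1 : (O \ F).Nonempty := (infinite_of_isOpen A hO hne).sdiff hF |>.nonempty
  obtain ⟨z, hz, a, rfl⟩ := (dense_orbit (A := A) x).inter_open_nonempty _
    (hO.sdiff hF.isClosed) h1
  exact ⟨a, hz⟩

theorem exists_isThreeCycle_near {f h : A} {x : X} (hf : f • x ≠ x) (hh : h • x ≠ x)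
    (hfh : f • x ≠ h • x) {O : Set X} (hO : IsOpen O) (hx : x ∈ O) :
    ∃ (B : Set X) (c : A), x ∈ B ∧ B ⊆ O ∧ IsThreeCycle c B ∧
      ∀ z ∈ B, c • z = f • z ∧ c • c • z = h • z := by
  obtain ⟨N, hN, hfN, hN'⟩ := compact_exists_isClopen_in_isOpen (x := f • x) (U := {x, h • x}ᶜ)
    (Set.toFinite _).isClosed.isOpen_compl (by simp [hf, hfh])
  obtain ⟨M, hM, hhM, hM'⟩ := compact_exists_isClopen_in_isOpen (x := h • x) (U := {x}ᶜ ∩ Nᶜ)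
    ((Set.toFinite _).isClosed.isOpen_compl.inter hN.compl.isOpen)
    ⟨by simp [hh], fun h => hN' h (by simp)⟩
  have hxN : x ∉ N := fun h => hN' h (by simp)
  have hxM : x ∉ M := fun h => (hM' h).1 (by simp)
  have cf : Continuous fun z : X => f • z := continuous_const_smul f
  have ch : Continuous fun z : X => h • z := continuous_const_smul h
  obtain ⟨B, hB, hxB, hBs⟩ := compact_exists_isClopen_in_isOpen (x := x)
    (U := O ∩ ((fun z => f • z) ⁻¹' N ∩ (fun z => h • z) ⁻¹' M) ∩ (Nᶜ ∩ Mᶜ))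
    ((hO.inter ((hN.isOpen.preimage cf).inter (hM.isOpen.preimage ch))).inter
      (hN.compl.isOpen.inter hM.compl.isOpen)) ⟨⟨hx, hfN, hhM⟩, hxN, hxM⟩
  obtain ⟨c, hc, hc'⟩ := exists_isThreeCycle f h B hB
    (fun z hz hz' => (hBs hz').2.1 (hBs hz).1.2.1) (fun z hz hz' => (hBs hz').2.2 (hBs hz).1.2.2)
    (fun z hz w hw e => (hM' (hBs hw).1.2.2).2 (by
      have := (hBs hz).1.2.1
      rw [mem_preimage, e] at this
      exact this))
  exact ⟨B, c, hxB, fun z hz => (hBs hz).1.1, hc, hc'⟩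

/-- A group element moving `x` inside the open set `V` agrees near `x` with a three-cycle supported
in `V`, which can be chosen to avoid a given finite set. -/
theorem exists_mem_altRist_of_ne {V : Set X} (hV : IsOpen V) {f : A} {x : X} (hx : x ∈ V)
    (hfx : f • x ∈ V) (hne : f • x ≠ x) {F : Set X} (hF : F.Finite) (hxF : x ∉ F)
    (hfF : f • x ∉ F) : ∃ g ∈ altRist A V, (∀ᶠ z in 𝓝 x, g • z = f • z) ∧ ∀ p ∈ F, g • p = p := by
  obtain ⟨h, hhV, hhF⟩ := exists_smul_mem A x hV ⟨x, hx⟩ (hF.union (Set.toFinite {x, f • x}))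
  simp only [mem_union, mem_insert_iff, mem_singleton_iff, not_or] at hhF
  have hVF : IsOpen (V ∩ Fᶜ) := hV.inter hF.isClosed.isOpen_compl
  obtain ⟨B, c, hxB, hBO, hc, hcB⟩ := exists_isThreeCycle_near hne hhF.2.1 (Ne.symm hhF.2.2)
    (O := (V ∩ Fᶜ) ∩ ((fun z => f • z) ⁻¹' (V ∩ Fᶜ) ∩ (fun z => h • z) ⁻¹' (V ∩ Fᶜ)))
    (hVF.inter ((hVF.preimage (continuous_const_smul f)).inter
      (hVF.preimage (continuous_const_smul h)))) ⟨⟨hx, hxF⟩, ⟨hfx, hfF⟩, hhV, hhF.1⟩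
  refine ⟨c, hc.mem_altRist fun z hz => ?_, ?_, fun p hp => ?_⟩
  · rw [(hcB z hz).2, (hcB z hz).1]
    exact ⟨(hBO hz).1.1, (hBO hz).2.1.1, (hBO hz).2.2.1⟩
  · filter_upwards [hc.isClopen.isOpen.mem_nhds hxB] with z hz using (hcB z hz).1
  · refine hc.smul_eq_of_forall_ne (fun h => (hBO h).1.2 hp) (fun z hz e => ?_) fun z hz e => ?_
    · rw [(hcB z hz).1] at e
      exact (hBO hz).2.1.2 (show f • z ∈ F by rwa [e])
    · rw [(hcB z hz).2] at e
      exact (hBO hz).2.2.2 (show h • z ∈ F by rwa [e])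

/-- The germ at `x` of a group element mapping a point `x` of `V` into `V` is the germ of an element
of `altRist A V`. -/
theorem exists_mem_altRist_eventuallyEq {V : Set X} (hV : IsOpen V) {f : A} {x : X} (hx : x ∈ V)
    (hfx : f • x ∈ V) : ∃ g ∈ altRist A V, ∀ᶠ z in 𝓝 x, g • z = f • z := by
  by_cases hne : f • x = x
  · -- Pass through an auxiliary point `h • x ≠ x`.
    obtain ⟨h, hhV, hhF⟩ := exists_smul_mem A x hV ⟨x, hx⟩ (Set.toFinite {x})
    have hhx : h • x ≠ x := hhF
    obtain ⟨g₁, hg₁, h₁, -⟩ := exists_mem_altRist_of_ne hV hx hhV hhx finite_empty (by simp)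
      (by simp)
    have e : (f * h⁻¹) • h • x = x := by rw [mul_smul, inv_smul_smul, hne]
    obtain ⟨g₂, hg₂, h₂, -⟩ := exists_mem_altRist_of_ne (f := f * h⁻¹) (x := h • x) hV hhV
      (by rw [e]; exact hx) (by rw [e]; exact hhx.symm) finite_empty (by simp) (by simp)
    refine ⟨g₂ * g₁, mul_mem hg₂ hg₁, ?_⟩
    have h₂' : ∀ᶠ z in 𝓝 x, g₂ • h • z = (f * h⁻¹) • h • z :=
      (continuous_const_smul h).continuousAt.eventually h₂
    filter_upwards [h₁, h₂'] with z hz₁ hz₂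
    rw [mul_smul, hz₁, hz₂, mul_smul, inv_smul_smul]
  · obtain ⟨g, hg, h, -⟩ := exists_mem_altRist_of_ne hV hx hfx hne finite_empty (by simp) (by simp)
    exact ⟨g, hg, h⟩

/-- Finitely many points of `V` can be moved into a non-empty open subset of `V` by an element of
`altRist A V`. -/
theorem exists_mem_altRist_forall_smul_mem {V O : Set X} (hV : IsOpen V) (hO : IsOpen O)
    (hne : O.Nonempty) (hOV : O ⊆ V) {P : Set X} (hP : P.Finite) (hPV : P ⊆ V) :
    ∃ d ∈ altRist A V, ∀ p ∈ P, d • p ∈ O := by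
  induction P, hP using Set.Finite.induction_on with
  | empty => exact ⟨1, one_mem _, by simp⟩
  | @insert p P hp hP ih =>
    obtain ⟨d, hd, hdP⟩ := ih fun z hz => hPV (by simp [hz])
    have hdp : d • p ∈ V := smul_mem_of_mem_altRist hd (hPV (by simp))
    by_cases hdO : d • p ∈ O
    · refine ⟨d, hd, ?_⟩
      simpa [hdO] using hdP
    · have hF : ((fun z => d • z) '' P).Finite := hP.image _
      obtain ⟨a, haO, haF⟩ := exists_smul_mem A (d • p) hO hne hF
      have hne' : a • d • p ≠ d • p := fun e => hdO (e ▸ haO)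
      obtain ⟨e, he, hee, heF⟩ := exists_mem_altRist_of_ne hV hdp (hOV haO) hne' hF
        (by rintro ⟨z, hz, hzp⟩; exact hp (smul_left_cancel d hzp ▸ hz)) haF
      refine ⟨e * d, mul_mem he hd, ?_⟩
      rintro q (rfl | hq)
      · rw [mul_smul, hee.self_of_nhds]; exact haO
      · rw [mul_smul, heF _ ⟨q, hq, rfl⟩]; exact hdP q hq

/-- The restriction of a three-cycle to a smaller clopen base. -/
theorem IsThreeCycle.exists_restrict {c : A} {B B' : Set X} (h : IsThreeCycle c B)
    (hB' : IsClopen B') (hBB : B' ⊆ B) :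
    ∃ c' : A, IsThreeCycle c' B' ∧ ∀ x ∈ B', c' • x = c • x ∧ c' • c' • x = c • c • x := by
  obtain ⟨c', h1, h2⟩ := exists_isThreeCycle c (c * c) B' hB'
    (fun x hx hx' => h.smul_notMem x (hBB hx) (hBB hx'))
    (fun x hx hx' => h.smul_smul_notMem x (hBB hx) (hBB (by rwa [mul_smul] at hx')))
    (fun x hx y hy e => by
      rw [mul_smul] at e
      have := smul_left_cancel c e
      exact h.smul_notMem y (hBB hy) (this ▸ hBB hx))
  exact ⟨c', h1, fun x hx => ⟨(h2 x hx).1, by rw [(h2 x hx).2, mul_smul]⟩⟩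

/-- A three-cycle is the product of its restrictions to the two parts of a partition of its base. -/
theorem IsThreeCycle.eq_mul {c c₁ c₂ : A} {B B₁ B₂ : Set X} (h : IsThreeCycle c B)
    (h₁ : IsThreeCycle c₁ B₁) (h₂ : IsThreeCycle c₂ B₂) (hB : B = B₁ ∪ B₂) (hd : Disjoint B₁ B₂)
    (he₁ : ∀ x ∈ B₁, c₁ • x = c • x ∧ c₁ • c₁ • x = c • c • x)
    (he₂ : ∀ x ∈ B₂, c₂ • x = c • x ∧ c₂ • c₂ • x = c • c • x) : c = c₁ * c₂ := by
  have hd' : ∀ x ∈ B₁, x ∉ B₂ := fun x hx => Set.disjoint_left.1 hd hx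
  have m₁ : ∀ x ∈ B₁, x ∈ B := fun x hx => hB ▸ Or.inl hx
  have m₂ : ∀ x ∈ B₂, x ∈ B := fun x hx => hB ▸ Or.inr hx
  have n1 : ∀ x ∈ B, ∀ y ∈ B, c • x ≠ y := fun x hx y hy e => h.smul_notMem x hx (e ▸ hy)
  have n2 : ∀ x ∈ B, ∀ y ∈ B, c • c • x ≠ y := fun x hx y hy e => h.smul_smul_notMem x hx (e ▸ hy)
  have n3 : ∀ x ∈ B, ∀ y ∈ B, c • c • x ≠ c • y := fun x hx y hy e =>
    n1 x hx y hy (smul_left_cancel c e)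
  have f₂ : ∀ x ∈ B₁, c₂ • x = x ∧ c₂ • c • x = c • x ∧ c₂ • c • c • x = c • c • x := by
    intro x hx
    refine ⟨h₂.smul_eq_of_forall_ne (hd' x hx) (fun z hz => ?_) fun z hz => ?_,
      h₂.smul_eq_of_forall_ne (fun hh => n1 x (m₁ x hx) _ (m₂ _ hh) rfl) (fun z hz => ?_)
        fun z hz => ?_,
      h₂.smul_eq_of_forall_ne (fun hh => n2 x (m₁ x hx) _ (m₂ _ hh) rfl) (fun z hz => ?_)
        fun z hz => ?_⟩
    · rw [(he₂ z hz).1]; exact n1 z (m₂ z hz) x (m₁ x hx)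
    · rw [(he₂ z hz).2]; exact n2 z (m₂ z hz) x (m₁ x hx)
    · rw [(he₂ z hz).1]; exact fun e => hd' x hx (smul_left_cancel c e ▸ hz)
    · rw [(he₂ z hz).2]; exact n3 z (m₂ z hz) x (m₁ x hx)
    · rw [(he₂ z hz).1]; exact (n3 x (m₁ x hx) z (m₂ z hz)).symm
    · rw [(he₂ z hz).2]
      exact fun e => hd' x hx (smul_left_cancel c (smul_left_cancel c e) ▸ hz)
  have f₁ : ∀ x ∈ B₂, c₁ • x = x ∧ c₁ • c • x = c • x ∧ c₁ • c • c • x = c • c • x := by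
    have hd'' : ∀ x ∈ B₂, x ∉ B₁ := fun x hx hx' => hd' x hx' hx
    intro x hx
    refine ⟨h₁.smul_eq_of_forall_ne (hd'' x hx) (fun z hz => ?_) fun z hz => ?_,
      h₁.smul_eq_of_forall_ne (fun hh => n1 x (m₂ x hx) _ (m₁ _ hh) rfl) (fun z hz => ?_)
        fun z hz => ?_,
      h₁.smul_eq_of_forall_ne (fun hh => n2 x (m₂ x hx) _ (m₁ _ hh) rfl) (fun z hz => ?_)
        fun z hz => ?_⟩
    · rw [(he₁ z hz).1]; exact n1 z (m₁ z hz) x (m₂ x hx)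
    · rw [(he₁ z hz).2]; exact n2 z (m₁ z hz) x (m₂ x hx)
    · rw [(he₁ z hz).1]; exact fun e => hd'' x hx (smul_left_cancel c e ▸ hz)
    · rw [(he₁ z hz).2]; exact n3 z (m₁ z hz) x (m₂ x hx)
    · rw [(he₁ z hz).1]; exact (n3 x (m₂ x hx) z (m₁ z hz)).symm
    · rw [(he₁ z hz).2]
      exact fun e => hd'' x hx (smul_left_cancel c (smul_left_cancel c e) ▸ hz)
  refine eq_of_smul_eq_smul (α := X) fun x => ?_
  rw [mul_smul]
  by_cases hx : ∃ z ∈ B, x = z ∨ x = c • z ∨ x = c • c • z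
  · obtain ⟨z, hz, hxz⟩ := hx
    have hz' := hz
    rw [hB] at hz'
    rcases hz' with hz' | hz'
    · have e3 : c₁ • c • c • z = z := by rw [← (he₁ z hz').2]; exact h₁.smul_cube z hz'
      have e2 : c₁ • c • z = c • c • z := by rw [← (he₁ z hz').2, (he₁ z hz').1]
      rcases hxz with rfl | rfl | rfl
      · rw [(f₂ x hz').1, (he₁ x hz').1]
      · rw [(f₂ z hz').2.1, e2]
      · rw [(f₂ z hz').2.2, e3, h.smul_cube z hz]
    · have e3 : c₂ • c • c • z = z := by rw [← (he₂ z hz').2]; exact h₂.smul_cube z hz'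
      have e2 : c₂ • c • z = c • c • z := by rw [← (he₂ z hz').2, (he₂ z hz').1]
      rcases hxz with rfl | rfl | rfl
      · rw [(he₂ x hz').1, (f₁ x hz').2.1]
      · rw [e2, (f₁ z hz').2.2]
      · rw [e3, (f₁ z hz').1, h.smul_cube z hz]
  · push Not at hx
    rw [h.smul_eq_of_forall_ne (fun hB => (hx x hB).1 rfl) (fun z hz e => (hx z hz).2.1 e.symm)
      fun z hz e => (hx z hz).2.2 e.symm]
    rw [h₂.smul_eq_of_forall_ne (fun hB => (hx x (m₂ x hB)).1 rfl)
      (fun z hz e => (hx z (m₂ z hz)).2.1 (by rw [← e, (he₂ z hz).1]))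
      fun z hz e => (hx z (m₂ z hz)).2.2 (by rw [← e, (he₂ z hz).2])]
    rw [h₁.smul_eq_of_forall_ne (fun hB => (hx x (m₁ x hB)).1 rfl)
      (fun z hz e => (hx z (m₁ z hz)).2.1 (by rw [← e, (he₁ z hz).1]))
      fun z hz e => (hx z (m₁ z hz)).2.2 (by rw [← e, (he₁ z hz).2])]

/-- A subgroup contains `altRist A V` as soon as it contains all sufficiently small restrictions of
the three-cycles supported in `V`. -/
theorem altRist_le_of_forall_restrict {V : Set X} {K : Subgroup A}
    (hK : ∀ (c : A) (B : Set X), IsThreeCycle c B → (∀ x ∉ V, c • x = x) → ∀ x ∈ B, ∃ O ∈ 𝓝 x,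
      ∀ (c' : A) (B' : Set X), B' ⊆ O → B' ⊆ B → IsThreeCycle c' B' →
        (∀ z ∈ B', c' • z = c • z ∧ c' • c' • z = c • c • z) → c' ∈ K) :
    altRist A V ≤ K := by
  rw [altRist, Subgroup.closure_le]
  rintro c ⟨⟨B, hc⟩, hcV⟩
  have key : ∃ U : Set X, IsClopen U ∧ B ⊆ U ∧ ∀ (c' : A) (B' : Set X), B' ⊆ U → B' ⊆ B →
      IsThreeCycle c' B' → (∀ z ∈ B', c' • z = c • z ∧ c' • c' • z = c • c • z) → c' ∈ K := by
    refine hc.isClopen.isClosed.isCompact.induction_on (p := fun s => ∃ U : Set X, IsClopen U ∧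
      s ⊆ U ∧ ∀ (c' : A) (B' : Set X), B' ⊆ U → B' ⊆ B → IsThreeCycle c' B' →
      (∀ z ∈ B', c' • z = c • z ∧ c' • c' • z = c • c • z) → c' ∈ K) ?_ ?_ ?_ ?_
    · refine ⟨∅, isClopen_empty, subset_rfl, fun c' B' hB' _ hc' _ => ?_⟩
      have : c' = 1 := eq_of_smul_eq_smul (α := X) fun x => by
        rw [one_smul]
        exact hc'.smul_eq x (fun h => hB' h) (fun h => hB' h) fun h => hB' h
      rw [this]
      exact one_mem K
    · rintro s t hst ⟨U, hU, htU, h⟩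
      exact ⟨U, hU, hst.trans htU, h⟩
    · rintro s t ⟨U, hU, hsU, h⟩ ⟨U', hU', htU', h'⟩
      refine ⟨U ∪ U', hU.union hU', union_subset_union hsU htU', fun c' B' hB' hB'B hc' he => ?_⟩
      obtain ⟨c₁, h₁, he₁⟩ := hc'.exists_restrict (hc'.isClopen.inter hU) inter_subset_left
      obtain ⟨c₂, h₂, he₂⟩ := hc'.exists_restrict (hc'.isClopen.diff hU) sdiff_subset
      rw [hc'.eq_mul h₁ h₂ (inter_union_sdiff B' U).symm
        (disjoint_sdiff_right.mono_left inter_subset_right) he₁ he₂]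
      refine mul_mem (h c₁ _ inter_subset_right (inter_subset_left.trans hB'B) h₁ fun z hz => ?_)
        (h' c₂ _ (fun z hz => (hB' hz.1).resolve_left hz.2) (sdiff_subset.trans hB'B) h₂
          fun z hz => ?_)
      · rw [(he₁ z hz).2, (he₁ z hz).1]; exact he z hz.1
      · rw [(he₂ z hz).2, (he₂ z hz).1]; exact he z hz.1
    · intro x hx
      obtain ⟨O, hO, h⟩ := hK c B hc hcV x hx
      obtain ⟨O', hO', hO'o, hxO'⟩ := mem_nhds_iff.1 hO
      obtain ⟨U, hU, hxU, hUO⟩ := compact_exists_isClopen_in_isOpen hO'o hxO'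
      exact ⟨U, mem_nhdsWithin_of_mem_nhds (hU.isOpen.mem_nhds hxU), U, hU, subset_rfl,
        fun c' B' hB' => h c' B' (hB'.trans (hUO.trans hO'))⟩
  obtain ⟨U, -, hBU, h⟩ := key
  exact h c B hBU subset_rfl hc fun z _ => ⟨rfl, rfl⟩

end AlternatingAction

section AlternatingAction

variable {A X : Type*} [Group A] [TopologicalSpace X] [MulAction A X] [IsAlternatingAction A X]
  [CompactSpace X] [T2Space X] [TotallyDisconnectedSpace X] [Infinite X]

open IsAlternatingAction
open scoped commutatorElement

/-! ### Generation and simplicity of the alternating rigid stabilizers -/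

/-- A subgroup `K` containing `altRist A U` contains `altRist A V` if all finite subsets of `V` can
be moved into `U` by elements normalizing `K`. -/
theorem altRist_le_of_forall_exists_conj {U V : Set X} (hU : IsOpen U) {K : Subgroup A}
    (hUK : altRist A U ≤ K)
    (h : ∀ P : Set X, P.Finite → P ⊆ V → ∃ d : A, (∀ k ∈ K, d⁻¹ * k * d ∈ K) ∧ ∀ p ∈ P, d • p ∈ U) :
    altRist A V ≤ K := by
  refine altRist_le_of_forall_restrict fun c B hc hcV x hx => ?_
  have hV : ∀ y, c • y ≠ y → y ∈ V := fun y hy => by_contra fun hn => hy (hcV y hn)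
  have h0 : c • x ≠ x := hc.smul_ne (Or.inl hx)
  obtain ⟨d, hdK, hd⟩ := h {x, c • x, c • c • x} (Set.toFinite _) (by
    rintro y (rfl | rfl | rfl)
    · exact hV _ h0
    · exact hV _ fun e => h0 (smul_left_cancel c e)
    · exact hV _ fun e => h0 (smul_left_cancel c (smul_left_cancel c e)))
  have hO : IsOpen ((fun z => d • z) ⁻¹' U ∩ ((fun z => d • c • z) ⁻¹' U ∩
      (fun z => d • c • c • z) ⁻¹' U)) :=
    (hU.preimage (continuous_const_smul d)).inter
      ((hU.preimage ((continuous_const_smul d).comp (continuous_const_smul c))).inter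
        (hU.preimage ((continuous_const_smul d).comp
          ((continuous_const_smul c).comp (continuous_const_smul c)))))
  refine ⟨_, hO.mem_nhds ⟨hd _ (by simp), hd _ (by simp), hd _ (by simp)⟩,
    fun c' B' hB' _ hc' he => ?_⟩
  have hmem : d * c' * d⁻¹ ∈ altRist A U := by
    refine (hc'.conj d).mem_altRist fun w hw => ?_
    obtain ⟨h1, h2, h3⟩ := hB' hw
    have e := he _ hw
    rw [mem_preimage] at h1 h2 h3
    rw [smul_inv_smul] at h1
    rw [← e.1] at h2
    rw [← e.2] at h3
    simp only [mul_smul, inv_smul_smul]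
    exact ⟨h1, h2, h3⟩
  simpa [mul_assoc] using hdK _ (hUK hmem)

theorem altRist_union_le {U W : Set X} (hU : IsOpen U) (hW : IsOpen W) (hne : (U ∩ W).Nonempty)
    {K : Subgroup A} (hUK : altRist A U ≤ K) (hWK : altRist A W ≤ K) : altRist A (U ∪ W) ≤ K := by
  refine altRist_le_of_forall_exists_conj hU hUK fun P hP hPV => ?_
  obtain ⟨d, hd, hdP⟩ := exists_mem_altRist_forall_smul_mem (A := A) hW (hU.inter hW) hne
    inter_subset_right (hP.inter_of_left W) inter_subset_right
  refine ⟨d, fun k hk => mul_mem (mul_mem (inv_mem (hWK hd)) hk) (hWK hd), fun p hp => ?_⟩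
  by_cases hpW : p ∈ W
  · exact (hdP p ⟨hp, hpW⟩).1
  · rw [smul_eq_of_mem_altRist hd p hpW]
    exact (hPV hp).resolve_right hpW

/-- Every three-cycle is locally a commutator of two three-cycles with one common point. -/
theorem altRist_le_commutator {V : Set X} (hV : IsOpen V) :
    altRist A V ≤ ⁅altRist A V, altRist A V⁆ := by
  refine altRist_le_of_forall_restrict fun c B hc hcV x hx => ?_
  have hmV : ∀ y, c • y ≠ y → y ∈ V := fun y hy => by_contra fun hn => hy (hcV y hn)
  have h0 : c • x ≠ x := hc.smul_ne (Or.inl hx)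
  have h1 : c • c • x ≠ c • x := fun e => h0 (smul_left_cancel c e)
  have h2 : c • c • x ≠ x := fun e => hc.smul_smul_notMem x hx (by rwa [e])
  have hxV : x ∈ V := hmV _ h0
  obtain ⟨a, haV, haF⟩ := exists_smul_mem A x hV ⟨x, hxV⟩ (Set.toFinite {x, c • x, c • c • x})
  obtain ⟨b, hbV, hbF⟩ := exists_smul_mem A x hV ⟨x, hxV⟩
    (Set.toFinite {x, c • x, c • c • x, a • x})
  simp only [mem_insert_iff, mem_singleton_iff, not_or] at haF hbF
  let pt : Fin 5 → X := ![x, c • x, c • c • x, a • x, b • x]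
  have hpt : Function.Injective pt := by
    intro i j hij
    fin_cases i <;> fin_cases j <;> first | rfl | (exfalso; simp [pt] at hij; grind)
  obtain ⟨N, hN, hxN, hNV, hNd⟩ := exists_disjoint_isClopen hpt (O := fun _ => V) (fun _ => hV) (by
    intro i
    fin_cases i
    · exact hxV
    · exact hmV _ h1
    · exact hmV _ fun e => h1 (smul_left_cancel c e)
    · exact haV
    · exact hbV)
  have hd : ∀ {i j : Fin 5} {y : X}, i ≠ j → y ∈ N i → y ∉ N j := fun hij hi hj =>
    Set.disjoint_left.1 (hNd hij) hi hj
  have cc : Continuous fun z : X => c • c • z :=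
    (continuous_const_smul c).comp (continuous_const_smul c)
  refine ⟨N 0 ∩ (fun z => c • z) ⁻¹' N 1 ∩ (fun z => c • c • z) ⁻¹' N 2 ∩
    (fun z => a • z) ⁻¹' N 3 ∩ (fun z => b • z) ⁻¹' N 4,
    (((((hN 0).isOpen.inter ((hN 1).isOpen.preimage (continuous_const_smul c))).inter
      ((hN 2).isOpen.preimage cc)).inter ((hN 3).isOpen.preimage (continuous_const_smul a))).inter
      ((hN 4).isOpen.preimage (continuous_const_smul b))).mem_nhds
      ⟨⟨⟨⟨hxN 0, hxN 1⟩, hxN 2⟩, hxN 3⟩, hxN 4⟩, fun c' B' hB' _ hc' he => ?_⟩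
  have m0 : ∀ z ∈ B', z ∈ N 0 := fun z hz => (hB' hz).1.1.1.1
  have m1 : ∀ z ∈ B', c • z ∈ N 1 := fun z hz => (hB' hz).1.1.1.2
  have m2 : ∀ z ∈ B', c • c • z ∈ N 2 := fun z hz => (hB' hz).1.1.2
  have m3 : ∀ z ∈ B', a • z ∈ N 3 := fun z hz => (hB' hz).1.2
  have m4 : ∀ z ∈ B', b • z ∈ N 4 := fun z hz => (hB' hz).2
  obtain ⟨σ, hσ, hσe⟩ := exists_isThreeCycle c a B' hc'.isClopen
    (fun z hz hz' => hd (by decide) (m1 z hz) (m0 _ hz'))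
    (fun z hz hz' => hd (by decide) (m3 z hz) (m0 _ hz'))
    (fun z hz w hw e => hd (j := 1) (by decide) (m3 w hw) (e ▸ m1 z hz))
  obtain ⟨τ, hτ, hτe⟩ := exists_isThreeCycle (c * c) b B' hc'.isClopen
    (fun z hz hz' => hd (by decide) (m2 z hz) (m0 _ (by rwa [mul_smul] at hz')))
    (fun z hz hz' => hd (by decide) (m4 z hz) (m0 _ hz'))
    (fun z hz w hw e => hd (j := 2) (by decide) (m4 w hw) (by
      rw [← e, mul_smul]; exact m2 z hz))
  simp only [mul_smul] at hτe
  have σN : σ ∈ altRist A (N 0 ∪ N 1 ∪ N 3) := hσ.mem_altRist fun z hz => by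
    rw [(hσe z hz).2, (hσe z hz).1]
    exact ⟨Or.inl (Or.inl (m0 z hz)), Or.inl (Or.inr (m1 z hz)), Or.inr (m3 z hz)⟩
  have τN : τ ∈ altRist A (N 0 ∪ N 2 ∪ N 4) := hτ.mem_altRist fun z hz => by
    rw [(hτe z hz).2, (hτe z hz).1]
    exact ⟨Or.inl (Or.inl (m0 z hz)), Or.inl (Or.inr (m2 z hz)), Or.inr (m4 z hz)⟩
  have c'N : c' ∈ altRist A (N 0 ∪ N 1 ∪ N 2) := hc'.mem_altRist fun z hz => by
    rw [(he z hz).2, (he z hz).1]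
    exact ⟨Or.inl (Or.inl (m0 z hz)), Or.inl (Or.inr (m1 z hz)), Or.inr (m2 z hz)⟩
  have key : c' * (τ * σ) = σ * τ := by
    refine eq_of_smul_eq_smul (α := X) fun y => ?_
    simp only [mul_smul]
    -- The permutations `σ`, `τ`, `c'` of the pieces `N i` are `(0 1 3)`, `(0 2 4)` and `(0 1 2)`.
    have fσ : ∀ y, (y ∈ N 2 ∨ y ∈ N 4) → σ • y = y := fun y hy =>
      smul_eq_of_mem_altRist σN y (by
        rintro ((h | h) | h) <;> rcases hy with hy | hy <;> exact hd (by decide) h hy)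
    have fτ : ∀ y, (y ∈ N 1 ∨ y ∈ N 3) → τ • y = y := fun y hy =>
      smul_eq_of_mem_altRist τN y (by
        rintro ((h | h) | h) <;> rcases hy with hy | hy <;> exact hd (by decide) h hy)
    have fc : ∀ y, (y ∈ N 3 ∨ y ∈ N 4) → c' • y = y := fun y hy =>
      smul_eq_of_mem_altRist c'N y (by
        rintro ((h | h) | h) <;> rcases hy with hy | hy <;> exact hd (by decide) h hy)
    have σ2 : ∀ z ∈ B', σ • c • z = a • z := fun z hz => by rw [← (hσe z hz).1, (hσe z hz).2]
    have σ3 : ∀ z ∈ B', σ • a • z = z := fun z hz => by rw [← (hσe z hz).2, hσ.smul_cube z hz]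
    have τ2 : ∀ z ∈ B', τ • c • c • z = b • z := fun z hz => by
      rw [← (hτe z hz).1, (hτe z hz).2]
    have τ3 : ∀ z ∈ B', τ • b • z = z := fun z hz => by rw [← (hτe z hz).2, hτ.smul_cube z hz]
    have c2 : ∀ z ∈ B', c' • c • z = c • c • z := fun z hz => by
      rw [← (he z hz).2, (he z hz).1]
    have c3 : ∀ z ∈ B', c' • c • c • z = z := fun z hz => by
      rw [← (he z hz).2, hc'.smul_cube z hz]
    by_cases hy : ∃ z ∈ B', y = z ∨ y = c • z ∨ y = c • c • z ∨ y = a • z ∨ y = b • z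
    · obtain ⟨z, hz, hyz⟩ := hy
      rcases hyz with rfl | rfl | rfl | rfl | rfl
      · rw [(hσe y hz).1, fτ _ (Or.inl (m1 y hz)), c2 y hz, (hτe y hz).1, fσ _ (Or.inl (m2 y hz))]
      · rw [fτ _ (Or.inl (m1 z hz)), σ2 z hz, fτ _ (Or.inr (m3 z hz)), fc _ (Or.inl (m3 z hz))]
      · rw [fσ _ (Or.inl (m2 z hz)), τ2 z hz, fc _ (Or.inr (m4 z hz)), fσ _ (Or.inr (m4 z hz))]
      · rw [σ3 z hz, (hτe z hz).1, c3 z hz, fτ _ (Or.inr (m3 z hz)), σ3 z hz]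
      · rw [fσ _ (Or.inr (m4 z hz)), τ3 z hz, (he z hz).1, (hσe z hz).1]
    · push Not at hy
      have e1 : σ • y = y := hσ.smul_eq_of_forall_ne (fun h => (hy y h).1 rfl)
        (fun z hz e => (hy z hz).2.1 (by rw [← e, (hσe z hz).1]))
        (fun z hz e => (hy z hz).2.2.2.1 (by rw [← e, (hσe z hz).2]))
      have e2 : τ • y = y := hτ.smul_eq_of_forall_ne (fun h => (hy y h).1 rfl)
        (fun z hz e => (hy z hz).2.2.1 (by rw [← e, (hτe z hz).1]))
        (fun z hz e => (hy z hz).2.2.2.2 (by rw [← e, (hτe z hz).2]))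
      have e3 : c' • y = y := hc'.smul_eq_of_forall_ne (fun h => (hy y h).1 rfl)
        (fun z hz e => (hy z hz).2.1 (by rw [← e, (he z hz).1]))
        (fun z hz e => (hy z hz).2.2.1 (by rw [← e, (he z hz).2]))
      rw [e1, e2, e3, e1]
  have hc'e : c' = ⁅σ, τ⁆ := by
    rw [commutatorElement_def, mul_assoc (σ * τ), ← mul_inv_rev, ← key, mul_inv_cancel_right]
  rw [hc'e]
  refine Subgroup.commutator_mem_commutator (altRist_mono ?_ σN) (altRist_mono ?_ τN)
  · exact union_subset (union_subset (hNV 0) (hNV 1)) (hNV 3)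
  · exact union_subset (union_subset (hNV 0) (hNV 2)) (hNV 4)

/-- A subgroup normalized by `altRist A V` and containing a non-trivial element of it contains all
of it: by a double commutator argument it contains the commutator subgroup of `altRist A B` for a
small set `B`. -/
theorem altRist_le_of_normalized {V : Set X} (hV : IsOpen V) {K : Subgroup A}
    (hK : ∀ d ∈ altRist A V, ∀ k ∈ K, d * k * d⁻¹ ∈ K) {n : A} (hn : n ∈ K)
    (hnV : n ∈ altRist A V) (hn1 : n ≠ 1) : altRist A V ≤ K := by
  obtain ⟨x, hx⟩ : ∃ x : X, n • x ≠ x := by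
    by_contra! h
    exact hn1 (eq_of_smul_eq_smul (α := X) fun x => by rw [h, one_smul])
  have hxV : x ∈ V := by_contra fun h => hx (smul_eq_of_mem_altRist hnV x h)
  obtain ⟨M, hM, hxM, hMx⟩ := compact_exists_isClopen_in_isOpen (x := n • x) (U := {x}ᶜ)
    isOpen_compl_singleton hx
  obtain ⟨B, hB, hxB, hBs⟩ := compact_exists_isClopen_in_isOpen (x := x)
    (U := V ∩ ((fun z => n • z) ⁻¹' M ∩ Mᶜ)) (hV.inter
      ((hM.isOpen.preimage (continuous_const_smul n)).inter hM.compl.isOpen))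
    ⟨hxV, hxM, fun h => hMx h rfl⟩
  have hBV : altRist A B ≤ altRist A V := altRist_mono fun z hz => (hBs hz).1
  have hdis : Disjoint ((fun z => n⁻¹ • z) ⁻¹' B) B := by
    rw [Set.disjoint_left]
    intro z hz hz'
    have h1 := (hBs hz).2.1
    rw [mem_preimage, smul_inv_smul] at h1
    exact (hBs hz').2.2 h1
  have hcomm : ⁅altRist A B, altRist A B⁆ ≤ K := by
    rw [Subgroup.commutator_le]
    intro a ha b hb
    have h1 : ⁅a, n⁆ ∈ K := mul_mem (hK a (hBV ha) n hn) (inv_mem hn)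
    have h2 : ⁅⁅a, n⁆, b⁆ ∈ K := by
      have := mul_mem h1 (hK b (hBV hb) _ (inv_mem h1))
      simpa [commutatorElement_def, mul_assoc] using this
    have h3 : Commute (n * a⁻¹ * n⁻¹) b := commute_of_mem_altRist hdis
      (conj_mem_altRist (inv_mem ha) n) hb
    have h4 : ⁅⁅a, n⁆, b⁆ = ⁅a, b⁆ := by
      have e : ⁅a, n⁆ = a * (n * a⁻¹ * n⁻¹) := by simp [commutatorElement_def, mul_assoc]
      rw [e, commutatorElement_def, commutatorElement_def, mul_inv_rev,
        mul_assoc a (n * a⁻¹ * n⁻¹) b, h3.eq]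
      group
    rwa [h4] at h2
  refine altRist_le_of_forall_exists_conj hB.isOpen ((altRist_le_commutator hB.isOpen).trans hcomm)
    fun P hP hPV => ?_
  obtain ⟨d, hd, hdP⟩ := exists_mem_altRist_forall_smul_mem (A := A) hV hB.isOpen ⟨x, hxB⟩
    (fun z hz => (hBs hz).1) hP hPV
  exact ⟨d, fun k hk => by simpa using hK d⁻¹ (inv_mem hd) k hk, hdP⟩

/-- Simplicity of the alternating rigid stabilizers of open sets. -/
theorem altRist_eq_bot_or_eq_top {V : Set X} (hV : IsOpen V) (N : Subgroup (altRist A V))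
    [hN : N.Normal] : N = ⊥ ∨ N = ⊤ := by
  by_contra! h
  obtain ⟨n, hn, hn1⟩ := N.bot_or_exists_ne_one.resolve_left h.1
  have hle := altRist_le_of_normalized hV (K := N.map (altRist A V).subtype) (by
    rintro d hd _ ⟨k, hk, rfl⟩
    exact ⟨⟨d, hd⟩ * k * ⟨d, hd⟩⁻¹, hN.conj_mem k hk _, by simp⟩) ⟨n, hn, rfl⟩ n.2
    (fun e => hn1 (Subtype.ext e))
  apply h.2
  rw [eq_top_iff]
  rintro g -
  obtain ⟨k, hk, hkg⟩ := hle g.2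
  rwa [← Subtype.ext hkg]

/-! ### Elements acting trivially near a finite set -/

variable (A) in
/-- The union of the groups `altRist A V` for `V` clopen and disjoint from `S`. -/
def altStabilizer (S : Set X) : Subgroup A where
  carrier := {g | ∃ V : Set X, IsClopen V ∧ Disjoint V S ∧ g ∈ altRist A V}
  one_mem' := ⟨∅, isClopen_empty, Set.empty_disjoint S, one_mem _⟩
  mul_mem' := by
    rintro a b ⟨V, hV, hVS, ha⟩ ⟨W, hW, hWS, hb⟩
    exact ⟨V ∪ W, hV.union hW, hVS.union_left hWS,
      mul_mem (altRist_mono subset_union_left ha) (altRist_mono subset_union_right hb)⟩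
  inv_mem' := by
    rintro a ⟨V, hV, hVS, ha⟩
    exact ⟨V, hV, hVS, inv_mem ha⟩

theorem eventually_smul_eq_of_mem_altStabilizer {S : Set X} {g : A} (hg : g ∈ altStabilizer A S)
    {s : X} (hs : s ∈ S) : ∀ᶠ z in 𝓝 s, g • z = z := by
  obtain ⟨V, hV, hVS, hgV⟩ := hg
  filter_upwards [hV.compl.isOpen.mem_nhds fun h => Set.disjoint_left.1 hVS h hs] with z hz
  exact smul_eq_of_mem_altRist hgV z hz

theorem conj_mem_altStabilizer {S : Set X} {h g : A}
    (hg : g ∈ altStabilizer A ((fun z => h • z) '' S)) : h⁻¹ * g * h ∈ altStabilizer A S := by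
  obtain ⟨V, hV, hVS, hgV⟩ := hg
  refine ⟨_, hV.preimage (continuous_const_smul _), ?_, by
    simpa only [_root_.inv_inv] using conj_mem_altRist hgV h⁻¹⟩
  rw [Set.disjoint_left] at hVS ⊢
  intro z hz hzS
  exact hVS hz ⟨z, hzS, rfl⟩

/-- A three-cycle can be split into a part whose support avoids `W` and a part whose support avoids
`P`, if the translates of `P` avoid `W`. -/
theorem IsThreeCycle.exists_mul_eq {c : A} {B : Set X} (hc : IsThreeCycle c B) {W P : Set X}
    (hW : IsClopen W) (h : ∀ p ∈ P, p ∉ W ∧ c • p ∉ W ∧ c • c • p ∉ W) :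
    ∃ c₁ ∈ altRist A Wᶜ, ∃ c₂ ∈ altStabilizer A P, c = c₁ * c₂ := by
  have k1 : Continuous fun z : X => c • z := continuous_const_smul c
  have k2 : Continuous fun z : X => c • c • z := k1.comp k1
  let E : Set X := W ∪ (fun z => c • z) ⁻¹' W ∪ (fun z => c • c • z) ⁻¹' W
  have hE : IsClopen E := (hW.union (hW.preimage k1)).union (hW.preimage k2)
  obtain ⟨c₁, h₁, he₁⟩ := hc.exists_restrict (hc.isClopen.diff hE) sdiff_subset
  obtain ⟨c₂, h₂, he₂⟩ := hc.exists_restrict (hc.isClopen.inter hE) inter_subset_left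
  refine ⟨c₁, h₁.mem_altRist fun z hz => ?_, c₂, ?_, hc.eq_mul h₁ h₂
    (sdiff_union_inter B E).symm (disjoint_sdiff_left.mono_right inter_subset_right) he₁ he₂⟩
  · rw [(he₁ z hz).2, (he₁ z hz).1]
    exact ⟨fun h => hz.2 (Or.inl (Or.inl h)), fun h => hz.2 (Or.inl (Or.inr h)),
      fun h => hz.2 (Or.inr h)⟩
  · refine ⟨(B ∩ E) ∪ (fun z => c • z) ⁻¹' (B ∩ E) ∪ (fun z => c • c • z) ⁻¹' (B ∩ E),
      (h₂.isClopen.union (h₂.isClopen.preimage k1)).union (h₂.isClopen.preimage k2), ?_,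
      h₂.mem_altRist fun z hz => ?_⟩
    · rw [Set.disjoint_left]
      intro p hp hpP
      obtain ⟨n0, n1, n2⟩ := h p hpP
      rcases hp with (⟨-, (h | h) | h⟩ | ⟨-, (h | h) | h⟩) | ⟨-, (h | h) | h⟩
      · exact n0 h
      · exact n1 h
      · exact n2 h
      · exact n1 h
      · exact n2 h
      · exact n0 (by rwa [mem_preimage, hc.smul_cube'] at h)
      · exact n2 h
      · exact n0 (by rwa [mem_preimage, hc.smul_cube'] at h)
      · exact n1 (by rwa [mem_preimage, hc.smul_cube'] at h)
    · rw [(he₂ z hz).2, (he₂ z hz).1]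
      refine ⟨Or.inl (Or.inl hz), Or.inr ?_, Or.inl (Or.inr ?_)⟩
      · rwa [mem_preimage, hc.smul_cube']
      · rwa [mem_preimage, hc.smul_cube']

/-- Up to `altStabilizer A S`, every group element avoids any clopen set `W` that is disjoint from
a certain finite set, the track of `S` along a word in three-cycles. -/
theorem exists_finite_forall_exists_altRist_compl (g : A) {S : Set X} (hS : S.Finite) :
    ∃ F : Set X, F.Finite ∧ ∀ W : Set X, IsClopen W → Disjoint W F →
      ∃ h ∈ altRist A Wᶜ, h⁻¹ * g ∈ altStabilizer A S := by
  have step : ∀ (c : A) (B : Set X), IsThreeCycle c B → ∀ g : A,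
      (∃ F : Set X, F.Finite ∧ ∀ W : Set X, IsClopen W → Disjoint W F →
        ∃ h ∈ altRist A Wᶜ, h⁻¹ * g ∈ altStabilizer A S) →
      ∃ F : Set X, F.Finite ∧ ∀ W : Set X, IsClopen W → Disjoint W F →
        ∃ h ∈ altRist A Wᶜ, h⁻¹ * (c * g) ∈ altStabilizer A S := by
    rintro c B hc g ⟨F, hF, hFW⟩
    refine ⟨F ∪ ((fun z => g • z) '' S ∪ (fun z => c • g • z) '' S ∪
      (fun z => c • c • g • z) '' S), hF.union (((hS.image _).union (hS.image _)).union
      (hS.image _)), fun W hW hWF => ?_⟩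
    rw [Set.disjoint_left] at hWF
    obtain ⟨h, hh, hhg⟩ := hFW W hW (Set.disjoint_left.2 fun z hz hzF => hWF hz (Or.inl hzF))
    obtain ⟨c₁, h₁, c₂, h₂, rfl⟩ := hc.exists_mul_eq (P := (fun z => h • z) '' S) hW (by
      rintro _ ⟨s, hs, rfl⟩
      have e : h • s = g • s := by
        have := (eventually_smul_eq_of_mem_altStabilizer hhg hs).self_of_nhds
        rw [mul_smul, inv_smul_eq_iff] at this
        exact this.symm
      simp only [e]
      exact ⟨fun hn => hWF hn (Or.inr (Or.inl (Or.inl ⟨s, hs, rfl⟩))),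
        fun hn => hWF hn (Or.inr (Or.inl (Or.inr ⟨s, hs, rfl⟩))),
        fun hn => hWF hn (Or.inr (Or.inr ⟨s, hs, rfl⟩))⟩)
    refine ⟨c₁ * h, mul_mem h₁ hh, ?_⟩
    have := mul_mem (conj_mem_altStabilizer h₂) hhg
    simpa [mul_assoc] using this
  have hg : g ∈ Subgroup.closure {c : A | ∃ B : Set X, IsThreeCycle c B} := by
    rw [closure_isThreeCycle]; trivial
  induction hg using Subgroup.closure_induction_left with
  | one => exact ⟨∅, finite_empty, fun W _ _ => ⟨1, one_mem _, by simp⟩⟩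
  | mul_left c hc g _ ih =>
    obtain ⟨B, hB⟩ := hc
    exact step c B hB g ih
  | inv_mul_cancel c hc g _ ih =>
    obtain ⟨B, hB⟩ := hc
    exact step c⁻¹ B hB.inv g ih

/-- An element acting trivially near a finite set `S` is a product of three-cycles with support
disjoint from `S`. -/
theorem mem_altStabilizer_of_eventually {g : A} {S : Set X} (hS : S.Finite)
    (hg : ∀ s ∈ S, ∀ᶠ z in 𝓝 s, g • z = z) : g ∈ altStabilizer A S := by
  obtain ⟨F, hF, h⟩ := exists_finite_forall_exists_altRist_compl g hS
  obtain ⟨w, hw⟩ := hF.exists_notMem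
  obtain ⟨W, hW, hwW, hWF⟩ := compact_exists_isClopen_in_isOpen hF.isClosed.isOpen_compl hw
  obtain ⟨h, hh, hhg⟩ := h W hW (Set.disjoint_left.2 fun z hz hzF => hWF hz hzF)
  -- `h` is supported off `W` and trivial near `S`, so it commutes with some `d` moving `S` to `W`.
  let U : Set X := {z | ∀ᶠ y in 𝓝 z, h • y = y}
  have hU : IsOpen U := isOpen_setOfPred_eventually_nhds
  have hWU : W ⊆ U := fun z hz => by
    filter_upwards [hW.isOpen.mem_nhds hz] with y hy
    exact smul_eq_of_mem_altRist hh y fun hn => hn hy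
  have hSU : S ⊆ U := fun s hs => by
    filter_upwards [hg s hs, eventually_smul_eq_of_mem_altStabilizer hhg hs] with y h1 h2
    rw [mul_smul, h1, inv_smul_eq_iff] at h2
    exact h2.symm
  obtain ⟨d, hd, hdS⟩ := exists_mem_altRist_forall_smul_mem (A := A) hU hW.isOpen ⟨w, hwW⟩ hWU hS
    hSU
  have hcomm : Commute d h := commute_of_forall_smul_eq (smul_eq_of_mem_altRist hd)
    fun x (hx : ∀ᶠ y in 𝓝 x, h • y = y) => hx.self_of_nhds
  have hmem : d⁻¹ * h * d ∈ altStabilizer A S := by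
    refine conj_mem_altStabilizer ⟨Wᶜ, hW.compl, ?_, hh⟩
    rw [Set.disjoint_left]
    rintro _ hn ⟨s, hs, rfl⟩
    exact hn (hdS s hs)
  rw [mul_assoc, ← hcomm.eq, inv_mul_cancel_left] at hmem
  simpa using mul_mem hmem hhg

/-! ### Finitely generated subgroups with large orbits -/

/-- For `V` clopen, some finitely generated subgroup of `altRist A V` has the same orbits on `V` as
the restriction to `V` of the whole group. -/
theorem exists_finite_subset_altRist {V : Set X} (hV : IsClopen V) (hne : V.Nonempty) :
    ∃ T : Set A, T.Finite ∧ T ⊆ altRist A V ∧ ∀ x ∈ V, ∀ a : A, a • x ∈ V →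
      ∃ γ ∈ Subgroup.closure T, γ • x = a • x := by
  classical
  obtain ⟨S, hS, hSorb⟩ := exists_finite (A := A) (X := X)
  -- finitely many translates of `V` cover the space
  have hcov : ∃ I : Set A, I.Finite ∧ ∀ x : X, ∃ i ∈ I, i • x ∈ V := by
    have hV' : ∀ a : A, IsOpen ((fun x => a • x) ⁻¹' V) := fun a =>
      hV.isOpen.preimage (continuous_const_smul a)
    obtain ⟨t, ht⟩ := isCompact_univ.elim_finite_subcover (fun a : A => (fun x => a • x) ⁻¹' V) hV'
      (fun x _ => by
        obtain ⟨a, ha, -⟩ := exists_smul_mem A x hV.isOpen hne finite_empty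
        exact mem_iUnion.2 ⟨a, ha⟩)
    refine ⟨t, t.finite_toSet, fun x => ?_⟩
    obtain ⟨i, hi, hx⟩ := mem_iUnion₂.1 (ht (mem_univ x))
    exact ⟨i, hi, hx⟩
  obtain ⟨I, hI, hIV⟩ := hcov
  -- a group element is realized on `V` by finitely many elements of `altRist A V`
  have hloc : ∀ f : A, ∃ T : Set A, T.Finite ∧ T ⊆ altRist A V ∧ ∀ x ∈ V, f • x ∈ V →
      ∃ g ∈ T, g • x = f • x := by
    intro f
    have hC : IsCompact (V ∩ (fun x => f • x) ⁻¹' V) :=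
      (hV.isClosed.inter (hV.isClosed.preimage (continuous_const_smul f))).isCompact
    have hex : ∀ x : X, ∃ g ∈ altRist A V, x ∈ V → f • x ∈ V → ∀ᶠ z in 𝓝 x, g • z = f • z := by
      intro x
      by_cases hx : x ∈ V ∧ f • x ∈ V
      · obtain ⟨g, hg, h⟩ := exists_mem_altRist_eventuallyEq hV.isOpen hx.1 hx.2
        exact ⟨g, hg, fun _ _ => h⟩
      · exact ⟨1, one_mem _, fun h1 h2 => absurd ⟨h1, h2⟩ hx⟩
    choose g hg hgx using hex
    obtain ⟨t, ht⟩ := hC.elim_nhds_subcover' (fun x _ => {z | g x • z = f • z})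
      (fun x hx => hgx x hx.1 hx.2)
    refine ⟨(fun x : ↥(V ∩ (fun x => f • x) ⁻¹' V) => g x) '' t, t.finite_toSet.image _, ?_,
      fun x hx hfx => ?_⟩
    · rintro _ ⟨x, -, rfl⟩
      exact hg x
    · obtain ⟨y, hy, hxy⟩ := mem_iUnion₂.1 (ht ⟨hx, hfx⟩)
      exact ⟨_, ⟨y, hy, rfl⟩, hxy⟩
  choose T hTf hTV hT using hloc
  let I' : Set A := insert 1 I
  let S' : Set A := insert 1 (S ∪ (fun s => s⁻¹) '' S)
  have hI' : I'.Finite := hI.insert 1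
  have hS' : S'.Finite := (hS.union (hS.image _)).insert 1
  let T' : Set A := ⋃ i ∈ I', ⋃ s ∈ S', ⋃ j ∈ I', T (j * s * i⁻¹)
  have hmem : ∀ i ∈ I', ∀ s ∈ S', ∀ j ∈ I', ∀ g ∈ T (j * s * i⁻¹), g ∈ T' := by
    intro i hi s hs j hj g hg
    simp only [T', mem_iUnion]
    exact ⟨i, hi, s, hs, j, hj, hg⟩
  have step : ∀ s ∈ S', ∀ σ : A, ∀ x ∈ V, (∀ j ∈ I', j • σ • x ∈ V →
      ∃ γ ∈ Subgroup.closure T', γ • x = j • σ • x) → ∀ j ∈ I', j • (s * σ) • x ∈ V →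
      ∃ γ ∈ Subgroup.closure T', γ • x = j • (s * σ) • x := by
    intro s hs σ x hx ih j hj hjV
    obtain ⟨i, hi, hiV⟩ := hIV (σ • x)
    obtain ⟨γ, hγ, hγx⟩ := ih i (Or.inr hi) hiV
    have e : (j * s * i⁻¹) • i • σ • x = j • (s * σ) • x := by simp [mul_smul]
    obtain ⟨g, hg, hgx⟩ := hT (j * s * i⁻¹) (i • σ • x) hiV (by rwa [e])
    refine ⟨g * γ, mul_mem (Subgroup.subset_closure (hmem i (Or.inr hi) s hs j hj g hg)) hγ, ?_⟩
    rw [mul_smul, hγx, hgx, e]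
  have main : ∀ σ ∈ Subgroup.closure S, ∀ x ∈ V, ∀ j ∈ I', j • σ • x ∈ V →
      ∃ γ ∈ Subgroup.closure T', γ • x = j • σ • x := by
    intro σ hσ x hx
    induction hσ using Subgroup.closure_induction_left with
    | one =>
      intro j hj hjV
      rw [one_smul] at hjV ⊢
      obtain ⟨g, hg, hgx⟩ := hT (j * 1 * 1⁻¹) x hx (by simpa using hjV)
      exact ⟨g, Subgroup.subset_closure (hmem 1 (Or.inl rfl) 1 (Or.inl rfl) j hj g hg),
        by simpa using hgx⟩
    | mul_left s hs σ _ ih => exact step s (Or.inr (Or.inl hs)) σ x hx ih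
    | inv_mul_cancel s hs σ _ ih => exact step s⁻¹ (Or.inr (Or.inr ⟨s, hs, rfl⟩)) σ x hx ih
  refine ⟨T', ?_, ?_, fun x hx a ha => ?_⟩
  · exact hI'.biUnion fun i _ => hS'.biUnion fun s _ => hI'.biUnion fun j _ => hTf _
  · intro g hg
    simp only [T', mem_iUnion] at hg
    obtain ⟨i, -, s, -, j, -, hg⟩ := hg
    exact hTV _ hg
  · obtain ⟨σ, hσ, hσx⟩ := hSorb x a
    obtain ⟨γ, hγ, h⟩ := main σ hσ x hx 1 (Or.inl rfl) (by rwa [one_smul, hσx])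
    exact ⟨γ, hγ, by rw [h, one_smul, hσx]⟩

theorem infinite_orbit_inter (x : X) {V : Set X} (hV : IsOpen V) (hne : V.Nonempty) :
    (MulAction.orbit A x ∩ V).Infinite := by
  intro hfin
  obtain ⟨a, haV, haF⟩ := exists_smul_mem A x hV hne hfin
  exact haF ⟨⟨a, rfl⟩, haV⟩

end AlternatingAction

/-! ### Long paths in coset spaces -/

section Paths

open scoped Pointwise

variable {W : Type*} [Group W]

/-- An element of `T ^ m` is the end point of a path of length `m` with steps in `T`. -/
theorem exists_path_of_mem_pow {T : Set W} {m : ℕ} {γ : W} (hγ : γ ∈ T ^ m) :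
    ∃ f : ℕ → W, (∀ a < m, f (a + 1) * (f a)⁻¹ ∈ T) ∧
      ∀ a ≤ m, f a ∈ T ^ a ∧ γ * (f a)⁻¹ ∈ T ^ (m - a) := by
  induction m generalizing γ with
  | zero =>
    refine ⟨fun _ => 1, by simp, fun a ha => ?_⟩
    obtain rfl : a = 0 := by omega
    simpa using hγ
  | succ m ih =>
    rw [pow_succ'] at hγ
    obtain ⟨t, ht, γ', hγ', rfl⟩ := hγ
    obtain ⟨f, hf1, hf2⟩ := ih hγ'
    have hfm : f m = γ' := by
      have := (hf2 m le_rfl).2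
      rw [Nat.sub_self, pow_zero, Set.mem_one, mul_inv_eq_one] at this
      exact this.symm
    refine ⟨fun a => if a ≤ m then f a else t * γ', fun a ha => ?_, fun a ha => ?_⟩
    · simp only [if_pos (by omega : a ≤ m)]
      by_cases h : a + 1 ≤ m
      · rw [if_pos h]
        exact hf1 a h
      · obtain rfl : a = m := by omega
        rw [if_neg h, hfm, mul_inv_cancel_right]
        exact ht
    · by_cases h : a ≤ m
      · simp only [if_pos h]
        refine ⟨(hf2 a h).1, ?_⟩
        rw [show m + 1 - a = (m - a) + 1 by omega, pow_succ', mul_assoc]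
        exact Set.mul_mem_mul ht (hf2 a h).2
      · obtain rfl : a = m + 1 := by omega
        simp only [if_neg h]
        refine ⟨?_, by simp⟩
        rw [pow_succ']
        exact Set.mul_mem_mul ht hγ'

/-- If `T` is a finite set generating an infinite subgroup, and `M` contains no non-trivial normal
subgroup, then some `T`-paths in the coset space of `M` visit arbitrarily many points: otherwise
the generated group would act through a finite quotient. -/
theorem exists_long_path {T : Set W} (hT : T.Finite) (h1 : (1 : W) ∈ T) (hinv : ∀ t ∈ T, t⁻¹ ∈ T)
    (hinf : Infinite (Subgroup.closure T)) {M : Subgroup W} (hM : M.normalCore = ⊥) (m : ℕ) :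
    ∃ v : ℕ → W, (∀ a < m, v (a + 1) * (v a)⁻¹ ∈ T) ∧
      ∀ a b, a < b → b ≤ m → (v a)⁻¹ * v b ∉ M := by
  by_contra! hcon
  have hm : m ≠ 0 := by
    rintro rfl
    obtain ⟨a, b, hab, hb, -⟩ := hcon (fun _ => 1) (by simp)
    omega
  let R : Set W := T ^ (m - 1)
  have hRfin : R.Finite := by
    have : ∀ k, (T ^ k).Finite := fun k => by
      induction k with
      | zero => simp
      | succ k ih => rw [pow_succ]; exact ih.mul hT
    exact this _
  have hpow : ∀ {i j}, i ≤ j → T ^ i ⊆ T ^ j := fun hij => Set.pow_subset_pow_right h1 hij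
  have h1R : (1 : W) ∈ R := hpow (Nat.zero_le _) (by simp)
  -- The `T ^ m`-neighbourhood of a coset is its `T ^ (m - 1)`-neighbourhood.
  have key : ∀ z : W ⧸ M, ∀ γ ∈ T ^ m, ∃ r ∈ R, γ • z = r • z := by
    intro z γ hγ
    obtain ⟨g, rfl⟩ := QuotientGroup.mk_surjective z
    obtain ⟨f, hf1, hf2⟩ := exists_path_of_mem_pow hγ
    obtain ⟨a, b, hab, hb, hv⟩ := hcon (fun a => f a * g) (fun a ha => by simpa using hf1 a ha)
    have e : f a • (g : W ⧸ M) = f b • (g : W ⧸ M) := QuotientGroup.eq.2 hv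
    refine ⟨γ * (f b)⁻¹ * f a, ?_, ?_⟩
    · have := Set.mul_mem_mul (hf2 b hb).2 (hf2 a (hab.le.trans hb)).1
      rw [← pow_add] at this
      exact hpow (by omega) this
    · rw [mul_smul, e, ← mul_smul, inv_mul_cancel_right]
  have hTR : ∀ z : W ⧸ M, ∀ t ∈ T, ∀ r ∈ R, ∃ r' ∈ R, (t * r) • z = r' • z := by
    intro z t ht r hr
    refine key z _ ?_
    have := Set.mul_mem_mul ht hr
    rwa [← pow_succ', show m - 1 + 1 = m by omega] at this
  -- The stabilizer of a coset is determined by a finite pattern.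
  have : Finite T := hT
  have : Finite R := hRfin
  let pat : W ⧸ M → Set (T × R × R) := fun z => {p | (p.1.1 * p.2.1.1) • z = p.2.2.1 • z}
  have hpat : ∀ z z', pat z = pat z' → ∀ γ ∈ Subgroup.closure T,
      ∃ r ∈ R, γ • z = r • z ∧ γ • z' = r • z' := by
    intro z z' hzz γ hγ
    have step : ∀ t ∈ T, ∀ γ : W, (∃ r ∈ R, γ • z = r • z ∧ γ • z' = r • z') →
        ∃ r ∈ R, (t * γ) • z = r • z ∧ (t * γ) • z' = r • z' := by
      rintro t ht γ ⟨r, hr, e1, e2⟩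
      obtain ⟨r', hr', e⟩ := hTR z t ht r hr
      have hp : ((⟨t, ht⟩, ⟨r, hr⟩, ⟨r', hr'⟩) : T × R × R) ∈ pat z := e
      rw [hzz] at hp
      refine ⟨r', hr', ?_, ?_⟩
      · rw [mul_smul, e1, ← mul_smul, e]
      · rw [mul_smul, e2, ← mul_smul]
        exact hp
    induction hγ using Subgroup.closure_induction_left with
    | one => exact ⟨1, h1R, rfl, rfl⟩
    | mul_left t ht γ _ ih => exact step t ht γ ih
    | inv_mul_cancel t ht γ _ ih => exact step _ (hinv t ht) γ ih
  have hstab : ∀ z z', pat z = pat z' → ∀ γ ∈ Subgroup.closure T, γ • z = z → γ • z' = z' := by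
    intro z z' hzz γ hγ h
    obtain ⟨r, hr, e1, e2⟩ := hpat z z' hzz γ hγ
    have hp : ((⟨1, h1⟩, ⟨r, hr⟩, ⟨1, h1R⟩) : T × R × R) ∈ pat z := by
      change (1 * r) • z = (1 : W) • z
      rw [one_mul, one_smul, ← e1, h]
    rw [hzz] at hp
    have hp' : (1 * r) • z' = (1 : W) • z' := hp
    rw [one_mul, one_smul] at hp'
    rw [e2, hp']
  let rep : Set (T × R × R) → W ⧸ M := fun p => Function.invFun pat p
  have hrep : ∀ z, pat (rep (pat z)) = pat z := fun z => Function.invFun_eq ⟨z, rfl⟩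
  have hex : ∀ (γ : Subgroup.closure T) (p : Set (T × R × R)),
      ∃ r : R, γ.1 • rep p = r.1 • rep p := by
    intro γ p
    obtain ⟨r, hr, e, -⟩ := hpat (rep p) (rep p) rfl γ.1 γ.2
    exact ⟨⟨r, hr⟩, e⟩
  choose Φ hΦ using hex
  have hinj : Function.Injective Φ := by
    intro γ γ' hγγ
    have hfix : ∀ z : W ⧸ M, (γ'.1⁻¹ * γ.1) • z = z := by
      intro z
      refine hstab (rep (pat z)) z (hrep z) _ (mul_mem (inv_mem γ'.2) γ.2) ?_
      rw [mul_smul, inv_smul_eq_iff, hΦ, hΦ, hγγ]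
    have hcore : γ'.1⁻¹ * γ.1 ∈ M.normalCore := by
      intro g
      have := hfix ((g⁻¹ : W) : W ⧸ M)
      have h2 := QuotientGroup.eq.1 this
      have h3 := inv_mem h2
      simpa [mul_assoc] using h3
    rw [hM, Subgroup.mem_bot, inv_mul_eq_one] at hcore
    exact Subtype.ext hcore.symm
  exact not_finite_iff_infinite.2 hinf (Finite.of_injective Φ hinj)

end Paths

/-! ### Coset spaces of finite asymptotic dimension -/

/-- The coset space of `L` has asymptotic dimension at most `n`, in the following sense: for every
finite set `P` of group elements it is covered by `n + 1` families of sets of uniformly bounded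
cardinality, such that no element of `P` moves a point of one set into another one of the same
family. -/
def CosetDimLE {A : Type*} [Group A] (L : Subgroup A) (n : ℕ) : Prop :=
  ∀ P : Set A, P.Finite → ∃ N : ℕ, ∃ 𝒟 : Fin (n + 1) → Set (Set (A ⧸ L)),
    (∀ i, ∀ D ∈ 𝒟 i, D.encard ≤ N) ∧
    (∀ i, ∀ D ∈ 𝒟 i, ∀ D' ∈ 𝒟 i, D ≠ D' → ∀ x ∈ D, ∀ p ∈ P, p • x ∉ D') ∧
    ∀ x, ∃ i, ∃ D ∈ 𝒟 i, x ∈ D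

section Grid

open scoped Pointwise

/-- A coset space does not have dimension at most `n` if arbitrarily long `(n + 1)`-dimensional grids
can be mapped injectively into it, such that the images of nearby grid points differ by an element
of a fixed finite set: sets of bounded cardinality are smaller than the grid in every coordinate. -/
theorem not_cosetDimLE_of_grid {A : Type*} [Group A] {L : Subgroup A} {n : ℕ} {P : Set A}
    (hP : P.Finite)
    (hgrid : ∀ m : ℕ, ∃ Φ : (Fin (n + 1) → ℕ) → A ⧸ L,
      (∀ x y, (∀ j, x j ≤ m) → (∀ j, y j ≤ m) → (∀ j, x j ≤ y j + 2 ∧ y j ≤ x j + 2) →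
        ∃ p ∈ P, Φ y = p • Φ x) ∧
      ∀ x y, (∀ j, x j ≤ m) → (∀ j, y j ≤ m) → Φ x = Φ y → x = y) :
    ¬ CosetDimLE L n := by
  classical
  intro hdim
  obtain ⟨N, 𝒟, hN, hsep, hcov⟩ := hdim P hP
  obtain ⟨Φ, hadj, hinj⟩ := hgrid (2 * N + 1)
  set m := 2 * N + 1 with hm
  -- `near i x D`: the point `x` is adjacent to a grid point lying in `D`.
  let near : (Fin (n + 1) → ℕ) → Set (A ⧸ L) → Prop := fun x D =>
    ∃ w : Fin (n + 1) → ℕ, (∀ j, w j ≤ m) ∧ (∀ j, x j ≤ w j + 1 ∧ w j ≤ x j + 1) ∧ Φ w ∈ D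
  have huniq : ∀ i x, ∀ D ∈ 𝒟 i, ∀ D' ∈ 𝒟 i, near x D → near x D' → D = D' := by
    rintro i x D hD D' hD' ⟨w, hwm, hw, hwD⟩ ⟨w', hwm', hw', hwD'⟩
    by_contra hne
    obtain ⟨p, hp, e⟩ := hadj w w' hwm hwm' fun j => by
      have := hw j; have := hw' j; omega
    exact hsep i D hD D' hD' hne _ hwD p hp (e ▸ hwD')
  -- A bounded set leaves room for a threshold in every coordinate.
  have hthr : ∀ (i : Fin (n + 1)) (D : Set (A ⧸ L)), D ∈ 𝒟 i → ∃ t, 1 ≤ t ∧ t ≤ m ∧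
      ∀ w : Fin (n + 1) → ℕ, (∀ j, w j ≤ m) → Φ w ∈ D → t ≠ w i ∧ t ≠ w i + 1 := by
    intro i D hD
    let C : Set ℕ := {c | ∃ w : Fin (n + 1) → ℕ, (∀ j, w j ≤ m) ∧ Φ w ∈ D ∧ w i = c}
    choose! wc hwc using fun (c : ℕ) (hc : c ∈ C) => hc
    have hCN : C.encard ≤ N := by
      refine (encard_le_encard_of_injOn (f := fun c => Φ (wc c)) (fun c hc => (hwc c hc).2.1) ?_
        ).trans (hN i D hD)
      intro c hc c' hc' e
      have := hinj _ _ (hwc c hc).1 (hwc c' hc').1 e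
      rw [← (hwc c hc).2.2, ← (hwc c' hc').2.2, this]
    have hC2 : (C ∪ (fun c => c + 1) '' C).encard ≤ (2 * N : ℕ) := by
      refine (encard_union_le _ _).trans ?_
      rw [two_mul, Nat.cast_add]
      exact add_le_add hCN ((encard_image_le _ _).trans hCN)
    have hnot : ¬ (Finset.Icc 1 m : Set ℕ) ⊆ C ∪ (fun c => c + 1) '' C := by
      intro hsub
      have h1 := (encard_le_encard hsub).trans hC2
      rw [encard_coe_eq_coe_finsetCard, Nat.card_Icc] at h1
      have h2 : m + 1 - 1 ≤ 2 * N := by exact_mod_cast h1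
      omega
    obtain ⟨t, ht, htC⟩ := Set.not_subset.1 hnot
    rw [Finset.mem_coe, Finset.mem_Icc] at ht
    refine ⟨t, ht.1, ht.2, fun w hw hwD => ⟨?_, ?_⟩⟩
    · rintro rfl
      exact htC (Or.inl ⟨w, hw, hwD, rfl⟩)
    · rintro rfl
      exact htC (Or.inr ⟨w i, ⟨w, hw, hwD, rfl⟩, rfl⟩)
  choose! t ht1 htm ht using hthr
  -- Cut at the threshold of the piece near the given point.
  let thr : Fin (n + 1) → (Fin (n + 1) → ℕ) → ℕ := fun i x =>
    if h : ∃ D ∈ 𝒟 i, near x D then t i h.choose else 1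
  have hthr : ∀ i x, ∀ D ∈ 𝒟 i, near x D → thr i x = t i D := by
    intro i x D hD hx
    have h : ∃ D ∈ 𝒟 i, near x D := ⟨D, hD, hx⟩
    simp only [thr, dif_pos h]
    rw [huniq i x _ h.choose_spec.1 D hD h.choose_spec.2 hx]
  have hthr1 : ∀ i x, 1 ≤ thr i x := by
    intro i x
    by_cases h : ∃ D ∈ 𝒟 i, near x D
    · simp only [thr, dif_pos h]
      exact ht1 i _ h.choose_spec.1
    · simp only [thr, dif_neg h]
      exact le_rfl
  have hthrm : ∀ i x, thr i x ≤ m := by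
    intro i x
    by_cases h : ∃ D ∈ 𝒟 i, near x D
    · simp only [thr, dif_pos h]
      exact htm i _ h.choose_spec.1
    · simp only [thr, dif_neg h]
      omega
  obtain ⟨b, hb, hbi⟩ := CubicalGrid.exists_unitCube (k := n + 1) (m := m)
    (fun i x => thr i x ≤ x i)
    (fun i x hx => by have := hthr1 i x; omega) (fun i x hx => by have := hthrm i x; omega)
  obtain ⟨i, D, hD, hbD⟩ := hcov (Φ b)
  refine hbi i ⟨t i D ≤ b i, fun x hx => ?_⟩
  have hnear : near x D := ⟨b, fun j => (hb j).le, fun j => by have := hx j; omega, hbD⟩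
  rw [hthr i x D hD hnear]
  have := ht i D hD b (fun j => (hb j).le) hbD
  have := hx i
  omega

end Grid

section AlternatingAction

variable {A X : Type*} [Group A] [TopologicalSpace X] [MulAction A X] [IsAlternatingAction A X]
  [CompactSpace X] [T2Space X] [TotallyDisconnectedSpace X] [Infinite X]

open IsAlternatingAction
open scoped Pointwise

variable (A) in
theorem pairwise_commute_altRist {ι : Type*} {U : ι → Set X}
    (hU : Pairwise (Function.onFun Disjoint U)) :
    Pairwise fun i j => ∀ x y : A, x ∈ altRist A (U i) → y ∈ altRist A (U j) → Commute x y :=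
  fun _ _ hij _ _ hx hy => commute_of_mem_altRist (hU hij) hx hy

variable (A) in
/-- The product of the groups `altRist A (U i)` for disjoint `U i`. -/
noncomputable def altRistProd {n : ℕ} (U : Fin n → Set X)
    (hU : Pairwise (Function.onFun Disjoint U)) : (∀ i, altRist A (U i)) →* A :=
  Subgroup.noncommPiCoprod (pairwise_commute_altRist A hU)

theorem altRistProd_mulSingle {n : ℕ} {U : Fin n → Set X}
    (hU : Pairwise (Function.onFun Disjoint U)) (i : Fin n) (g : altRist A (U i)) :
    altRistProd A U hU (Pi.mulSingle i g) = g :=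
  Subgroup.noncommPiCoprod_mulSingle (hcomm := pairwise_commute_altRist A hU) i g

variable (A) in
theorem exists_ne_one_mem_altRist {V : Set X} (hV : IsOpen V) (hne : V.Nonempty) :
    ∃ g ∈ altRist A V, g ≠ 1 := by
  obtain ⟨x, hx⟩ := hne
  obtain ⟨a, haV, hax⟩ := exists_smul_mem A x hV ⟨x, hx⟩ (Set.toFinite {x})
  obtain ⟨g, hg, hgx⟩ := exists_mem_altRist_eventuallyEq hV hx haV
  refine ⟨g, hg, ?_⟩
  rintro rfl
  have := hgx.self_of_nhds
  rw [one_smul] at this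
  exact hax this.symm

/-- If the elements of `L` in the product of the groups `altRist A (U i)`, `i ≤ n`, have all their
components in proper subgroups, then the coset space of `L` has dimension greater than `n`. -/
theorem not_cosetDimLE_of_forall_ne_top {n : ℕ} {U : Fin (n + 1) → Set X}
    (hUc : ∀ i, IsClopen (U i)) (hne : ∀ i, (U i).Nonempty)
    (hU : Pairwise (Function.onFun Disjoint U)) {L : Subgroup A}
    (M : ∀ i, Subgroup (altRist A (U i))) (hM : ∀ i, M i ≠ ⊤)
    (hL : ∀ g, altRistProd A U hU g ∈ L → ∀ i, g i ∈ M i) : ¬ CosetDimLE L n := by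
  classical
  have hex : ∀ i, ∃ T : Set (altRist A (U i)), T.Finite ∧ 1 ∈ T ∧ (∀ t ∈ T, t⁻¹ ∈ T) ∧
      Infinite (Subgroup.closure T) := by
    intro i
    obtain ⟨T, hT, hTU, hTorb⟩ := exists_finite_subset_altRist (A := A) (hUc i) (hne i)
    let T₀ : Set (altRist A (U i)) := Subtype.val ⁻¹' T
    have hT₀ : T₀.Finite := hT.preimage Subtype.val_injective.injOn
    refine ⟨insert 1 (T₀ ∪ T₀⁻¹), (hT₀.union hT₀.inv).insert 1, Or.inl rfl, ?_, ?_⟩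
    · rintro t (rfl | ht | ht)
      · exact Or.inl inv_one
      · exact Or.inr (Or.inr (by simpa using ht))
      · exact Or.inr (Or.inl ht)
    · obtain ⟨x, hx⟩ := hne i
      rw [← not_finite_iff_infinite]
      intro hfin
      refine infinite_orbit_inter (A := A) x (hUc i).isOpen ⟨x, hx⟩
        ((Set.finite_range fun γ : Subgroup.closure (insert 1 (T₀ ∪ T₀⁻¹)) =>
          (γ.1 : A) • x).subset ?_)
      rintro _ ⟨⟨a, rfl⟩, haU⟩
      obtain ⟨γ, hγ, hγx⟩ := hTorb x hx a haU
      have hle : Subgroup.closure T ≤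
          (Subgroup.closure (insert 1 (T₀ ∪ T₀⁻¹))).map (altRist A (U i)).subtype := by
        rw [Subgroup.closure_le]
        intro t ht
        exact ⟨⟨t, hTU ht⟩, Subgroup.subset_closure (Or.inr (Or.inl ht)), rfl⟩
      obtain ⟨γ', hγ', rfl⟩ := hle hγ
      exact ⟨⟨γ', hγ'⟩, hγx⟩
  choose T hT h1 hinv hinf using hex
  have hcore : ∀ i, (M i).normalCore = ⊥ := fun i =>
    (altRist_eq_bot_or_eq_top (hUc i).isOpen (M i).normalCore).resolve_right fun h =>
      hM i (top_le_iff.1 (h ▸ (M i).normalCore_le))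
  have hP : (altRistProd A U hU '' {s | ∀ i, s i ∈ T i * T i}).Finite := by
    refine Set.Finite.image _ ?_
    have := Set.Finite.pi (fun i => (hT i).mul (hT i))
    refine this.subset fun s hs => ?_
    rw [Set.mem_univ_pi]
    exact hs
  refine not_cosetDimLE_of_grid hP fun m => ?_
  choose v hv1 hv2 using fun i => exists_long_path (hT i) (h1 i) (hinv i) (hinf i) (hcore i) m
  have hv3 : ∀ i a b, a ≤ m → b ≤ m → a ≤ b + 2 → b ≤ a + 2 →
      v i b * (v i a)⁻¹ ∈ T i * T i := by
    have up : ∀ i a b, a ≤ b → b ≤ m → b ≤ a + 2 → v i b * (v i a)⁻¹ ∈ T i * T i := by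
      intro i a b hab hb hab2
      obtain rfl | rfl | rfl : b = a ∨ b = a + 1 ∨ b = a + 2 := by omega
      · rw [mul_inv_cancel]
        exact ⟨1, h1 i, 1, h1 i, mul_one 1⟩
      · exact ⟨_, hv1 i a (by omega), 1, h1 i, mul_one _⟩
      · exact ⟨_, hv1 i (a + 1) (by omega), _, hv1 i a (by omega), by group⟩
    intro i a b ha hb hab hba
    rcases le_total a b with h | h
    · exact up i a b h hb hba
    · obtain ⟨s, hs, t, ht, hst⟩ := up i b a h ha hab
      refine ⟨t⁻¹, hinv i t ht, s⁻¹, hinv i s hs, ?_⟩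
      have hst' : s * t = v i a * (v i b)⁻¹ := hst
      change t⁻¹ * s⁻¹ = _
      rw [← mul_inv_rev, hst', mul_inv_rev, _root_.inv_inv]
  refine ⟨fun x => (altRistProd A U hU fun i => v i (x i) : A), fun x y hx hy hxy => ?_,
    fun x y hx hy e => ?_⟩
  · refine ⟨altRistProd A U hU ((fun i => v i (y i)) * (fun i => v i (x i))⁻¹),
      ⟨_, fun i => hv3 i _ _ (hx i) (hy i) (hxy i).1 (hxy i).2, rfl⟩, ?_⟩
    change _ = ((altRistProd A U hU ((fun i => v i (y i)) * (fun i => v i (x i))⁻¹) *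
      altRistProd A U hU fun i => v i (x i) : A) : A ⧸ L)
    rw [map_mul, map_inv, inv_mul_cancel_right]
  · have h := hL _ (by
      have := QuotientGroup.eq.1 e
      rwa [← map_inv, ← map_mul] at this)
    funext i
    rcases lt_trichotomy (x i) (y i) with hlt | heq | hlt
    · exact absurd (h i) (hv2 i _ _ hlt (hy i))
    · exact heq
    · have h' := inv_mem (h i)
      simp only [Pi.mul_apply, Pi.inv_apply, mul_inv_rev, _root_.inv_inv] at h'
      exact absurd h' (hv2 i _ _ hlt (hx i))

/-- If the coset space of `L` has dimension at most `n`, then of `n + 1` disjoint clopen sets at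
least one has its alternating rigid stabilizer contained in `L`. -/
theorem exists_altRist_le_of_cosetDimLE {n : ℕ} {L : Subgroup A} (hdim : CosetDimLE L n)
    {U : Fin (n + 1) → Set X} (hUc : ∀ i, IsClopen (U i)) (hne : ∀ i, (U i).Nonempty)
    (hU : Pairwise (Function.onFun Disjoint U)) : ∃ i, altRist A (U i) ≤ L := by
  classical
  by_contra! hcon
  let L' : Subgroup (∀ i, altRist A (U i)) := L.comap (altRistProd A U hU)
  by_cases hproj : ∀ i, L'.map (Pi.evalMonoidHom (fun i => altRist A (U i)) i) ≠ ⊤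
  · exact not_cosetDimLE_of_forall_ne_top hUc hne hU _ hproj
      (fun g hg i => ⟨g, hg, rfl⟩) hdim
  push Not at hproj
  obtain ⟨i, hi⟩ := hproj
  -- The projection of `L'` is onto, hence `L ∩ altRist A (U i)` is normal, hence trivial.
  have hnormal : (L.subgroupOf (altRist A (U i))).Normal := by
    refine ⟨fun k hk g => ?_⟩
    obtain ⟨l, hl, hlg⟩ : g ∈ L'.map (Pi.evalMonoidHom (fun i => altRist A (U i)) i) := by
      rw [hi]; trivial
    have e : Pi.mulSingle i (g * k * g⁻¹) = l * Pi.mulSingle i k * l⁻¹ := by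
      funext j
      by_cases hj : j = i
      · subst hj
        have hlg' : l j = g := hlg
        simp [hlg']
      · simp [hj]
    have hk' : (k : A) ∈ L := hk
    change ((g * k * g⁻¹ : altRist A (U i)) : A) ∈ L
    rw [← altRistProd_mulSingle hU i (g * k * g⁻¹), e, map_mul, map_mul, map_inv,
      altRistProd_mulSingle]
    exact mul_mem (mul_mem hl hk') (inv_mem hl)
  have htriv : ∀ g ∈ altRist A (U i), g ∈ L → g = 1 := by
    rcases altRist_eq_bot_or_eq_top (hUc i).isOpen (L.subgroupOf (altRist A (U i))) with h | h
    · intro g hg hgL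
      have : (⟨g, hg⟩ : altRist A (U i)) ∈ L.subgroupOf (altRist A (U i)) := hgL
      rw [h, Subgroup.mem_bot] at this
      exact congrArg Subtype.val this
    · exact absurd (Subgroup.subgroupOf_eq_top.1 h) (hcon i)
  have hinfU := infinite_of_isOpen A (hUc i).isOpen (hne i)
  let f := hinfU.natEmbedding
  obtain ⟨V, hVc, hxV, hVU, hV⟩ := exists_disjoint_isClopen
    (x := fun j : Fin (n + 1) => (f j : X)) (fun a b h => by
      have := f.injective (Subtype.ext h)
      exact Fin.ext this) (O := fun _ => U i) (fun _ => (hUc i).isOpen) (fun j => (f j).2)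
  refine not_cosetDimLE_of_forall_ne_top hVc (fun j => ⟨_, hxV j⟩) hV (fun _ => ⊥)
    (fun j h => ?_) (fun g hg j => ?_) hdim
  · obtain ⟨g, hg, hg1⟩ := exists_ne_one_mem_altRist A (hVc j).isOpen ⟨_, hxV j⟩
    have : (⟨g, hg⟩ : altRist A (V j)) ∈ (⊥ : Subgroup (altRist A (V j))) := by rw [h]; trivial
    exact hg1 (congrArg Subtype.val this)
  · have hrange : altRistProd A V hV g ∈ altRist A (U i) := by
      have : (altRistProd A V hV).range ≤ altRist A (U i) := by
        rw [altRistProd, Subgroup.noncommPiCoprod_range]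
        exact iSup_le fun j => altRist_mono (hVU j)
      exact this ⟨g, rfl⟩
    have h1 := htriv _ hrange hg
    -- The components are determined by the action on the disjoint sets `V j`.
    have hinj : Function.Injective (altRistProd A V hV) := by
      refine Subgroup.injective_noncommPiCoprod_of_iSupIndep
        (hcomm := pairwise_commute_altRist A hV) ?_
      intro j
      rw [Subgroup.disjoint_def]
      intro a ha ha'
      have hle : (⨆ k, ⨆ (_ : k ≠ j), altRist A (V k)) ≤ altRist A (V j)ᶜ :=
        iSup_le fun k => iSup_le fun hk => altRist_mono
          (Set.subset_compl_iff_disjoint_right.2 (hV hk))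
      refine eq_of_smul_eq_smul (α := X) fun x => ?_
      rw [one_smul]
      by_cases hx : x ∈ V j
      · exact smul_eq_of_mem_altRist (hle ha') x fun h => h hx
      · exact smul_eq_of_mem_altRist ha x hx
    have h2 : g = 1 := hinj (by rw [h1, map_one])
    rw [h2]
    exact one_mem _

/-! ### The finite set attached to a subgroup -/

variable (X) in
/-- The set of points without a clopen neighbourhood whose alternating rigid stabilizer is contained
in `L`. -/
def subgroupSupport (L : Subgroup A) : Set X :=
  {x | ∀ O : Set X, IsClopen O → x ∈ O → ¬ altRist A O ≤ L}

/-- Disjoint neighbourhoods of `n + 1` points of the support would have alternating rigid stabilizers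
not contained in `L`. -/
theorem encard_subgroupSupport_le {n : ℕ} {L : Subgroup A} (hdim : CosetDimLE L n) :
    (subgroupSupport X L).encard ≤ n := by
  by_contra! hlt
  have h1 : ((n + 1 : ℕ) : ℕ∞) ≤ (subgroupSupport X L).encard := by
    simpa using Order.add_one_le_of_lt hlt
  obtain ⟨t, ht, htc⟩ := exists_subset_encard_eq h1
  have htfin : t.Finite := finite_of_encard_eq_coe htc
  have hcard : Nat.card t = n + 1 := by
    rw [Nat.card_coe_set_eq, ncard_def, htc]; rfl
  have : Finite t := htfin
  let e : Fin (n + 1) ≃ t := (Finite.equivFinOfCardEq hcard).symm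
  obtain ⟨V, hVc, hxV, -, hV⟩ := exists_disjoint_isClopen
    (x := fun j : Fin (n + 1) => (e j : X)) (fun a b h => e.injective (Subtype.ext h))
    (O := fun _ => univ) (fun _ => isOpen_univ) (fun j => mem_univ _)
  obtain ⟨i, hi⟩ := exists_altRist_le_of_cosetDimLE hdim hVc (fun j => ⟨_, hxV j⟩) hV
  exact ht (e i).2 _ (hVc i) (hxV i) hi

/-- If the coset space of `L` is finite-dimensional, then `L` contains the alternating rigid
stabilizers of all clopen sets avoiding its support. -/
theorem altRist_le_of_disjoint_subgroupSupport {n : ℕ} {L : Subgroup A} (hdim : CosetDimLE L n)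
    {V : Set X} (hV : IsClopen V) (hd : Disjoint V (subgroupSupport X L)) : altRist A V ≤ L := by
  -- Any two small clopen sets with stabilizer in `L` are contained in a third one.
  have hmerge : ∀ O O' : Set X, IsClopen O → IsClopen O' → altRist A O ≤ L → altRist A O' ≤ L →
      ∃ U : Set X, IsClopen U ∧ O ∪ O' ⊆ U ∧ altRist A U ≤ L := by
    intro O O' hO hO' h h'
    rcases O.eq_empty_or_nonempty with rfl | hne
    · exact ⟨O', hO', by simp, h'⟩
    rcases O'.eq_empty_or_nonempty with rfl | hne'
    · exact ⟨O, hO, by simp, h⟩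
    by_cases hdis : (O ∩ O').Nonempty
    · exact ⟨O ∪ O', hO.union hO', subset_rfl, altRist_union_le hO.isOpen hO'.isOpen hdis h h'⟩
    have hdis' : Disjoint O O' := Set.disjoint_iff_inter_eq_empty.2
      (Set.not_nonempty_iff_eq_empty.1 hdis)
    let f := (infinite_of_isOpen A hO.isOpen hne).natEmbedding
    let f' := (infinite_of_isOpen A hO'.isOpen hne').natEmbedding
    obtain ⟨V, hVc, hxV, hVO, hVd⟩ := exists_disjoint_isClopen
      (x := fun j : Fin (n + 1) => (f j : X)) (fun a b h => Fin.ext (f.injective (Subtype.ext h)))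
      (O := fun _ => O) (fun _ => hO.isOpen) (fun j => (f j).2)
    obtain ⟨V', hVc', hxV', hVO', hVd'⟩ := exists_disjoint_isClopen
      (x := fun j : Fin (n + 1) => (f' j : X)) (fun a b h => Fin.ext (f'.injective (Subtype.ext h)))
      (O := fun _ => O') (fun _ => hO'.isOpen) (fun j => (f' j).2)
    obtain ⟨i, hi⟩ := exists_altRist_le_of_cosetDimLE (U := fun i => V i ∪ V' i) hdim
      (fun i => (hVc i).union (hVc' i)) (fun j => ⟨_, Or.inl (hxV j)⟩) (fun a b hab => by
        refine Set.disjoint_union_left.2 ⟨Set.disjoint_union_right.2 ⟨hVd hab, ?_⟩,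
          Set.disjoint_union_right.2 ⟨?_, hVd' hab⟩⟩
        · exact hdis'.mono (hVO a) (hVO' b)
        · exact (hdis'.mono (hVO b) (hVO' a)).symm)
    refine ⟨O ∪ (V i ∪ V' i) ∪ O', (hO.union ((hVc i).union (hVc' i))).union hO', ?_, ?_⟩
    · exact union_subset (subset_union_left.trans subset_union_left) subset_union_right
    · exact altRist_union_le (hO.union ((hVc i).union (hVc' i))).isOpen hO'.isOpen
        ⟨_, Or.inr (Or.inr (hxV' i)), hVO' i (hxV' i)⟩
        (altRist_union_le hO.isOpen ((hVc i).union (hVc' i)).isOpen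
          ⟨_, hVO i (hxV i), Or.inl (hxV i)⟩ h hi) h'
  obtain ⟨U, -, hVU, hU⟩ : ∃ U : Set X, IsClopen U ∧ V ⊆ U ∧ altRist A U ≤ L := by
    refine hV.isClosed.isCompact.induction_on
      (p := fun s => ∃ U : Set X, IsClopen U ∧ s ⊆ U ∧ altRist A U ≤ L) ?_ ?_ ?_ ?_
    · refine ⟨∅, isClopen_empty, subset_rfl, ?_⟩
      intro g hg
      have : g = 1 := eq_of_smul_eq_smul (α := X) fun x => by
        rw [one_smul]; exact smul_eq_of_mem_altRist hg x (by simp)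
      rw [this]
      exact one_mem L
    · rintro s t hst ⟨U, hU, htU, h⟩
      exact ⟨U, hU, hst.trans htU, h⟩
    · rintro s t ⟨U, hU, hsU, h⟩ ⟨U', hU', htU', h'⟩
      obtain ⟨U'', h1, h2, h3⟩ := hmerge U U' hU hU' h h'
      exact ⟨U'', h1, (union_subset_union hsU htU').trans h2, h3⟩
    · intro x hx
      have hxS : x ∉ subgroupSupport X L := fun h => Set.disjoint_left.1 hd hx h
      simp only [subgroupSupport, mem_ofPred_eq, not_forall, not_not] at hxS
      obtain ⟨O, hO, hxO, h⟩ := hxS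
      exact ⟨O, mem_nhdsWithin_of_mem_nhds (hO.isOpen.mem_nhds hxO), O, hO, subset_rfl, h⟩
  exact (altRist_mono hVU).trans hU

end AlternatingAction

section StabilizerField

variable {A X Y : Type*} [Group A] [TopologicalSpace X] [MulAction A X] [IsAlternatingAction A X]
  [CompactSpace X] [T2Space X] [TotallyDisconnectedSpace X] [Infinite X]
  [TopologicalSpace Y] [CompactSpace Y] [T2Space Y] [MulAction A Y]

/-! ### Fields of germ stabilizers -/

/-- The properties of the stabilizers `L y` of germs at the points `y` of a space on which a group
acts by elements of a full group: they are contained in the stabilizers of points, equivariant and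
lower semicontinuous. Their coset spaces are required to be finite-dimensional. -/
structure IsStabilizerField (L : Y → Subgroup A) : Prop where
  continuous_smul : ∀ g : A, Continuous fun y : Y => g • y
  smul_eq : ∀ y, ∀ g ∈ L y, g • y = y
  conj_mem : ∀ y, ∀ g ∈ L y, ∀ a : A, a * g * a⁻¹ ∈ L (a • y)
  isOpen : ∀ g : A, IsOpen {y | g ∈ L y}
  exists_dim : ∀ y, ∃ n, CosetDimLE (L y) n

namespace IsStabilizerField

variable {L : Y → Subgroup A} (hL : IsStabilizerField L)

include hL

theorem finite_support (y : Y) : (subgroupSupport X (L y)).Finite := by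
  obtain ⟨n, hn⟩ := hL.exists_dim y
  exact finite_of_encard_le_coe (encard_subgroupSupport_le hn)

theorem altRist_le {y : Y} {V : Set X} (hV : IsClopen V)
    (hd : Disjoint V (subgroupSupport X (L y))) : altRist A V ≤ L y := by
  obtain ⟨n, hn⟩ := hL.exists_dim y
  exact altRist_le_of_disjoint_subgroupSupport hn hV hd

theorem smul_mem_support {y : Y} {x : X} (hx : x ∈ subgroupSupport X (L y)) (a : A) :
    a • x ∈ subgroupSupport X (L (a • y)) := by
  intro O hO hxO hle
  refine hx ((fun z => a • z) ⁻¹' O) (hO.preimage (continuous_const_smul a)) hxO fun g hg => ?_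
  have h1 := conj_mem_altRist hg a
  have e : ((fun z : X => a⁻¹ • z) ⁻¹' ((fun z => a • z) ⁻¹' O)) = O := by
    ext z; simp
  rw [e] at h1
  have h2 := hL.conj_mem _ _ (hle h1) a⁻¹
  simpa [mul_assoc] using h2

theorem image_support (y : Y) (a : A) :
    subgroupSupport X (L (a • y)) = (fun x => a • x) '' subgroupSupport X (L y) := by
  apply Subset.antisymm
  · intro x hx
    have := hL.smul_mem_support hx a⁻¹
    rw [inv_smul_smul] at this
    exact ⟨_, this, smul_inv_smul a x⟩
  · rintro _ ⟨x, hx, rfl⟩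
    exact hL.smul_mem_support hx a

/-- An element acting trivially near the support of `L y` lies in `L y`. -/
theorem mem_of_eventually {y : Y} {g : A}
    (hg : ∀ x ∈ subgroupSupport X (L y), ∀ᶠ z in 𝓝 x, g • z = z) : g ∈ L y := by
  obtain ⟨V, hV, hd, hgV⟩ := mem_altStabilizer_of_eventually (hL.finite_support y) hg
  exact hL.altRist_le hV hd hgV

theorem support_eq_empty_iff {y : Y} : subgroupSupport X (L y) = ∅ ↔ L y = ⊤ := by
  constructor
  · intro h
    rw [eq_top_iff]
    intro g _
    exact hL.mem_of_eventually (X := X) (by simp [h])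
  · intro h
    rw [Set.eq_empty_iff_forall_notMem]
    intro x hx
    exact hx univ isClopen_univ (mem_univ _) (h ▸ le_top)

/-- A finite set cannot meet `V` if it is invariant under a group with infinite orbits on `V`. -/
theorem disjoint_of_forall_smul_mem {V F : Set X} (hF : F.Finite) (hV : IsOpen V) {T : Set A}
    (hT : ∀ x ∈ V, ∀ a : A, a • x ∈ V → ∃ γ ∈ Subgroup.closure T, γ • x = a • x)
    (hinv : ∀ γ ∈ Subgroup.closure T, ∀ x ∈ F, γ • x ∈ F) : Disjoint V F := by
  rw [Set.disjoint_left]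
  intro x hxV hxF
  refine infinite_orbit_inter (A := A) x hV ⟨x, hxV⟩ (hF.subset ?_)
  rintro _ ⟨⟨a, rfl⟩, ha⟩
  obtain ⟨γ, hγ, e⟩ := hT x hxV a ha
  have := hinv γ hγ x hxF
  rw [e] at this
  exact this

theorem eventually_support_subset {y : Y} {W : Set X} (hW : IsClopen W)
    (h : subgroupSupport X (L y) ⊆ W) : ∀ᶠ y' in 𝓝 y, subgroupSupport X (L y') ⊆ W := by
  rcases (Wᶜ).eq_empty_or_nonempty with he | hne
  · rw [compl_empty_iff] at he
    exact Eventually.of_forall fun y' => he ▸ subset_univ _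
  obtain ⟨T, hT, hTV, hTorb⟩ := exists_finite_subset_altRist (A := A) hW.compl hne
  have hTL : ∀ t ∈ T, t ∈ L y := fun t ht =>
    hL.altRist_le hW.compl (disjoint_compl_left_iff_subset.2 h) (hTV ht)
  have hev : ∀ᶠ y' in 𝓝 y, ∀ t ∈ T, t ∈ L y' :=
    (eventually_all_finite hT).2 fun t ht => (hL.isOpen t).mem_nhds (hTL t ht)
  filter_upwards [hev] with y' hy'
  rw [← disjoint_compl_left_iff_subset]
  refine hL.disjoint_of_forall_smul_mem (hL.finite_support y') hW.compl.isOpen hTorb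
    fun γ hγ x hx => ?_
  have := hL.smul_mem_support hx γ
  rwa [hL.smul_eq y' γ ((Subgroup.closure_le _).2 hy' hγ)] at this

theorem eventually_support_inter_nonempty {y : Y} {W : Set X} (hW : IsClopen W)
    (h : (subgroupSupport X (L y) ∩ W).Nonempty) :
    ∀ᶠ y' in 𝓝 y, (subgroupSupport X (L y') ∩ W).Nonempty := by
  by_contra hcon
  replace hcon := mem_closure_iff_frequently.2 (not_eventually.1 hcon)
  have hfix : ∀ g ∈ altRist A W, g • y = y := by
    intro g hg
    have hcl : IsClosed {y' : Y | g • y' = y'} :=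
      isClosed_eq (hL.continuous_smul g) continuous_id
    refine closure_minimal (fun y' hy' => ?_) hcl hcon
    have hdis : Disjoint W (subgroupSupport X (L y')) :=
      (Set.disjoint_iff_inter_eq_empty.2 (Set.not_nonempty_iff_eq_empty.1 hy')).symm
    exact hL.smul_eq y' g (hL.altRist_le hW hdis hg)
  obtain ⟨q, hqS, hqW⟩ := h
  obtain ⟨T, hT, hTV, hTorb⟩ := exists_finite_subset_altRist (A := A) hW ⟨q, hqW⟩
  refine Set.disjoint_left.1 (hL.disjoint_of_forall_smul_mem (hL.finite_support y) hW.isOpen hTorb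
    fun γ hγ x hx => ?_) hqW hqS
  have := hL.smul_mem_support hx γ
  rwa [hfix γ ((Subgroup.closure_le _).2 hTV hγ)] at this

theorem isClopen_support_nonempty : IsClopen {y | (subgroupSupport X (L y)).Nonempty} := by
  constructor
  · rw [← isOpen_compl_iff, isOpen_iff_mem_nhds]
    intro y hy
    have hy' : subgroupSupport X (L y) ⊆ ∅ := (Set.not_nonempty_iff_eq_empty.1 hy).subset
    filter_upwards [hL.eventually_support_subset isClopen_empty hy'] with z hz h
    exact h.ne_empty (subset_empty_iff.1 hz)
  · rw [isOpen_iff_mem_nhds]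
    intro y hy
    filter_upwards [hL.eventually_support_inter_nonempty (y := y) (W := univ) isClopen_univ
      (by rw [inter_univ]; exact hy)] with z hz
    rw [inter_univ] at hz
    exact hz

end IsStabilizerField

/-- Finitely many distinct points can be moved simultaneously into prescribed open sets. -/
theorem exists_forall_smul_mem {k : ℕ} {p : Fin k → X} (hp : Function.Injective p)
    {U : Fin k → Set X} (hU : ∀ i, IsOpen (U i)) (hne : ∀ i, (U i).Nonempty) :
    ∃ d : A, ∀ i, d • p i ∈ U i := by
  induction k with
  | zero => exact ⟨1, fun i => i.elim0⟩
  | succ k ih =>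
    obtain ⟨d, hd⟩ := ih (p := fun i => p i.castSucc) (fun i j h => Fin.castSucc_injective k (hp h))
      (fun i => hU i.castSucc) fun i => hne i.castSucc
    by_cases hlast : d • p (Fin.last k) ∈ U (Fin.last k)
    · exact ⟨d, fun i => Fin.lastCases hlast hd i⟩
    have hF : (range fun i : Fin k => d • p i.castSucc).Finite := finite_range _
    obtain ⟨a, haU, haF⟩ := exists_smul_mem A (d • p (Fin.last k)) (hU _) (hne _) hF
    obtain ⟨e, -, hee, heF⟩ := exists_mem_altRist_of_ne (f := a) (x := d • p (Fin.last k))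
      isOpen_univ (mem_univ _) (mem_univ _) (fun h => hlast (h ▸ haU)) hF (by
        rintro ⟨i, hi⟩
        exact (Fin.castSucc_lt_last i).ne (hp (smul_left_cancel d hi))) haF
    refine ⟨e * d, fun i => ?_⟩
    induction i using Fin.lastCases with
    | last => rw [mul_smul, hee.self_of_nhds]; exact haU
    | cast i => rw [mul_smul, heF _ ⟨i, rfl⟩]; exact hd i

/-- The cardinality of the supports is bounded: otherwise, moving the points of large supports
around, compactness would give a dense support. -/
theorem IsStabilizerField.exists_encard_support_le {L : Y → Subgroup A}
    (hL : IsStabilizerField L) : ∃ k : ℕ, ∀ y, (subgroupSupport X (L y)).encard ≤ k := by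
  by_contra! hcon
  let ι := {U : Set X // IsClopen U ∧ U.Nonempty}
  let C : ι → Set Y := fun U => {y | (subgroupSupport X (L y) ∩ U.1).Nonempty}
  have hC : ∀ U, IsClosed (C U) := by
    rintro ⟨U, hU, -⟩
    rw [← isOpen_compl_iff, isOpen_iff_mem_nhds]
    intro y hy
    have hy' : subgroupSupport X (L y) ⊆ Uᶜ := by
      rw [Set.subset_compl_iff_disjoint_right, Set.disjoint_iff_inter_eq_empty]
      exact Set.not_nonempty_iff_eq_empty.1 hy
    filter_upwards [hL.eventually_support_subset hU.compl hy'] with z hz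
    rintro ⟨x, hxS, hxU⟩
    exact hz hxS hxU
  have hne : (univ ∩ ⋂ U, C U).Nonempty := by
    refine isCompact_univ.inter_iInter_nonempty C hC fun u => ?_
    let e := u.equivFin
    obtain ⟨y, hy⟩ := hcon u.card
    obtain ⟨t, ht, htc⟩ := exists_subset_encard_eq hy.le
    have htfin : t.Finite := finite_of_encard_eq_coe htc
    have hcard : Nat.card t = u.card := by
      rw [Nat.card_coe_set_eq, ncard_def, htc]; rfl
    have : Finite t := htfin
    let e' : Fin u.card ≃ t := (Finite.equivFinOfCardEq hcard).symm
    obtain ⟨d, hd⟩ := exists_forall_smul_mem (A := A) (p := fun i => (e' i : X))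
      (fun a b h => e'.injective (Subtype.ext h)) (U := fun i => (e.symm i).1.1)
      (fun i => (e.symm i).1.2.1.isOpen) fun i => (e.symm i).1.2.2
    refine ⟨d • y, mem_univ _, mem_iInter₂.2 fun U hU => ?_⟩
    have := hd (e ⟨U, hU⟩)
    rw [Equiv.symm_apply_apply] at this
    exact ⟨_, hL.smul_mem_support (ht (e' (e ⟨U, hU⟩)).2) d, this⟩
  obtain ⟨y, -, hy⟩ := hne
  have hfin := hL.finite_support (X := X) y
  obtain ⟨w, hw⟩ := hfin.exists_notMem
  obtain ⟨W, hW, hwW, hWF⟩ := compact_exists_isClopen_in_isOpen hfin.isClosed.isOpen_compl hw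
  obtain ⟨x, hxS, hxW⟩ := mem_iInter.1 hy ⟨W, hW, ⟨w, hwW⟩⟩
  exact hWF hxW hxS

end StabilizerField

namespace EtaleGroupoid

variable {G X : Type*} [TopologicalSpace G] [TopologicalSpace X] {𝒢 : EtaleGroupoid G X}

/-! ### The action of the full group on the unit space -/

theorem inv_unit (x : X) : 𝒢.inv (𝒢.unit x) = 𝒢.unit x := by
  have h1 := 𝒢.mul_inv (𝒢.unit x)
  rw [𝒢.unit_mul_of rfl, 𝒢.rng_unit] at h1
  exact h1

namespace FullGroup

theorem exists_mem (g : 𝒢.FullGroup) (x : X) : ∃ γ ∈ g.1, 𝒢.src γ = x := by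
  have : x ∈ 𝒢.src '' (g.1 : Set G) := by rw [g.2.1]; trivial
  exact this

/-- The germ of `g` at `x`: the arrow of `g` with source `x`. -/
noncomputable def germ (g : 𝒢.FullGroup) (x : X) : G := (g.exists_mem x).choose

theorem germ_mem (g : 𝒢.FullGroup) (x : X) : g.germ x ∈ g.1 := (g.exists_mem x).choose_spec.1

@[simp]
theorem src_germ (g : 𝒢.FullGroup) (x : X) : 𝒢.src (g.germ x) = x :=
  (g.exists_mem x).choose_spec.2

theorem germ_eq {g : 𝒢.FullGroup} {γ : G} (h : γ ∈ g.1) {x : X} (hx : 𝒢.src γ = x) :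
    g.germ x = γ :=
  g.1.injOn_src (g.germ_mem x) h (by rw [src_germ, hx])

theorem germ_one (x : X) : (1 : 𝒢.FullGroup).germ x = 𝒢.unit x :=
  germ_eq (g := 1) (show 𝒢.unit x ∈ (1 : 𝒢.FullGroup).1 from ⟨x, trivial, rfl⟩) (𝒢.src_unit x)

theorem germ_mul (g h : 𝒢.FullGroup) (x : X) :
    (g * h).germ x = 𝒢.mul (g.germ (𝒢.rng (h.germ x))) (h.germ x) (src_germ _ _) :=
  germ_eq (g := g * h) (show 𝒢.mul _ _ _ ∈ (g * h).1 from
    ⟨_, g.germ_mem _, _, h.germ_mem _, src_germ _ _, rfl⟩) ((𝒢.src_mul _ _ _).trans (src_germ _ _))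

/-- The full group acts on the unit space by homeomorphisms. -/
noncomputable instance : MulAction 𝒢.FullGroup X where
  smul g x := 𝒢.rng (g.germ x)
  one_smul x := by
    change 𝒢.rng ((1 : 𝒢.FullGroup).germ x) = x
    rw [germ_one, 𝒢.rng_unit]
  mul_smul g h x := by
    change 𝒢.rng ((g * h).germ x) = 𝒢.rng (g.germ (𝒢.rng (h.germ x)))
    rw [germ_mul, 𝒢.rng_mul]

theorem smul_def (g : 𝒢.FullGroup) (x : X) : g • x = 𝒢.rng (g.germ x) := rfl

theorem smul_src {g : 𝒢.FullGroup} {γ : G} (h : γ ∈ g.1) : g • 𝒢.src γ = 𝒢.rng γ := by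
  rw [smul_def, germ_eq h rfl]

theorem continuous_germ (g : 𝒢.FullGroup) : Continuous g.germ := by
  rw [continuous_iff_continuousAt]
  intro x
  refine continuousAt_of_isOpenMap_injOn 𝒢.isLocalHomeomorph_src.isOpenMap g.1.isOpen g.1.injOn_src
    (Eventually.of_forall fun y => g.germ_mem y) ?_
  simp only [src_germ]
  exact continuousAt_id

theorem continuous_smul (g : 𝒢.FullGroup) : Continuous fun x : X => g • x :=
  𝒢.isLocalHomeomorph_rng.continuous.comp g.continuous_germ

theorem coe_eq_range_germ (g : 𝒢.FullGroup) : (g.1 : Set G) = range g.germ := by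
  apply Subset.antisymm
  · intro γ hγ
    exact ⟨_, germ_eq hγ rfl⟩
  · rintro _ ⟨x, rfl⟩
    exact g.germ_mem x

theorem eq_of_subset {g h : 𝒢.FullGroup} (hgh : (g.1 : Set G) ⊆ h.1) : g = h := by
  refine Subtype.ext (Bisection.coe_ext (Subset.antisymm hgh fun γ hγ => ?_))
  rw [← germ_eq hγ rfl, germ_eq (hgh (g.germ_mem _)) (src_germ _ _)]
  exact g.germ_mem _

theorem unit_mem_iff_germ_eq {g : 𝒢.FullGroup} {x : X} :
    𝒢.unit x ∈ g.1 ↔ g.germ x = 𝒢.unit x :=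
  ⟨fun h => germ_eq h (𝒢.src_unit x), fun h => h ▸ g.germ_mem x⟩

theorem smul_eq_of_unit_mem {g : 𝒢.FullGroup} {x : X} (h : 𝒢.unit x ∈ g.1) : g • x = x := by
  rw [smul_def, unit_mem_iff_germ_eq.1 h, 𝒢.rng_unit]

/-- Two elements have the same germ at `x` if and only if `g⁻¹ h` has the trivial germ. -/
theorem germ_eq_germ_iff {g h : 𝒢.FullGroup} {x : X} :
    g.germ x = h.germ x ↔ 𝒢.unit x ∈ (g⁻¹ * h).1 := by
  constructor
  · intro e
    have h1 : 𝒢.inv (h.germ x) ∈ (g⁻¹ : 𝒢.FullGroup).1 := ⟨_, e ▸ g.germ_mem x, rfl⟩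
    have h2 := 𝒢.inv_mul (h.germ x)
    rw [src_germ] at h2
    exact ⟨_, h1, _, h.germ_mem x, 𝒢.src_inv _, h2⟩
  · intro hx
    have : h = g * (g⁻¹ * h) := by group
    have h3 := germ_mul g (g⁻¹ * h) x
    rw [← this] at h3
    rw [h3, 𝒢.mul_unit_of (unit_mem_iff_germ_eq.1 hx), unit_mem_iff_germ_eq.1 hx, 𝒢.rng_unit]

end FullGroup

/-- The restriction of a bisection to arrows with source in the open set `U`. -/
def Bisection.restrictSrc (T : 𝒢.Bisection) {U : Set X} (hU : IsOpen U) : 𝒢.Bisection where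
  carrier := T ∩ 𝒢.src ⁻¹' U
  isOpen := T.isOpen.inter (hU.preimage 𝒢.isLocalHomeomorph_src.continuous)
  injOn_src := T.injOn_src.mono inter_subset_left
  injOn_rng := T.injOn_rng.mono inter_subset_left

/-- In an effective groupoid, a germ is trivial if and only if the element acts trivially near the
given point. -/
theorem FullGroup.unit_mem_iff (heff : 𝒢.IsEffective) {g : 𝒢.FullGroup} {x : X} :
    𝒢.unit x ∈ g.1 ↔ ∀ᶠ z in 𝓝 x, g • z = z := by
  constructor
  · intro h
    have h1 : IsOpen (𝒢.unit ⁻¹' (g.1 : Set G)) := g.1.isOpen.preimage 𝒢.continuous_unit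
    filter_upwards [h1.mem_nhds h] with z hz
    exact smul_eq_of_unit_mem hz
  · intro h
    obtain ⟨U, hU, hUo, hxU⟩ := eventually_nhds_iff.1 h
    have key : g.1.restrictSrc hUo = Bisection.ofOpen U hUo := by
      apply heff
      ext ⟨a, b⟩
      constructor
      · rintro ⟨γ, ⟨hγ, hγU⟩, hab⟩
        obtain ⟨rfl, rfl⟩ := Prod.mk.inj hab
        refine ⟨_, ⟨𝒢.src γ, hγU, rfl⟩, ?_⟩
        have := hU _ hγU
        rw [smul_src hγ] at this
        simp only [𝒢.src_unit, 𝒢.rng_unit, this]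
      · rintro ⟨_, ⟨z, hz, rfl⟩, hab⟩
        refine ⟨g.germ z, ⟨g.germ_mem z, by simpa using hz⟩, ?_⟩
        rw [← hab]
        have := hU z hz
        rw [smul_def] at this
        simp only [src_germ, 𝒢.src_unit, 𝒢.rng_unit, this]
    have hmem : 𝒢.unit x ∈ Bisection.ofOpen (𝒢 := 𝒢) U hUo := ⟨x, hxU, rfl⟩
    rw [← key] at hmem
    exact hmem.1

theorem Bisection.isCompact_inter_preimage_src (T : 𝒢.Bisection) {B : Set X} (hB : IsCompact B)
    (hBT : B ⊆ 𝒢.src '' (T : Set G)) : IsCompact ((T : Set G) ∩ 𝒢.src ⁻¹' B) := by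
  have : CompactSpace B := isCompact_iff_compactSpace.1 hB
  choose s hsT hs using fun x : B => hBT x.2
  have hc : Continuous s := by
    rw [continuous_iff_continuousAt]
    intro x
    refine continuousAt_of_isOpenMap_injOn 𝒢.isLocalHomeomorph_src.isOpenMap T.isOpen T.injOn_src
      (Eventually.of_forall hsT) ?_
    simp only [hs]
    exact continuous_subtype_val.continuousAt
  have : (T : Set G) ∩ 𝒢.src ⁻¹' B = range s := by
    apply Subset.antisymm
    · rintro γ ⟨hγT, hγB⟩
      exact ⟨⟨_, hγB⟩, T.injOn_src (hsT _) hγT (hs _)⟩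
    · rintro _ ⟨x, rfl⟩
      exact ⟨hsT x, by rw [mem_preimage, hs]; exact x.2⟩
  rw [this]
  exact isCompact_range hc

theorem exists_bisection_mem (γ : G) : ∃ T : 𝒢.Bisection, γ ∈ T := by
  obtain ⟨A, hAo, hA, hAi⟩ := 𝒢.isLocalHomeomorph_src.isLocallyInjective γ
  obtain ⟨B, hBo, hB, hBi⟩ := 𝒢.isLocalHomeomorph_rng.isLocallyInjective γ
  exact ⟨⟨A ∩ B, hAo.inter hBo, fun a ha b hb => hAi ha.1 hb.1, fun a ha b hb => hBi ha.2 hb.2⟩,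
    hA, hB⟩

/-! ### Multisections -/

namespace Multisection

variable {d : ℕ}

/-- The set of units of the `i`-th diagonal entry of a multisection. -/
def base (F : 𝒢.Multisection d) (i : Fin d) : Set X := {x | 𝒢.unit x ∈ F.toFun i i}

variable (F : 𝒢.Multisection d)

theorem src_mem_base {i j : Fin d} {γ : G} (h : γ ∈ F.toFun i j) : 𝒢.src γ ∈ F.base j := by
  have h' : γ ∈ F.toFun i j * F.toFun j j := by rw [F.mul_eq]; exact h
  obtain ⟨a, ha, b, hb, hab, rfl⟩ := h'
  obtain ⟨x, rfl⟩ := F.diag_subset j hb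
  rw [𝒢.src_mul, 𝒢.src_unit]
  exact hb

theorem rng_mem_base {i j : Fin d} {γ : G} (h : γ ∈ F.toFun i j) : 𝒢.rng γ ∈ F.base i := by
  have h' : γ ∈ F.toFun i i * F.toFun i j := by rw [F.mul_eq]; exact h
  obtain ⟨a, ha, b, hb, hab, rfl⟩ := h'
  obtain ⟨x, rfl⟩ := F.diag_subset i ha
  rw [𝒢.rng_mul, 𝒢.rng_unit]
  exact ha

theorem exists_mem_src (i : Fin d) {j : Fin d} {x : X} (hx : x ∈ F.base j) :
    ∃ γ ∈ F.toFun i j, 𝒢.src γ = x := by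
  have h' : 𝒢.unit x ∈ F.toFun j i * F.toFun i j := by rw [F.mul_eq]; exact hx
  obtain ⟨a, ha, b, hb, hab, e⟩ := h'
  exact ⟨b, hb, by rw [← 𝒢.src_mul a b hab, e, 𝒢.src_unit]⟩

theorem exists_mem_rng (j : Fin d) {i : Fin d} {x : X} (hx : x ∈ F.base i) :
    ∃ γ ∈ F.toFun i j, 𝒢.rng γ = x := by
  have h' : 𝒢.unit x ∈ F.toFun i j * F.toFun j i := by rw [F.mul_eq]; exact hx
  obtain ⟨a, ha, b, hb, hab, e⟩ := h'
  exact ⟨a, ha, by rw [← 𝒢.rng_mul a b hab, e, 𝒢.rng_unit]⟩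

theorem eq_of_mem_base {i j : Fin d} {x : X} (hi : x ∈ F.base i) (hj : x ∈ F.base j) : i = j := by
  by_contra h
  exact Set.disjoint_left.1 (F.diag_disjoint i j h) hi hj

theorem isClopen_base (i : Fin d) : IsClopen (F.base i) := by
  have := 𝒢.t2
  constructor
  · have e : F.base i = 𝒢.src '' (F.toFun i i : Set G) := by
      apply Subset.antisymm
      · intro x hx
        exact ⟨_, hx, 𝒢.src_unit x⟩
      · rintro _ ⟨γ, hγ, rfl⟩
        exact F.src_mem_base hγ
    rw [e]
    exact ((F.diag_compact i).image 𝒢.isLocalHomeomorph_src.continuous).isClosed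
  · exact (F.toFun i i).isOpen.preimage 𝒢.continuous_unit

theorem mem_permCarrier {σ : Equiv.Perm (Fin d)} {γ : G} : γ ∈ F.permCarrier σ ↔
    (∃ i, γ ∈ F.toFun (σ i) i) ∨ ∃ x, (∀ i, x ∉ F.base i) ∧ γ = 𝒢.unit x := by
  simp only [permCarrier, mem_union, mem_iUnion, Set.mem_sdiff, mem_range, not_exists]
  refine or_congr Iff.rfl ⟨?_, ?_⟩
  · rintro ⟨⟨x, rfl⟩, h⟩
    exact ⟨x, h, rfl⟩
  · rintro ⟨x, h, rfl⟩
    exact ⟨⟨x, rfl⟩, h⟩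

/-- The element `F(σ)` of the full group. -/
def permElement (σ : Equiv.Perm (Fin d)) : 𝒢.FullGroup :=
  ⟨⟨F.permCarrier σ, by
    have e : F.permCarrier σ = (⋃ i, (F.toFun (σ i) i : Set G)) ∪
        𝒢.unit '' (⋂ i, (F.base i)ᶜ) := by
      ext γ
      rw [mem_permCarrier]
      simp [eq_comm]
    rw [e]
    exact (isOpen_iUnion fun i => (F.toFun (σ i) i).isOpen).union (Bisection.isOpen_unit_image
      (isOpen_iInter_of_finite fun i => (F.isClopen_base i).compl.isOpen)), by
    intro γ hγ δ hδ h
    rw [mem_permCarrier] at hγ hδ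
    rcases hγ with ⟨i, hi⟩ | ⟨x, hx, rfl⟩ <;> rcases hδ with ⟨j, hj⟩ | ⟨y, hy, rfl⟩
    · obtain rfl := F.eq_of_mem_base (F.src_mem_base hi) (h ▸ F.src_mem_base hj)
      exact (F.toFun _ _).injOn_src hi hj h
    · rw [𝒢.src_unit] at h
      exact absurd (h ▸ F.src_mem_base hi) (hy i)
    · rw [𝒢.src_unit] at h
      exact absurd (h ▸ F.src_mem_base hj) (hx j)
    · rw [𝒢.src_unit, 𝒢.src_unit] at h
      rw [h], by
    intro γ hγ δ hδ h
    rw [mem_permCarrier] at hγ hδ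
    rcases hγ with ⟨i, hi⟩ | ⟨x, hx, rfl⟩ <;> rcases hδ with ⟨j, hj⟩ | ⟨y, hy, rfl⟩
    · obtain rfl := σ.injective (F.eq_of_mem_base (F.rng_mem_base hi) (h ▸ F.rng_mem_base hj))
      exact (F.toFun _ _).injOn_rng hi hj h
    · rw [𝒢.rng_unit] at h
      exact absurd (h ▸ F.rng_mem_base hi) (hy _)
    · rw [𝒢.rng_unit] at h
      exact absurd (h ▸ F.rng_mem_base hj) (hx _)
    · rw [𝒢.rng_unit, 𝒢.rng_unit] at h
      rw [h]⟩, by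
    refine eq_univ_of_forall fun x => ?_
    by_cases h : ∃ i, x ∈ F.base i
    · obtain ⟨i, hi⟩ := h
      obtain ⟨γ, hγ, hx⟩ := F.exists_mem_src (σ i) hi
      exact ⟨γ, F.mem_permCarrier.2 (Or.inl ⟨i, hγ⟩), hx⟩
    · push Not at h
      exact ⟨𝒢.unit x, F.mem_permCarrier.2 (Or.inr ⟨x, h, rfl⟩), 𝒢.src_unit x⟩, by
    refine eq_univ_of_forall fun x => ?_
    by_cases h : ∃ i, x ∈ F.base i
    · obtain ⟨i, hi⟩ := h
      obtain ⟨γ, hγ, hx⟩ := F.exists_mem_rng (σ.symm i) hi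
      exact ⟨γ, F.mem_permCarrier.2 (Or.inl ⟨σ.symm i, by rwa [σ.apply_symm_apply]⟩), hx⟩
    · push Not at h
      exact ⟨𝒢.unit x, F.mem_permCarrier.2 (Or.inr ⟨x, h, rfl⟩), 𝒢.rng_unit x⟩⟩

theorem mem_permElement {σ : Equiv.Perm (Fin d)} {γ : G} : γ ∈ (F.permElement σ).1 ↔
    (∃ i, γ ∈ F.toFun (σ i) i) ∨ ∃ x, (∀ i, x ∉ F.base i) ∧ γ = 𝒢.unit x :=
  F.mem_permCarrier

theorem permElement_mul (σ τ : Equiv.Perm (Fin d)) :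
    F.permElement (σ * τ) = F.permElement σ * F.permElement τ := by
  refine (FullGroup.eq_of_subset ?_).symm
  rintro _ ⟨γ, hγ, δ, hδ, h, rfl⟩
  refine F.mem_permElement.2 ?_
  rcases F.mem_permElement.1 hγ with ⟨i, hi⟩ | ⟨x, hx, rfl⟩ <;>
    rcases F.mem_permElement.1 hδ with ⟨j, hj⟩ | ⟨y, hy, rfl⟩
  · obtain rfl := F.eq_of_mem_base (F.src_mem_base hi) (h ▸ F.rng_mem_base hj)
    refine Or.inl ⟨j, ?_⟩
    rw [Equiv.Perm.mul_apply, ← F.mul_eq _ (τ j)]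
    exact ⟨γ, hi, δ, hj, h, rfl⟩
  · rw [𝒢.rng_unit] at h
    exact absurd (h ▸ F.src_mem_base hi) (hy i)
  · rw [𝒢.src_unit] at h
    exact absurd (h ▸ F.rng_mem_base hj) (hx _)
  · refine Or.inr ⟨x, hx, ?_⟩
    rw [𝒢.mul_unit_of rfl]

/-- The homomorphism `σ ↦ F(σ)`. -/
def permHom : Equiv.Perm (Fin d) →* 𝒢.FullGroup :=
  MonoidHom.mk' F.permElement F.permElement_mul

theorem permElement_smul_mem {σ : Equiv.Perm (Fin d)} {i : Fin d} {x : X} (hx : x ∈ F.base i) :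
    F.permElement σ • x ∈ F.base (σ i) := by
  obtain ⟨γ, hγ, rfl⟩ := F.exists_mem_src (σ i) hx
  rw [FullGroup.smul_src (F.mem_permElement.2 (Or.inl ⟨i, hγ⟩))]
  exact F.rng_mem_base hγ

theorem permElement_smul_of_fixed {σ : Equiv.Perm (Fin d)} {i : Fin d} (hi : σ i = i) {x : X}
    (hx : x ∈ F.base i) : F.permElement σ • x = x :=
  FullGroup.smul_eq_of_unit_mem (F.mem_permElement.2 (Or.inl ⟨i, by rw [hi]; exact hx⟩))

theorem permElement_smul_of_notMem {σ : Equiv.Perm (Fin d)} {x : X}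
    (hx : ∀ i, x ∉ F.base i) : F.permElement σ • x = x :=
  FullGroup.smul_eq_of_unit_mem (F.mem_permElement.2 (Or.inr ⟨x, hx, rfl⟩))

theorem isThreeCycle_permElement {τ : Equiv.Perm (Fin d)} (hτ : τ.IsThreeCycle) {i : Fin d}
    (hi : τ i ≠ i) : IsThreeCycle (F.permElement τ) (F.base i) := by
  have h3 : ∀ j, τ (τ (τ j)) = j := by
    intro j
    have : τ ^ 3 = 1 := by rw [← hτ.orderOf]; exact pow_orderOf_eq_one τ
    have := congrArg (fun σ : Equiv.Perm (Fin d) => σ j) this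
    simpa [pow_succ] using this
  have h2 : τ (τ i) ≠ i := by
    intro h
    have := h3 i
    rw [h] at this
    exact hi this
  refine ⟨F.isClopen_base i, fun x hx h => ?_, fun x hx h => ?_, fun x hx => ?_,
    fun x h0 h1 h2 => ?_⟩
  · exact hi (F.eq_of_mem_base (F.permElement_smul_mem hx) h)
  · exact h2 (F.eq_of_mem_base (F.permElement_smul_mem (F.permElement_smul_mem hx)) h)
  · rw [← mul_smul, ← mul_smul, ← permElement_mul, ← permElement_mul]
    refine F.permElement_smul_of_fixed (i := i) ?_ hx
    simp [h3]
  · by_cases h : ∃ j, x ∈ F.base j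
    · obtain ⟨j, hj⟩ := h
      refine F.permElement_smul_of_fixed (i := j) ?_ hj
      by_contra hne
      have hj1 := F.permElement_smul_mem (σ := τ) hj
      have hj2 := F.permElement_smul_mem (σ := τ) hj1
      have m0 : j ≠ i := fun e => h0 (e ▸ hj)
      have m1 : τ j ≠ i := fun e => h1 (e ▸ hj1)
      have m2 : τ (τ j) ≠ i := fun e => h2 (e ▸ hj2)
      obtain ⟨n, hn⟩ := (hτ.isCycle.sameCycle hi hne).exists_pow_eq'
      rw [hτ.orderOf] at hn
      obtain ⟨hn3, hn⟩ := hn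
      interval_cases n
      · exact m0 (by simpa using hn.symm)
      · apply m2
        rw [← hn, pow_one, h3]
      · apply m1
        rw [← hn, pow_two, Equiv.Perm.mul_apply, h3]
    · push Not at h
      exact F.permElement_smul_of_notMem h

/-- The multisection with entries `Eᵢ Eⱼ⁻¹`, for bisections `Eᵢ` with a common source and disjoint
compact ranges. -/
def ofFamily (E : Fin d → 𝒢.Bisection) {B : Set X} (hsrc : ∀ i, 𝒢.src '' (E i : Set G) = B)
    (hcomp : ∀ i, IsCompact (𝒢.rng '' (E i : Set G)))
    (hdisj : ∀ i j, i ≠ j → Disjoint (𝒢.rng '' (E i : Set G)) (𝒢.rng '' (E j : Set G))) :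
    𝒢.Multisection d where
  toFun i j := E i * (E j)⁻¹
  diag_subset i := by
    have : ((E i * (E i)⁻¹ : 𝒢.Bisection) : Set G) = _ := 𝒢.setMul_setInv (E i).injOn_src
    rw [this]
    exact image_subset_range _ _
  diag_compact i := by
    have : ((E i * (E i)⁻¹ : 𝒢.Bisection) : Set G) = _ := 𝒢.setMul_setInv (E i).injOn_src
    rw [this]
    exact (hcomp i).image 𝒢.continuous_unit
  diag_disjoint i j hij := by
    have e : ∀ i, ((E i * (E i)⁻¹ : 𝒢.Bisection) : Set G) = _ := fun i =>
      𝒢.setMul_setInv (E i).injOn_src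
    rw [e i, e j]
    refine Set.disjoint_image_of_injective (fun a b h => ?_) (hdisj i j hij)
    rw [← 𝒢.src_unit a, h, 𝒢.src_unit]
  mul_eq i j l := by
    have h1 : (((E j)⁻¹ * E j : 𝒢.Bisection) : Set G) = 𝒢.unit '' B := by
      rw [← hsrc j]
      exact 𝒢.setInv_setMul (E j).injOn_rng
    have h2 : E i * ((E j)⁻¹ * E j) = E i := Bisection.coe_ext (by
      rw [Bisection.coe_mul, h1]
      exact 𝒢.setMul_unit (hsrc i).subset)
    rw [_root_.mul_assoc, ← _root_.mul_assoc (E j)⁻¹, ← _root_.mul_assoc (E i), h2]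

theorem ofFamily_mem {E : Fin d → 𝒢.Bisection} {B : Set X}
    (hsrc : ∀ i, 𝒢.src '' (E i : Set G) = B) (hcomp : ∀ i, IsCompact (𝒢.rng '' (E i : Set G)))
    (hdisj : ∀ i j, i ≠ j → Disjoint (𝒢.rng '' (E i : Set G)) (𝒢.rng '' (E j : Set G)))
    {i j : Fin d} {γ δ : G} (hγ : γ ∈ E i) (hδ : δ ∈ E j) (h : 𝒢.src γ = 𝒢.rng (𝒢.inv δ)) :
    𝒢.mul γ (𝒢.inv δ) h ∈ (ofFamily E hsrc hcomp hdisj).toFun i j :=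
  ⟨γ, hγ, _, ⟨δ, hδ, rfl⟩, h, rfl⟩

theorem ofFamily_base {E : Fin d → 𝒢.Bisection} {B : Set X}
    (hsrc : ∀ i, 𝒢.src '' (E i : Set G) = B) (hcomp : ∀ i, IsCompact (𝒢.rng '' (E i : Set G)))
    (hdisj : ∀ i j, i ≠ j → Disjoint (𝒢.rng '' (E i : Set G)) (𝒢.rng '' (E j : Set G)))
    (i : Fin d) : (ofFamily E hsrc hcomp hdisj).base i = 𝒢.rng '' (E i : Set G) := by
  have e : ((E i * (E i)⁻¹ : 𝒢.Bisection) : Set G) = _ := 𝒢.setMul_setInv (E i).injOn_src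
  ext x
  change 𝒢.unit x ∈ ((E i * (E i)⁻¹ : 𝒢.Bisection) : Set G) ↔ _
  rw [e]
  constructor
  · rintro ⟨y, hy, h⟩
    rw [← 𝒢.src_unit x, ← h, 𝒢.src_unit]
    exact hy
  · intro h
    exact ⟨x, h, rfl⟩

end Multisection

end EtaleGroupoid

/-! ### Interpolation of germs -/

section Interpolation

variable {A X : Type*} [Group A] [TopologicalSpace X] [MulAction A X] [IsAlternatingAction A X]
  [CompactSpace X] [T2Space X] [TotallyDisconnectedSpace X] [Infinite X]

/-- Germs of group elements at finitely many points, with distinct values, are the germs of a single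
group element. -/
theorem exists_forall_eventually_smul_eq {s : Set X} (hs : s.Finite) {f : X → A}
    (hf : InjOn (fun x => f x • x) s) : ∃ g : A, ∀ x ∈ s, ∀ᶠ z in 𝓝 x, g • z = f x • z := by
  induction s, hs using Set.Finite.induction_on with
  | empty => exact ⟨1, by simp⟩
  | @insert p s hps hs ih =>
    obtain ⟨g, hg⟩ := ih (hf.mono (subset_insert _ _))
    have hF : ((fun x => f x • x) '' s).Finite := hs.image _
    have h1 : g • p ∉ (fun x => f x • x) '' s := by
      rintro ⟨x, hx, e⟩
      have e : f x • x = g • p := e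
      rw [← (hg x hx).self_of_nhds] at e
      exact hps (smul_left_cancel g e ▸ hx)
    have h2 : f p • p ∉ (fun x => f x • x) '' s := by
      rintro ⟨x, hx, e⟩
      exact hps (hf (mem_insert_of_mem _ hx) (mem_insert _ _) e ▸ hx)
    obtain ⟨V₁, hV₁, hpV₁, hd₁⟩ := compact_exists_isClopen_in_isOpen hF.isClosed.isOpen_compl h1
    obtain ⟨V₂, hV₂, hpV₂, hd₂⟩ := compact_exists_isClopen_in_isOpen hF.isClosed.isOpen_compl h2
    have hV := hV₁.union hV₂
    obtain ⟨e, heV, he⟩ := exists_mem_altRist_eventuallyEq (A := A) hV.isOpen (f := f p * g⁻¹)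
      (x := g • p) (Or.inl hpV₁) (by rw [mul_smul, inv_smul_smul]; exact Or.inr hpV₂)
    refine ⟨e * g, fun x hx => ?_⟩
    rcases hx with rfl | hx
    · have := (continuous_const_smul g).continuousAt.eventually he
      filter_upwards [this] with z hz
      rw [mul_smul, hz, mul_smul, inv_smul_smul]
    · have hfx : f x • x ∈ (V₁ ∪ V₂)ᶜ := by
        rintro (h | h)
        · exact hd₁ h ⟨x, hx, rfl⟩
        · exact hd₂ h ⟨x, hx, rfl⟩
      rw [← (hg x hx).self_of_nhds] at hfx
      have := (continuous_const_smul g).continuousAt.eventually (hV.compl.isOpen.mem_nhds hfx)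
      filter_upwards [this, hg x hx] with z h3 h4
      rw [mul_smul, smul_eq_of_mem_altRist heV _ h3, h4]

end Interpolation

namespace EtaleGroupoid

variable {G X : Type*} [TopologicalSpace G] [TopologicalSpace X] {𝒢 : EtaleGroupoid G X}

/-! ### Alternating full groups act alternatingly -/

theorem Multisection.permElement_mem {d : ℕ} (hd : 3 ≤ d) (F : 𝒢.Multisection d)
    {σ : Equiv.Perm (Fin d)} (hσ : σ ∈ alternatingGroup (Fin d)) :
    F.permElement σ ∈ 𝒢.alternatingFullGroup :=
  Subgroup.subset_closure ⟨d, hd, F, σ, hσ, rfl⟩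

theorem isThreeCycle_finRotate : (finRotate 3).IsThreeCycle := by
  rw [← card_support_eq_three_iff]
  decide

theorem src_image_restrictSrc (T : 𝒢.Bisection) {B : Set X} (hB : IsOpen B)
    (hBT : B ⊆ 𝒢.src '' (T : Set G)) : 𝒢.src '' (T.restrictSrc hB : Set G) = B := by
  apply Subset.antisymm
  · rintro _ ⟨γ, hγ, rfl⟩
    exact hγ.2
  · intro x hx
    obtain ⟨γ, hγ, rfl⟩ := hBT hx
    exact ⟨γ, ⟨hγ, hx⟩, rfl⟩

/-- Three bisections with disjoint ranges over a clopen set give a three-cycle. -/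
theorem exists_isThreeCycle_of_bisections [CompactSpace X] (E : Fin 3 → 𝒢.Bisection) {B : Set X}
    (hB : IsClopen B) (hBE : ∀ i, B ⊆ 𝒢.src '' (E i : Set G))
    (hdisj : ∀ i j, i ≠ j → ∀ γ ∈ E i, ∀ δ ∈ E j, 𝒢.src γ ∈ B → 𝒢.src δ ∈ B → 𝒢.rng γ ≠ 𝒢.rng δ) :
    ∃ c : 𝒢.alternatingFullGroup, IsThreeCycle c (𝒢.rng '' ((E 0 : Set G) ∩ 𝒢.src ⁻¹' B)) ∧
      ∀ i, ∀ γ ∈ E (i + 1), ∀ δ ∈ E i, 𝒢.src γ ∈ B → ∀ h : 𝒢.src γ = 𝒢.rng (𝒢.inv δ),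
        𝒢.mul γ (𝒢.inv δ) h ∈ c.1.1 := by
  let E' : Fin 3 → 𝒢.Bisection := fun i => (E i).restrictSrc hB.isOpen
  have hsrc : ∀ i, 𝒢.src '' (E' i : Set G) = B := fun i =>
    src_image_restrictSrc (E i) hB.isOpen (hBE i)
  have hcomp : ∀ i, IsCompact (𝒢.rng '' (E' i : Set G)) := fun i =>
    ((E i).isCompact_inter_preimage_src hB.isClosed.isCompact (hBE i)).image
      𝒢.isLocalHomeomorph_rng.continuous
  have hd : ∀ i j, i ≠ j → Disjoint (𝒢.rng '' (E' i : Set G)) (𝒢.rng '' (E' j : Set G)) := by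
    intro i j hij
    rw [Set.disjoint_left]
    rintro _ ⟨γ, hγ, rfl⟩ ⟨δ, hδ, e⟩
    exact hdisj i j hij γ hγ.1 δ hδ.1 hγ.2 hδ.2 e.symm
  let F := Multisection.ofFamily E' hsrc hcomp hd
  have hmem : F.permElement (finRotate 3) ∈ 𝒢.alternatingFullGroup :=
    F.permElement_mem le_rfl isThreeCycle_finRotate.mem_alternatingGroup
  have hc := F.isThreeCycle_permElement isThreeCycle_finRotate (i := 0) (by decide)
  rw [Multisection.ofFamily_base] at hc
  refine ⟨⟨_, hmem⟩, ⟨hc.1, hc.2, hc.3, hc.4, hc.5⟩, fun i γ hγ δ hδ hγB h => ?_⟩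
  refine F.mem_permElement.2 (Or.inl ⟨i, ?_⟩)
  rw [finRotate_apply]
  refine Multisection.ofFamily_mem hsrc hcomp hd (i := i + 1) (j := i) ⟨hγ, hγB⟩ ⟨hδ, ?_⟩ h
  rw [𝒢.rng_inv] at h
  rw [mem_preimage, ← h]
  exact hγB

section Cantor

variable [CompactSpace X] [T2Space X] [TotallyDisconnectedSpace X] [Infinite X]

/-- The first of two arrows with a common source, such that the source and the two ranges are
distinct, lies in an element of the alternating full group, namely in a three-cycle. -/
theorem exists_mem_of_three {γ₁ γ₂ : G} (hs : 𝒢.src γ₁ = 𝒢.src γ₂) (h₁ : 𝒢.rng γ₁ ≠ 𝒢.src γ₁)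
    (h₂ : 𝒢.rng γ₂ ≠ 𝒢.src γ₁) (h₁₂ : 𝒢.rng γ₁ ≠ 𝒢.rng γ₂) :
    ∃ g : 𝒢.alternatingFullGroup, γ₁ ∈ g.1.1 := by
  obtain ⟨T₁, hT₁⟩ := exists_bisection_mem (𝒢 := 𝒢) γ₁
  obtain ⟨T₂, hT₂⟩ := exists_bisection_mem (𝒢 := 𝒢) γ₂
  let γ : Fin 3 → G := ![𝒢.unit (𝒢.src γ₁), γ₁, γ₂]
  let E : Fin 3 → 𝒢.Bisection := ![1, T₁, T₂]
  have hγE : ∀ i, γ i ∈ E i := by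
    intro i
    fin_cases i
    · exact ⟨𝒢.src γ₁, trivial, rfl⟩
    · exact hT₁
    · exact hT₂
  have hγs : ∀ i, 𝒢.src (γ i) = 𝒢.src γ₁ := by
    intro i
    fin_cases i
    · exact 𝒢.src_unit _
    · rfl
    · exact hs.symm
  have hinj : Function.Injective fun i => 𝒢.rng (γ i) := by
    have e0 : 𝒢.rng (γ 0) = 𝒢.src γ₁ := 𝒢.rng_unit _
    have e1 : 𝒢.rng (γ 1) = 𝒢.rng γ₁ := rfl
    have e2 : 𝒢.rng (γ 2) = 𝒢.rng γ₂ := rfl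
    intro i j hij
    simp only at hij
    fin_cases i <;> fin_cases j <;>
      simp only [Fin.zero_eta, Fin.mk_one, Fin.reduceFinMk, e0, e1, e2] at hij ⊢ <;>
      simp_all
  obtain ⟨N, hN, hγN, -, hNd⟩ := exists_disjoint_isClopen hinj (O := fun _ => univ)
    (fun _ => isOpen_univ) fun _ => mem_univ _
  have hO : ∀ i, IsOpen (𝒢.src '' ((E i : Set G) ∩ 𝒢.rng ⁻¹' N i)) := fun i =>
    𝒢.isLocalHomeomorph_src.isOpenMap _ ((E i).isOpen.inter
      ((hN i).isOpen.preimage 𝒢.isLocalHomeomorph_rng.continuous))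
  obtain ⟨B, hB, hxB, hBO⟩ := compact_exists_isClopen_in_isOpen (x := 𝒢.src γ₁)
    (isOpen_iInter_of_finite hO) (mem_iInter.2 fun i => ⟨γ i, ⟨hγE i, hγN i⟩, hγs i⟩)
  have hBE : ∀ i, B ⊆ 𝒢.src '' ((E i : Set G) ∩ 𝒢.rng ⁻¹' N i) := fun i =>
    hBO.trans (iInter_subset _ i)
  have hrng : ∀ i, ∀ δ ∈ E i, 𝒢.src δ ∈ B → 𝒢.rng δ ∈ N i := by
    intro i δ hδ hδB
    obtain ⟨δ', ⟨h1, h2⟩, h3⟩ := hBE i hδB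
    rw [← (E i).injOn_src h1 hδ h3]
    exact h2
  obtain ⟨c, -, hc⟩ := exists_isThreeCycle_of_bisections E hB
    (fun i => (hBE i).trans (image_mono inter_subset_left)) fun i j hij δ hδ δ' hδ' hδB hδB' e =>
      Set.disjoint_left.1 (hNd hij) (hrng i δ hδ hδB) (e ▸ hrng j δ' hδ' hδB')
  have hmul : 𝒢.src γ₁ = 𝒢.rng (𝒢.inv (γ 0)) := by rw [𝒢.rng_inv, hγs]
  have := hc 0 γ₁ (hγE 1) (γ 0) (hγE 0) hxB hmul
  rw [𝒢.mul_unit_of (show 𝒢.inv (γ 0) = 𝒢.unit (𝒢.src γ₁) from inv_unit _)] at this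
  exact ⟨c, this⟩

theorem exists_rng_notMem (hmin : 𝒢.IsMinimal) (x : X) {F : Set X} (hF : F.Finite) :
    ∃ γ, 𝒢.src γ = x ∧ 𝒢.rng γ ∉ F := by
  by_contra! hcon
  have h1 : {y | ∃ γ, 𝒢.src γ = x ∧ 𝒢.rng γ = y} ⊆ F := by
    rintro _ ⟨γ, hγ, rfl⟩
    exact hcon γ hγ
  have h2 := hF.isClosed.closure_subset_iff.2 h1
  rw [(hmin x).closure_eq] at h2
  exact infinite_univ (hF.subset h2)

/-- In a minimal groupoid the bisections in the alternating full group cover all arrows. -/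
theorem exists_alternatingFullGroup_mem (hmin : 𝒢.IsMinimal) (γ : G) :
    ∃ g : 𝒢.alternatingFullGroup, γ ∈ g.1.1 := by
  have key : ∀ γ : G, 𝒢.rng γ ≠ 𝒢.src γ → ∃ g : 𝒢.alternatingFullGroup, γ ∈ g.1.1 := by
    intro γ hγ
    obtain ⟨δ, hδ, hδF⟩ := exists_rng_notMem hmin (𝒢.src γ) (toFinite {𝒢.src γ, 𝒢.rng γ})
    simp only [mem_insert_iff, mem_singleton_iff, not_or] at hδF
    exact exists_mem_of_three hδ.symm hγ hδF.1 (Ne.symm hδF.2)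
  by_cases hγ : 𝒢.rng γ = 𝒢.src γ
  · -- Factor `γ` through another point of the orbit.
    obtain ⟨δ, hδ, hδF⟩ := exists_rng_notMem hmin (𝒢.src γ) (finite_singleton (𝒢.src γ))
    have h : 𝒢.src γ = 𝒢.rng (𝒢.inv δ) := by rw [𝒢.rng_inv, hδ]
    obtain ⟨g, hg⟩ := key δ (by rw [hδ]; exact hδF)
    obtain ⟨g', hg'⟩ := key (𝒢.mul γ (𝒢.inv δ) h) (by
      rw [𝒢.rng_mul, 𝒢.src_mul, 𝒢.src_inv, hγ]; exact Ne.symm hδF)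
    have hs : 𝒢.src (𝒢.mul γ (𝒢.inv δ) h) = 𝒢.rng δ := by rw [𝒢.src_mul, 𝒢.src_inv]
    refine ⟨g' * g, _, hg', _, hg, hs, ?_⟩
    rw [𝒢.mul_assoc _ _ _ h (𝒢.src_inv δ), 𝒢.mul_unit_of (𝒢.inv_mul δ)]
  · exact key γ hγ

theorem smul_coe (g : 𝒢.alternatingFullGroup) (x : X) : g • x = g.1 • x := rfl

theorem exists_isThreeCycle_alternatingFullGroup (f h : 𝒢.alternatingFullGroup) {B : Set X}
    (hB : IsClopen B) (hf : ∀ x ∈ B, f • x ∉ B) (hh : ∀ x ∈ B, h • x ∉ B)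
    (hfh : ∀ x ∈ B, ∀ y ∈ B, f • x ≠ h • y) :
    ∃ c : 𝒢.alternatingFullGroup, IsThreeCycle c B ∧
      ∀ x ∈ B, c • x = f • x ∧ c • c • x = h • x := by
  let k : Fin 3 → 𝒢.FullGroup := ![1, f.1, h.1]
  have hrng : ∀ i, ∀ γ ∈ (k i).1, 𝒢.rng γ = k i • 𝒢.src γ := fun i γ hγ =>
    (FullGroup.smul_src hγ).symm
  have hk : ∀ i j, i ≠ j → ∀ x ∈ B, ∀ y ∈ B, k i • x ≠ k j • y := by
    have h1 : ∀ x ∈ B, ∀ y ∈ B, (1 : 𝒢.FullGroup) • x ≠ f.1 • y := fun x hx y hy e =>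
      hf y hy (by rw [smul_coe, ← e, one_smul]; exact hx)
    have h2 : ∀ x ∈ B, ∀ y ∈ B, (1 : 𝒢.FullGroup) • x ≠ h.1 • y := fun x hx y hy e =>
      hh y hy (by rw [smul_coe, ← e, one_smul]; exact hx)
    intro i j hij x hx y hy
    fin_cases i <;> fin_cases j
    · exact absurd rfl hij
    · exact h1 x hx y hy
    · exact h2 x hx y hy
    · exact (h1 y hy x hx).symm
    · exact absurd rfl hij
    · exact hfh x hx y hy
    · exact (h2 y hy x hx).symm
    · exact (hfh y hy x hx).symm
    · exact absurd rfl hij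
  obtain ⟨c, hc, hcm⟩ := exists_isThreeCycle_of_bisections (fun i => (k i).1) hB
    (fun i => by rw [(k i).2.1]; exact subset_univ _) (fun i j hij γ hγ δ hδ hγB hδB => by
      rw [hrng i γ hγ, hrng j δ hδ]
      exact hk i j hij _ hγB _ hδB)
  have hstep : ∀ i, ∀ x ∈ B, c • (k i • x) = k (i + 1) • x := by
    intro i x hx
    have h1 : 𝒢.src ((k (i + 1)).germ x) = 𝒢.rng (𝒢.inv ((k i).germ x)) := by
      rw [𝒢.rng_inv, FullGroup.src_germ, FullGroup.src_germ]
    have h2 := FullGroup.smul_src (hcm i _ ((k (i + 1)).germ_mem x) _ ((k i).germ_mem x)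
      (by rw [FullGroup.src_germ]; exact hx) h1)
    rw [𝒢.src_mul, 𝒢.src_inv, 𝒢.rng_mul] at h2
    exact h2
  have hbase : 𝒢.rng '' (((k 0).1 : Set G) ∩ 𝒢.src ⁻¹' B) = B := by
    apply Subset.antisymm
    · rintro _ ⟨γ, ⟨hγ, hγB⟩, rfl⟩
      rw [hrng 0 γ hγ]
      change (1 : 𝒢.FullGroup) • _ ∈ B
      rw [one_smul]
      exact hγB
    · intro x hx
      exact ⟨𝒢.unit x, ⟨⟨x, trivial, rfl⟩, by rw [mem_preimage, 𝒢.src_unit]; exact hx⟩,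
        𝒢.rng_unit x⟩
  rw [hbase] at hc
  refine ⟨c, hc, fun x hx => ?_⟩
  have e1 : c • x = f • x := by
    have := hstep 0 x hx
    rwa [show k 0 = 1 from rfl, one_smul] at this
  exact ⟨e1, by rw [e1]; exact hstep 1 x hx⟩

theorem closure_isThreeCycle_alternatingFullGroup :
    Subgroup.closure {c : 𝒢.alternatingFullGroup | ∃ B : Set X, IsThreeCycle c B} = ⊤ := by
  rw [eq_top_iff]
  refine (Subgroup.closure_closure_coe_preimage (k := {g : 𝒢.FullGroup | ∃ d : ℕ, 3 ≤ d ∧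
    ∃ F : 𝒢.Multisection d, ∃ σ ∈ alternatingGroup (Fin d),
      (g.1 : Set G) = F.permCarrier σ})).ge.trans ((Subgroup.closure_le _).2 ?_)
  rintro g ⟨d, hd, F, σ, hσ, hg⟩
  have key : ∀ σ ∈ alternatingGroup (Fin d), ∃ c ∈ Subgroup.closure
      {c : 𝒢.alternatingFullGroup | ∃ B : Set X, IsThreeCycle c B}, c.1 = F.permHom σ := by
    intro σ hσ
    rw [← Equiv.Perm.closure_three_cycles_eq_alternating] at hσ
    induction hσ using Subgroup.closure_induction with
    | mem τ hτ =>
      obtain ⟨i, hi⟩ : ∃ i, τ i ≠ i := by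
        by_contra! hcon
        exact (Equiv.Perm.IsThreeCycle.isCycle hτ).ne_one (Equiv.ext hcon)
      have hc := F.isThreeCycle_permElement hτ hi
      exact ⟨⟨_, F.permElement_mem hd (Equiv.Perm.IsThreeCycle.mem_alternatingGroup hτ)⟩,
        Subgroup.subset_closure ⟨_, hc.1, hc.2, hc.3, hc.4, hc.5⟩, rfl⟩
    | one => exact ⟨1, one_mem _, by simp⟩
    | mul τ τ' _ _ h h' =>
      obtain ⟨c, hc, e⟩ := h
      obtain ⟨c', hc', e'⟩ := h'
      exact ⟨c * c', mul_mem hc hc', by simp [e, e']⟩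
    | inv τ _ h =>
      obtain ⟨c, hc, e⟩ := h
      exact ⟨c⁻¹, inv_mem hc, by simp [e]⟩
  obtain ⟨c, hc, e⟩ := key σ hσ
  have : g = c := by
    apply Subtype.ext
    rw [e]
    exact Subtype.ext (Bisection.coe_ext hg)
  rw [this]
  exact hc

theorem exists_finite_alternatingFullGroup (hgen : 𝒢.IsCompactlyGenerated) (hmin : 𝒢.IsMinimal) :
    ∃ S : Set 𝒢.alternatingFullGroup, S.Finite ∧
      ∀ (x : X) (a : 𝒢.alternatingFullGroup), ∃ s ∈ Subgroup.closure S, s • x = a • x := by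
  obtain ⟨K, hK, hgenK⟩ := hgen
  obtain ⟨t, ht⟩ := hK.elim_finite_subcover (fun g : 𝒢.alternatingFullGroup => (g.1.1 : Set G))
    (fun g => g.1.1.isOpen) fun γ _ => mem_iUnion.2 (exists_alternatingFullGroup_mem hmin γ)
  have hKt : ∀ γ ∈ K, ∃ g ∈ t, γ ∈ g.1.1 := fun γ hγ => by simpa using ht hγ
  have key : ∀ γ, 𝒢.Generated K γ →
      ∃ s ∈ Subgroup.closure (t : Set 𝒢.alternatingFullGroup), γ ∈ s.1.1 := by
    intro γ hγ
    induction hγ with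
    | of_mem γ hγ =>
      obtain ⟨g, hg, h⟩ := hKt γ hγ
      exact ⟨g, Subgroup.subset_closure hg, h⟩
    | of_inv_mem γ hγ =>
      obtain ⟨g, hg, h⟩ := hKt γ hγ
      exact ⟨g⁻¹, inv_mem (Subgroup.subset_closure hg), ⟨γ, h, rfl⟩⟩
    | mul γ δ h _ _ ih ih' =>
      obtain ⟨g, hg, hγ⟩ := ih
      obtain ⟨g', hg', hδ⟩ := ih'
      exact ⟨g * g', mul_mem hg hg', γ, hγ, δ, hδ, h, rfl⟩
  refine ⟨t, t.finite_toSet, fun x a => ?_⟩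
  obtain ⟨s, hs, h⟩ := key _ (hgenK (a.1.germ x))
  refine ⟨s, hs, ?_⟩
  have h1 := FullGroup.smul_src h
  rw [FullGroup.src_germ] at h1
  exact h1

/-- The alternating full group of a compactly generated, effective, minimal groupoid over a Cantor
space acts alternatingly. -/
theorem isAlternatingAction (hgen : 𝒢.IsCompactlyGenerated) (heff : 𝒢.IsEffective)
    (hmin : 𝒢.IsMinimal) : IsAlternatingAction 𝒢.alternatingFullGroup X where
  continuous_const_smul g := FullGroup.continuous_smul g.1
  eq_of_smul_eq_smul {g h} hgh := by
    refine Subtype.ext (FullGroup.eq_of_subset ?_)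
    rw [FullGroup.coe_eq_range_germ]
    rintro _ ⟨x, rfl⟩
    rw [FullGroup.germ_eq_germ_iff.2 ((FullGroup.unit_mem_iff heff).2
      (Eventually.of_forall fun z => ?_))]
    · exact h.1.germ_mem x
    · rw [mul_smul, inv_smul_eq_iff]
      exact (hgh z).symm
  exists_isThreeCycle f h _ hB hf hh hfh :=
    exists_isThreeCycle_alternatingFullGroup f h hB hf hh hfh
  closure_isThreeCycle := closure_isThreeCycle_alternatingFullGroup
  dense_orbit x := by
    refine (hmin x).mono ?_
    rintro _ ⟨γ, rfl, rfl⟩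
    obtain ⟨g, hg⟩ := exists_alternatingFullGroup_mem hmin γ
    exact ⟨g, FullGroup.smul_src hg⟩
  exists_finite := exists_finite_alternatingFullGroup hgen hmin

/-- Every arrow of a symmetric power is contained in an element of the alternating full group. -/
theorem SymPowArrow.exists_alternatingFullGroup_subset
    [IsAlternatingAction 𝒢.alternatingFullGroup X]
    (heff : 𝒢.IsEffective) (hmin : 𝒢.IsMinimal) {r : ℕ} (Q : 𝒢.SymPowArrow r) :
    ∃ g : 𝒢.alternatingFullGroup, Q.1 ⊆ g.1.1 := by
  choose k hk using exists_alternatingFullGroup_mem (𝒢 := 𝒢) hmin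
  have hfin : Q.1.Finite := by
    obtain ⟨γ, hγ⟩ := Q.2.1
    rw [← hγ]
    exact finite_range γ
  have : Nonempty G := ⟨𝒢.unit (Classical.arbitrary X)⟩
  choose! σ hσQ hσ using fun x (hx : x ∈ 𝒢.src '' Q.1) => hx
  have hkσ : ∀ x ∈ 𝒢.src '' Q.1, k (σ x) • x = 𝒢.rng (σ x) := fun x hx => by
    have := FullGroup.smul_src (hk (σ x))
    rwa [hσ x hx] at this
  obtain ⟨g, hg⟩ := exists_forall_eventually_smul_eq (hfin.image 𝒢.src) (f := fun x => k (σ x))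
    (fun x hx y hy hxy => by
      simp only [hkσ x hx, hkσ y hy] at hxy
      rw [← hσ x hx, ← hσ y hy, Q.2.2.2 (hσQ x hx) (hσQ y hy) hxy])
  refine ⟨g, fun γ hγ => ?_⟩
  have hx : 𝒢.src γ ∈ 𝒢.src '' Q.1 := ⟨γ, hγ, rfl⟩
  have e : σ (𝒢.src γ) = γ := Q.2.2.1 (hσQ _ hx) hγ (hσ _ hx)
  have h1 : (g.1).germ (𝒢.src γ) = (k γ).1.germ (𝒢.src γ) := by
    rw [FullGroup.germ_eq_germ_iff, FullGroup.unit_mem_iff heff]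
    filter_upwards [hg _ hx] with z hz
    rw [e] at hz
    rw [mul_smul, inv_smul_eq_iff]
    exact hz.symm
  rw [FullGroup.germ_eq (hk γ) rfl] at h1
  exact h1 ▸ g.1.germ_mem _

end Cantor

end EtaleGroupoid

namespace EtaleGroupoid

variable {A H Y : Type*} [Group A] [TopologicalSpace H] [TopologicalSpace Y]
  {ℋ : EtaleGroupoid H Y}

/-! ### Stabilizers of germs -/

theorem FullGroup.unit_mem_conj {g h : ℋ.FullGroup} {y : Y} (hg : ℋ.unit y ∈ g.1) :
    ℋ.unit (h • y) ∈ (h * g * h⁻¹).1 := by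
  have e : h.germ y = (h * g).germ y := by
    rw [FullGroup.germ_eq_germ_iff, inv_mul_cancel_left]
    exact hg
  have h1 : h.germ y ∈ (h * g).1 := e ▸ (h * g).germ_mem y
  exact ⟨_, h1, _, ⟨_, h.germ_mem y, rfl⟩, (ℋ.rng_inv _).symm, ℋ.mul_inv _⟩

/-- The group of elements whose image under `ρ` has the trivial germ at `y`. -/
def germStabilizer (ρ : A →* ℋ.FullGroup) (y : Y) : Subgroup A where
  carrier := {a | ℋ.unit y ∈ (ρ a).1}
  mul_mem' {a b} ha hb := by
    change ℋ.unit y ∈ (ρ (a * b)).1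
    rw [map_mul]
    exact ⟨_, ha, _, hb, by rw [ℋ.src_unit, ℋ.rng_unit], ℋ.mul_unit_of rfl _⟩
  one_mem' := by
    change ℋ.unit y ∈ (ρ 1).1
    rw [map_one]
    exact ⟨y, trivial, rfl⟩
  inv_mem' {a} ha := by
    have h1 := FullGroup.unit_mem_iff_germ_eq.1 ha
    have h2 : (ρ a).germ y = (1 : ℋ.FullGroup).germ y := by rw [h1, FullGroup.germ_one]
    have h3 := FullGroup.germ_eq_germ_iff.1 h2
    rw [mul_one, ← map_inv] at h3
    exact h3

variable {ρ : A →* ℋ.FullGroup}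

theorem mem_germStabilizer {y : Y} {a : A} : a ∈ germStabilizer ρ y ↔ ℋ.unit y ∈ (ρ a).1 := Iff.rfl

theorem germ_eq_germ_iff_mem_germStabilizer {y : Y} {a b : A} :
    (ρ a).germ y = (ρ b).germ y ↔ a⁻¹ * b ∈ germStabilizer ρ y := by
  rw [FullGroup.germ_eq_germ_iff, mem_germStabilizer, map_mul, map_inv]

/-- A compact set of arrows has boundedly many arrows with any given source. -/
theorem exists_encard_inter_src_le {K : Set H} (hK : IsCompact K) :
    ∃ N : ℕ, ∀ y, (K ∩ ℋ.src ⁻¹' {y}).encard ≤ N := by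
  obtain ⟨t, ht⟩ := hK.elim_finite_subcover (fun T : ℋ.Bisection => (T : Set H))
    (fun T => T.isOpen) fun γ _ => mem_iUnion.2 (exists_bisection_mem γ)
  have hKt : ∀ γ ∈ K, ∃ T ∈ t, γ ∈ T := fun γ hγ => by simpa using ht hγ
  choose! T hTt hT using hKt
  refine ⟨t.card, fun y => ?_⟩
  rw [← encard_coe_eq_coe_finsetCard]
  refine encard_le_encard_of_injOn (f := T) (fun γ hγ => hTt γ hγ.1) fun γ hγ δ hδ e => ?_
  exact (T γ).injOn_src (hT γ hγ.1) (e ▸ hT δ hδ.1) (hγ.2.trans hδ.2.symm)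

theorem leafDiv_injective {y : Y} (δ : ℋ.Leaf y) : Function.Injective fun γ => ℋ.leafDiv γ δ := by
  have key : ∀ γ : ℋ.Leaf y, ∀ h, ℋ.mul (ℋ.leafDiv γ δ) δ.1 h = γ.1 := by
    intro γ h
    have := ℋ.mul_assoc γ.1 (ℋ.inv δ.1) δ.1 (by rw [γ.2, ℋ.rng_inv, δ.2]) (ℋ.src_inv _)
    rw [ℋ.mul_unit_of (ℋ.inv_mul _)] at this
    exact this
  intro γ γ' h
  have hs : ∀ γ : ℋ.Leaf y, ℋ.src (ℋ.leafDiv γ δ) = ℋ.rng δ.1 := fun γ => by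
    rw [leafDiv, ℋ.src_mul, ℋ.src_inv]
  refine Subtype.ext ?_
  rw [← key γ (hs γ), ← key γ' (hs γ')]
  exact ℋ.mul_congr h rfl _ _

/-- The map sending the coset of `a` to the germ of `ρ a` at `y` embeds the coset space of the germ
stabilizer coarsely into the leaf. -/
theorem cosetDimLE_germStabilizer [CompactSpace Y] {y : Y} {n : ℕ}
    (h : (ℋ.leafCoarse y).AsdimLE n) : CosetDimLE (germStabilizer ρ y) n := by
  intro P hP
  let Φ : A ⧸ germStabilizer ρ y → ℋ.Leaf y := fun q => ⟨(ρ q.out).germ y, FullGroup.src_germ _ _⟩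
  have hΦ : ∀ a : A, (Φ a).1 = (ρ a).germ y := by
    intro a
    change (ρ (Quotient.out _)).germ y = _
    rw [germ_eq_germ_iff_mem_germStabilizer, ← QuotientGroup.eq]
    exact Quotient.out_eq _
  have hΦinj : Function.Injective Φ := by
    intro q q' e
    induction q using QuotientGroup.induction_on with | H a => ?_
    induction q' using QuotientGroup.induction_on with | H b => ?_
    have e' := congrArg Subtype.val e
    rw [hΦ, hΦ, germ_eq_germ_iff_mem_germStabilizer] at e'
    exact QuotientGroup.eq.2 e'
  let E : Set (ℋ.Leaf y × ℋ.Leaf y) := {p | ∃ t ∈ P, ∃ q, p = (Φ (t • q), Φ q)}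
  have hE : (ℋ.leafCoarse y).Controlled E := by
    refine ⟨⋃ t ∈ P, ((ρ t).1 : Set H), hP.isCompact_biUnion fun t _ => ?_, ?_⟩
    · rw [FullGroup.coe_eq_range_germ]
      exact isCompact_range (FullGroup.continuous_germ _)
    · rintro _ ⟨t, ht, q, rfl⟩
      induction q using QuotientGroup.induction_on with | H a => ?_
      refine mem_biUnion ht ?_
      have e : ρ t = ρ (t * a) * (ρ a)⁻¹ := by rw [map_mul, mul_inv_cancel_right]
      rw [e]
      refine ⟨_, ?_, _, ⟨_, ?_, rfl⟩, _, rfl⟩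
      · change (Φ ((t * a : A) : A ⧸ germStabilizer ρ y)).1 ∈ _
        rw [hΦ]
        exact FullGroup.germ_mem _ _
      · rw [hΦ]
        exact FullGroup.germ_mem _ _
  obtain ⟨𝒟, h𝒟, hcov⟩ := h E hE
  have hN : ∀ i, ∃ N : ℕ, ∀ D ∈ 𝒟 i, (Φ ⁻¹' D).encard ≤ N := by
    intro i
    obtain ⟨K, hK, hKD⟩ := (h𝒟 i).2
    obtain ⟨N, hN⟩ := exists_encard_inter_src_le (ℋ := ℋ) hK
    refine ⟨N, fun D hD => ?_⟩
    rcases D.eq_empty_or_nonempty with rfl | ⟨δ, hδ⟩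
    · simp
    refine le_trans (encard_le_encard_of_injOn (f := fun q => ℋ.leafDiv (Φ q) δ) ?_
      ((leafDiv_injective δ).comp hΦinj).injOn) (hN (ℋ.rng δ.1))
    intro q hq
    refine ⟨hKD (Φ q, δ) (mem_biUnion hD ⟨hq, hδ⟩), ?_⟩
    exact (ℋ.src_mul _ _ _).trans (ℋ.src_inv _)
  choose N hN using hN
  refine ⟨∑ i, N i, fun i => (Φ ⁻¹' ·) '' 𝒟 i, ?_, ?_, ?_⟩
  · rintro i _ ⟨D, hD, rfl⟩
    refine (hN i D hD).trans ?_
    exact_mod_cast Finset.single_le_sum (fun j _ => Nat.zero_le (N j)) (Finset.mem_univ i)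
  · rintro i _ ⟨D, hD, rfl⟩ _ ⟨D', hD', rfl⟩ hne q hq t ht hq'
    have hne' : D' ≠ D := by
      rintro rfl
      exact hne rfl
    have := (h𝒟 i).1 D' hD' D hD hne'
    exact notMem_empty _ (this ▸ ⟨⟨hq', hq⟩, t, ht, q, rfl⟩ : (Φ (t • q), Φ q) ∈ (∅ : Set _))
  · intro q
    obtain ⟨i, D, hD, hq⟩ := hcov (Φ q)
    exact ⟨i, _, ⟨D, hD, rfl⟩, hq⟩

theorem exists_asdimLE_of_leafAsdim_lt_top [CompactSpace Y] {y : Y} (h : ℋ.leafAsdim y < ⊤) :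
    ∃ n : ℕ, (ℋ.leafCoarse y).AsdimLE n ∧ (n : ℕ∞) ≤ ℋ.leafAsdim y := by
  classical
  have hex : ∃ n, (ℋ.leafCoarse y).AsdimLE n := by
    by_contra! hcon
    refine h.ne ?_
    simp [leafAsdim, CoarseStructure.asdim, hcon]
  exact ⟨Nat.find hex, Nat.find_spec hex,
    le_iInf₂ fun n hn => by exact_mod_cast Nat.find_min' hex hn⟩

theorem isStabilizerField_germStabilizer [CompactSpace Y] [MulAction A Y]
    (hact : ∀ (a : A) (y : Y), a • y = ρ a • y) (hdim : ∀ y, ℋ.leafAsdim y < ⊤) :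
    IsStabilizerField (germStabilizer ρ) where
  continuous_smul g := by
    simp only [hact]
    exact FullGroup.continuous_smul _
  smul_eq y g hg := by
    rw [hact]
    exact FullGroup.smul_eq_of_unit_mem hg
  conj_mem y g hg a := by
    rw [mem_germStabilizer, map_mul, map_mul, map_inv, hact]
    exact FullGroup.unit_mem_conj hg
  isOpen g := (ρ g).1.isOpen.preimage ℋ.continuous_unit
  exists_dim y := by
    obtain ⟨n, hn, -⟩ := exists_asdimLE_of_leafAsdim_lt_top (hdim y)
    exact ⟨n, cosetDimLE_germStabilizer hn⟩

theorem mem_supportOf_range_iff {y : Y} (hcl : IsClosed {y | germStabilizer ρ y ≠ ⊤}) :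
    y ∈ supportOf ρ.range ↔ germStabilizer ρ y ≠ ⊤ := by
  have : (⋃ k ∈ ρ.range, FullGroup.support k) = {y | germStabilizer ρ y ≠ ⊤} := by
    ext y
    simp only [FullGroup.support, MonoidHom.mem_range, mem_iUnion, mem_ofPred_eq, exists_prop,
      exists_exists_eq_and, ne_eq, Subgroup.eq_top_iff', not_forall, mem_germStabilizer]
  rw [supportOf, this, hcl.closure_eq]
  rfl

end EtaleGroupoid

/-! ### The topology of symmetric powers -/

namespace SymPow

theorem exists_range_eq {X : Type*} {r : ℕ} {S : Set X} (hne : S.Nonempty) (hS : S.encard ≤ r) :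
    ∃ x : Fin r → X, range x = S := by
  have hfin : S.Finite := finite_of_encard_le_coe hS
  have := hfin.to_subtype
  have := hne.to_subtype
  have := Fintype.ofFinite S
  have hcard : Fintype.card S ≤ Fintype.card (Fin r) := by
    rw [Fintype.card_fin, ← Nat.card_eq_fintype_card, Nat.card_coe_set_eq]
    rw [← hfin.cast_ncard_eq] at hS
    exact_mod_cast hS
  obtain ⟨e⟩ := Function.Embedding.nonempty_of_card_le hcard
  refine ⟨fun i => (Function.invFun e i : S), ?_⟩
  have := (Function.invFun_surjective e.injective).range_eq
  rw [← Function.comp_def Subtype.val, range_comp, this, image_univ, Subtype.range_coe]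

variable {X : Type*} [TopologicalSpace X] {r : ℕ}

theorem finite (S : SymPow X r) : S.1.Finite := by
  obtain ⟨x, hx⟩ := S.2
  rw [← hx]
  exact finite_range x

variable [CompactSpace X] [T2Space X] [TotallyDisconnectedSpace X]

/-- A neighbourhood of a point `S` of a symmetric power contains all points which are covered by
certain small disjoint clopen neighbourhoods of the points of `S` and meet all of them. -/
theorem exists_isClopen_of_mem {E : Set (SymPow X r)} (hE : IsOpen E) {S : SymPow X r}
    (hS : S ∈ E) : ∃ W : S.1 → Set X, (∀ p, IsClopen (W p)) ∧ (∀ p, p.1 ∈ W p) ∧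
      ∀ T : SymPow X r, T.1 ⊆ ⋃ p, W p → (∀ p, (T.1 ∩ W p).Nonempty) → T ∈ E := by
  have := S.finite.to_subtype
  have hE' : IsOpen (SymPow.mk ⁻¹' E : Set (Fin r → X)) := hE.preimage continuous_coinduced_rng
  have hex : ∀ x : Fin r → S.1, ∃ N : Fin r → Set X, (∀ i, IsOpen (N i) ∧ (x i).1 ∈ N i) ∧
      (Function.Surjective x → univ.pi N ⊆ SymPow.mk ⁻¹' E) := by
    intro x
    by_cases hx : Function.Surjective x
    · have hmem : (fun i => (x i).1) ∈ (SymPow.mk ⁻¹' E : Set (Fin r → X)) := by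
        have : SymPow.mk (fun i => (x i).1) = S := by
          refine Subtype.ext ?_
          change range (Subtype.val ∘ x) = _
          rw [range_comp, hx.range_eq, image_univ, Subtype.range_coe]
        rw [mem_preimage, this]
        exact hS
      obtain ⟨N, hN, hNE⟩ := isOpen_pi_iff'.1 hE' _ hmem
      exact ⟨N, hN, fun _ => hNE⟩
    · exact ⟨fun _ => univ, fun i => ⟨isOpen_univ, mem_univ _⟩, fun h => absurd h hx⟩
  choose N hN hNE using hex
  obtain ⟨W, hW, hSW, hWN, hWd⟩ := exists_disjoint_isClopen (x := fun p : S.1 => p.1)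
    Subtype.val_injective (O := fun p => ⋂ (x : Fin r → S.1) (i) (_ : x i = p), N x i)
    (fun p => isOpen_iInter_of_finite fun x => isOpen_iInter_of_finite fun i =>
      isOpen_iInter_of_finite fun _ => (hN x i).1)
    (fun p => by
      simp only [mem_iInter]
      rintro x i rfl
      exact (hN x i).2)
  refine ⟨W, hW, hSW, fun T hT hTW => ?_⟩
  obtain ⟨b, hb⟩ := T.2
  have hbW : ∀ i, ∃ p, b i ∈ W p := fun i => mem_iUnion.1 (hT (hb ▸ mem_range_self i))
  choose x hx using hbW
  have hsurj : Function.Surjective x := by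
    intro p
    obtain ⟨t, htT, htp⟩ := hTW p
    rw [← hb] at htT
    obtain ⟨i, rfl⟩ := htT
    refine ⟨i, ?_⟩
    by_contra hne
    exact Set.disjoint_left.1 (hWd hne) (hx i) htp
  have hmem : b ∈ univ.pi (N x) := fun i _ => by
    have := hWN _ (hx i)
    simp only [mem_iInter] at this
    exact this x i rfl
  have : SymPow.mk b = T := Subtype.ext hb
  rw [← this]
  exact hNE x hsurj hmem

end SymPow

namespace IsStabilizerField

variable {A X Y : Type*} [Group A] [TopologicalSpace X] [MulAction A X] [IsAlternatingAction A X]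
  [CompactSpace X] [T2Space X] [TotallyDisconnectedSpace X] [Infinite X]
  [TopologicalSpace Y] [CompactSpace Y] [T2Space Y] [MulAction A Y] {L : Y → Subgroup A} {r : ℕ}

/-- The support depends continuously on the point, as a point of the symmetric power. -/
theorem continuous_support (hL : IsStabilizerField L) {Z : Set Y} {q : Z → SymPow X r}
    (hq : ∀ y, (q y).1 = subgroupSupport X (L y)) : Continuous q := by
  rw [continuous_def]
  intro E hE
  rw [isOpen_iff_mem_nhds]
  intro y hy
  obtain ⟨W, hW, hqW, hWE⟩ := SymPow.exists_isClopen_of_mem hE hy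
  have := (q y).finite.to_subtype
  have h1 : ∀ᶠ y' in 𝓝 (y : Y), subgroupSupport X (L y') ⊆ ⋃ p, W p :=
    hL.eventually_support_subset (isClopen_iUnion_of_finite hW) fun x hx =>
      mem_iUnion.2 ⟨⟨x, by rw [hq]; exact hx⟩, hqW _⟩
  have h2 : ∀ᶠ y' in 𝓝 (y : Y), ∀ p, (subgroupSupport X (L y') ∩ W p).Nonempty :=
    eventually_all.2 fun p => hL.eventually_support_inter_nonempty (hW p)
      ⟨p, by rw [← hq]; exact p.2, hqW p⟩
  have h3 := continuous_subtype_val.continuousAt.eventually (h1.and h2)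
  filter_upwards [h3] with y' hy'
  exact hWE _ (by rw [hq y']; exact hy'.1) fun p => by rw [hq y']; exact hy'.2 p

/-- There is a least bound `r` for the cardinality of the supports, and it is attained. -/
theorem exists_encard_support_eq (hL : IsStabilizerField L) {y : Y} (hy : L y ≠ ⊤) :
    ∃ r : ℕ, 1 ≤ r ∧ (∀ y, (subgroupSupport X (L y)).encard ≤ r) ∧
      ∃ y₀, (r : ℕ∞) ≤ (subgroupSupport X (L y₀)).encard := by
  classical
  have hex := hL.exists_encard_support_le (X := X)
  have h0 : Nat.find hex ≠ 0 := by
    intro h0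
    have := Nat.find_spec hex y
    rw [h0, Nat.cast_zero, nonpos_iff_eq_zero, encard_eq_zero, hL.support_eq_empty_iff] at this
    exact hy this
  refine ⟨Nat.find hex, Nat.one_le_iff_ne_zero.2 h0, Nat.find_spec hex, ?_⟩
  obtain ⟨m, hm⟩ := Nat.exists_eq_succ_of_ne_zero h0
  have := Nat.find_min hex (m := m) (by omega)
  push Not at this
  obtain ⟨y₀, hy₀⟩ := this
  refine ⟨y₀, ?_⟩
  rw [hm]
  simpa using Order.add_one_le_of_lt hy₀

end IsStabilizerField

namespace EtaleGroupoid

variable {G X H Y : Type*} [TopologicalSpace G] [TopologicalSpace X] [TopologicalSpace H]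
  [TopologicalSpace Y] {𝒢 : EtaleGroupoid G X} {ℋ : EtaleGroupoid H Y}

/-! ### Germs over the support -/

/-- The arrow `η` is the germ of some `ρ g`, and the set `Q` consists of the germs of `g` at the
points of the support of the germ stabilizer at the source of `η`. -/
def IsGermOver (ρ : 𝒢.alternatingFullGroup →* ℋ.FullGroup) (Q : Set G) (η : H) : Prop :=
  ∃ g : 𝒢.alternatingFullGroup, η ∈ (ρ g).1 ∧ Q ⊆ g.1.1 ∧
    𝒢.src '' Q = subgroupSupport X (germStabilizer ρ (ℋ.src η))

variable {ρ : 𝒢.alternatingFullGroup →* ℋ.FullGroup}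

theorem image_smul_eq_of_subset {g : 𝒢.alternatingFullGroup} {Q : Set G} (hQ : Q ⊆ g.1.1) :
    (fun x => g • x) '' (𝒢.src '' Q) = 𝒢.rng '' Q := by
  rw [image_image]
  exact image_congr fun γ hγ => FullGroup.smul_src (hQ hγ)

section

variable [CompactSpace X] [T2Space X] [TotallyDisconnectedSpace X] [Infinite X]
  [IsAlternatingAction 𝒢.alternatingFullGroup X] [CompactSpace Y] [T2Space Y]
  [MulAction 𝒢.alternatingFullGroup Y]
  (hL : IsStabilizerField (germStabilizer ρ))
  (hact : ∀ (a : 𝒢.alternatingFullGroup) (y : Y), a • y = ρ a • y) (heff : 𝒢.IsEffective)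

include hL in
theorem support_smul_eq_of_subset {g : 𝒢.alternatingFullGroup} {Q : Set G} (hQ : Q ⊆ g.1.1)
    {y : Y} (h : 𝒢.src '' Q = subgroupSupport X (germStabilizer ρ y)) :
    𝒢.rng '' Q = subgroupSupport X (germStabilizer ρ (g • y)) := by
  rw [hL.image_support, ← h, image_smul_eq_of_subset hQ]

theorem smul_src_eq (hact : ∀ (a : 𝒢.alternatingFullGroup) (y : Y), a • y = ρ a • y)
    {g : 𝒢.alternatingFullGroup} {η : H} (h : η ∈ (ρ g).1) : g • ℋ.src η = ℋ.rng η := by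
  rw [hact, FullGroup.smul_src h]

include hL heff in
/-- If the germs of `g` and `g'` at the support for `y` are equal, then so are the germs of `ρ g`
and `ρ g'` at `y`. -/
theorem germ_eq_of_subset {g g' : 𝒢.alternatingFullGroup} {Q : Set G} (hg : Q ⊆ g.1.1)
    (hg' : Q ⊆ g'.1.1) {y : Y} (h : 𝒢.src '' Q = subgroupSupport X (germStabilizer ρ y)) :
    (ρ g).germ y = (ρ g').germ y := by
  rw [germ_eq_germ_iff_mem_germStabilizer]
  refine hL.mem_of_eventually (X := X) fun x hx => ?_
  rw [← h] at hx
  obtain ⟨γ, hγ, rfl⟩ := hx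
  have e : g.1.germ (𝒢.src γ) = g'.1.germ (𝒢.src γ) := by
    rw [FullGroup.germ_eq (hg hγ) rfl, FullGroup.germ_eq (hg' hγ) rfl]
  exact (FullGroup.unit_mem_iff heff).1 (FullGroup.germ_eq_germ_iff.1 e)

namespace IsGermOver

include hL heff in
theorem eq_germ {Q : Set G} {η : H} (h : IsGermOver ρ Q η) {g : 𝒢.alternatingFullGroup}
    (hg : Q ⊆ g.1.1) : η = (ρ g).germ (ℋ.src η) := by
  obtain ⟨g', hη, hg', hQ⟩ := h
  rw [← germ_eq_of_subset hL heff hg' hg hQ, FullGroup.germ_eq hη rfl]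

include hL heff in
theorem eq_of_src_eq {Q : Set G} {η η' : H} (h : IsGermOver ρ Q η) (h' : IsGermOver ρ Q η')
    (hs : ℋ.src η = ℋ.src η') : η = η' := by
  have h1 := h
  obtain ⟨g, hη, hg, hQ⟩ := h
  rw [h1.eq_germ hL heff hg, h'.eq_germ hL heff hg, hs]

include hL hact in
theorem rng_eq {Q : Set G} {η : H} (h : IsGermOver ρ Q η) :
    𝒢.rng '' Q = subgroupSupport X (germStabilizer ρ (ℋ.rng η)) := by
  obtain ⟨g, hη, hg, hQ⟩ := h
  rw [support_smul_eq_of_subset hL hg hQ, smul_src_eq hact hη]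

include hL hact in
theorem inv {Q : Set G} {η : H} (h : IsGermOver ρ Q η) :
    IsGermOver ρ (𝒢.setInv Q) (ℋ.inv η) := by
  refine ⟨h.choose⁻¹, ?_, image_mono h.choose_spec.2.1, ?_⟩
  · rw [map_inv]
    exact ⟨η, h.choose_spec.1, rfl⟩
  · rw [𝒢.src_image_setInv, ℋ.src_inv, h.rng_eq hL hact]

theorem mul {Q P : Set G} {η δ : H} (hs : ℋ.src η = ℋ.rng δ) (h : IsGermOver ρ Q η)
    (h' : IsGermOver ρ P δ) (hQP : 𝒢.src '' Q = 𝒢.rng '' P) :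
    IsGermOver ρ (𝒢.setMul Q P) (ℋ.mul η δ hs) := by
  obtain ⟨g, hη, hg, hQ⟩ := h
  obtain ⟨g', hδ, hg', hP⟩ := h'
  refine ⟨g * g', ?_, 𝒢.setMul_mono hg hg', ?_⟩
  · rw [map_mul]
    exact ⟨η, hη, δ, hδ, hs, rfl⟩
  · rw [𝒢.src_image_setMul hQP.symm.subset, ℋ.src_mul, hP]

theorem germ {g : 𝒢.alternatingFullGroup} {Q : Set G} (hg : Q ⊆ g.1.1) {y : Y}
    (h : 𝒢.src '' Q = subgroupSupport X (germStabilizer ρ y)) :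
    IsGermOver ρ Q ((ρ g).germ y) :=
  ⟨g, FullGroup.germ_mem _ _, hg, by rw [FullGroup.src_germ]; exact h⟩

theorem unit (y : Y) :
    IsGermOver ρ (𝒢.unit '' subgroupSupport X (germStabilizer ρ y)) (ℋ.unit y) := by
  refine ⟨1, ?_, ?_, ?_⟩
  · rw [map_one]
    exact ⟨y, trivial, rfl⟩
  · rintro _ ⟨x, -, rfl⟩
    exact ⟨x, trivial, rfl⟩
  · rw [ℋ.src_unit, image_image]
    simp [𝒢.src_unit]

end IsGermOver

end

end EtaleGroupoid

namespace EtaleGroupoid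

/-! ### Idempotents of the pseudogroup -/

namespace Bisection

variable {G X : Type*} [TopologicalSpace G] [TopologicalSpace X] {𝒢 : EtaleGroupoid G X}

theorem isIdempotentElem_of_subset {T : 𝒢.Bisection} (hT : (T : Set G) ⊆ range 𝒢.unit) :
    IsIdempotentElem T := by
  refine coe_ext (Subset.antisymm ?_ fun γ hγ => ?_)
  · rintro _ ⟨a, ha, b, hb, h, rfl⟩
    obtain ⟨x, rfl⟩ := hT hb
    rwa [𝒢.mul_unit_of rfl]
  · obtain ⟨x, rfl⟩ := hT hγ
    exact ⟨_, hγ, _, hγ, by rw [𝒢.src_unit, 𝒢.rng_unit], 𝒢.mul_unit_of rfl _⟩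

theorem compatible_of_subset {T S R : 𝒢.Bisection} (hT : (T : Set G) ⊆ R)
    (hS : (S : Set G) ⊆ R) : Compatible T S := by
  constructor
  · refine isIdempotentElem_of_subset ?_
    refine (𝒢.setMul_mono hT (image_mono hS)).trans ?_
    exact (𝒢.setMul_setInv R.injOn_src).subset.trans (image_subset_range _ _)
  · refine isIdempotentElem_of_subset ?_
    refine (𝒢.setMul_mono (image_mono hT) hS).trans ?_
    exact (𝒢.setInv_setMul R.injOn_rng).subset.trans (image_subset_range _ _)

theorem unit_mem_mul {T S : 𝒢.Bisection} {x : X} (hT : 𝒢.unit x ∈ T) (hS : 𝒢.unit x ∈ S) :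
    𝒢.unit x ∈ T * S :=
  ⟨_, hT, _, hS, by rw [𝒢.src_unit, 𝒢.rng_unit], 𝒢.mul_unit_of rfl _⟩

theorem mem_mul_ofOpen {T : 𝒢.Bisection} {U : Set X} {hU : IsOpen U} {γ : G} :
    γ ∈ T * ofOpen U hU ↔ γ ∈ T ∧ 𝒢.src γ ∈ U := by
  constructor
  · rintro ⟨a, ha, _, ⟨x, hx, rfl⟩, h, rfl⟩
    rw [𝒢.rng_unit] at h
    rw [𝒢.mul_unit_of rfl, h]
    exact ⟨ha, hx⟩
  · rintro ⟨h, hU⟩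
    exact ⟨γ, h, _, ⟨_, hU, rfl⟩, (𝒢.rng_unit _).symm, 𝒢.mul_unit γ⟩

theorem mem_ofOpen_mul {T : 𝒢.Bisection} {U : Set X} {hU : IsOpen U} {γ : G} :
    γ ∈ ofOpen U hU * T ↔ γ ∈ T ∧ 𝒢.rng γ ∈ U := by
  constructor
  · rintro ⟨_, ⟨x, hx, rfl⟩, a, ha, h, rfl⟩
    rw [𝒢.src_unit] at h
    rw [𝒢.unit_mul_of rfl, ← h]
    exact ⟨ha, hx⟩
  · rintro ⟨h, hU⟩
    exact ⟨_, ⟨_, hU, rfl⟩, γ, h, 𝒢.src_unit _, 𝒢.unit_mul γ⟩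

end Bisection

end EtaleGroupoid

namespace ContinuousMorphism

open EtaleGroupoid EtaleGroupoid.Bisection

variable {G X H Y : Type*} [TopologicalSpace G] [TopologicalSpace X] [TopologicalSpace H]
  [TopologicalSpace Y] {𝒢 : EtaleGroupoid G X} {ℋ : EtaleGroupoid H Y}

theorem ext_of_apply {φ φ' : ContinuousMorphism 𝒢 ℋ}
    (h : ∀ T, φ.toMonoidHom T = φ'.toMonoidHom T) : φ = φ' := by
  have h' : φ.toMonoidHom = φ'.toMonoidHom := MonoidHom.ext h
  cases φ
  cases φ'
  simp only at h'
  subst h'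
  rfl

theorem coe_apply_sUnion (φ : ContinuousMorphism 𝒢 ℋ) (𝒯 : Set 𝒢.Bisection)
    (h𝒯 : ∀ T ∈ 𝒯, ∀ S ∈ 𝒯, Compatible T S) :
    (φ.toMonoidHom (sUnion 𝒯 h𝒯) : Set H) = ⋃ T ∈ 𝒯, (φ.toMonoidHom T : Set H) :=
  φ.map_sUnion 𝒯 h𝒯

theorem apply_empty (φ : ContinuousMorphism 𝒢 ℋ) : φ.toMonoidHom ∅ = ∅ := φ.map_empty

theorem isIdempotentElem_ofOpen {U : Set X} (hU : IsOpen U) :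
    IsIdempotentElem (ofOpen (𝒢 := 𝒢) U hU) :=
  isIdempotentElem_of_subset (image_subset_range _ _)

/-- On idempotents a continuous morphism is given by a map between the unit spaces: the open sets
whose image does not contain `y` have a largest element, and as the unit space is Hausdorff, the
complement of this set is a point. -/
theorem exists_forall_unit_mem_iff (φ : ContinuousMorphism 𝒢 ℋ) (y : Y) :
    ∃ a : X, ∀ (U : Set X) (hU : IsOpen U), ℋ.unit y ∈ φ.toMonoidHom (ofOpen U hU) ↔ a ∈ U := by
  have := 𝒢.t2
  let 𝒰 : Set (Set X) := {U | ∃ hU : IsOpen U, ℋ.unit y ∉ φ.toMonoidHom (ofOpen U hU)}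
  let 𝒯 : Set 𝒢.Bisection := {T | ∃ U ∈ 𝒰, (T : Set G) = 𝒢.unit '' U}
  have hN : IsOpen (⋃₀ 𝒰) := isOpen_sUnion fun U hU => hU.1
  have h𝒯 : ∀ T ∈ 𝒯, ∀ S ∈ 𝒯, Compatible T S := by
    rintro T ⟨U, -, hT⟩ S ⟨V, -, hS⟩
    refine compatible_of_subset (R := 1) ?_ ?_
    · rw [hT, coe_one]
      exact image_mono (subset_univ _)
    · rw [hS, coe_one]
      exact image_mono (subset_univ _)
  have hunion : ofOpen (⋃₀ 𝒰) hN = sUnion 𝒯 h𝒯 := by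
    refine coe_ext (Subset.antisymm ?_ ?_)
    · rintro _ ⟨x, ⟨U, hU, hx⟩, rfl⟩
      exact mem_biUnion (x := ofOpen U hU.1) ⟨U, hU, rfl⟩ ⟨x, hx, rfl⟩
    · refine iUnion₂_subset ?_
      rintro T ⟨U, hU, hT⟩
      rw [hT]
      exact image_mono (subset_sUnion_of_mem hU)
  have hyN : ℋ.unit y ∉ φ.toMonoidHom (ofOpen (⋃₀ 𝒰) hN) := by
    intro h
    rw [hunion] at h
    have h' : ℋ.unit y ∈ (φ.toMonoidHom (sUnion 𝒯 h𝒯) : Set H) := h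
    rw [coe_apply_sUnion, mem_iUnion₂] at h'
    obtain ⟨T, ⟨U, ⟨hU, hyU⟩, hT⟩, hyT⟩ := h'
    have : T = ofOpen U hU := coe_ext hT
    rw [this] at hyT
    exact hyU hyT
  have hmono : ∀ (U V : Set X) (hU : IsOpen U) (hV : IsOpen V), U ⊆ V →
      ℋ.unit y ∈ φ.toMonoidHom (ofOpen U hU) → ℋ.unit y ∈ φ.toMonoidHom (ofOpen V hV) := by
    intro U V hU hV hUV h
    have e : ofOpen (𝒢 := 𝒢) U hU = ofOpen V hV * ofOpen U hU := by
      refine coe_ext (Set.ext fun γ => ?_)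
      refine Iff.trans ?_ mem_mul_ofOpen.symm
      constructor
      · rintro ⟨x, hx, rfl⟩
        exact ⟨⟨x, hUV hx, rfl⟩, by rwa [𝒢.src_unit]⟩
      · rintro ⟨⟨x, hx, rfl⟩, h⟩
        rw [𝒢.src_unit] at h
        exact ⟨x, h, rfl⟩
    rw [e, map_mul] at h
    obtain ⟨a, ha, b, hb, hab, e'⟩ := h
    obtain ⟨z, rfl⟩ := mem_unit_of_isIdempotentElem
      ((isIdempotentElem_ofOpen hU).map φ.toMonoidHom) hb
    rw [ℋ.mul_unit_of rfl] at e'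
    exact e' ▸ ha
  have hne : (⋃₀ 𝒰)ᶜ.Nonempty := by
    by_contra hcon
    rw [not_nonempty_iff_eq_empty, compl_empty_iff] at hcon
    have e : ofOpen (𝒢 := 𝒢) (⋃₀ 𝒰) hN = 1 := coe_ext (by rw [coe_one, ← hcon]; rfl)
    rw [e, map_one] at hyN
    exact hyN ⟨y, trivial, rfl⟩
  obtain ⟨a, ha⟩ := hne
  refine ⟨a, fun U hU => ⟨fun h => ?_, fun h => ?_⟩⟩
  · by_contra haU
    -- Every point outside `U` lies in the largest open set, since it can be separated from `a`.
    refine hyN ?_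
    have hcov : U ⊆ ⋃₀ 𝒰 := by
      intro b hb
      by_contra hbN
      have hab : a ≠ b := fun e => haU (e ▸ hb)
      obtain ⟨V, W, hV, hW, haV, hbW, hVW⟩ := t2_separation hab
      have h1 : ℋ.unit y ∈ φ.toMonoidHom (ofOpen V hV) := by
        by_contra hn
        exact ha ⟨V, ⟨hV, hn⟩, haV⟩
      have h2 : ℋ.unit y ∈ φ.toMonoidHom (ofOpen W hW) := by
        by_contra hn
        exact hbN ⟨W, ⟨hW, hn⟩, hbW⟩
      have h3 := unit_mem_mul h1 h2
      have e : ofOpen V hV * ofOpen W hW = (∅ : 𝒢.Bisection) := by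
        refine coe_ext (Set.ext fun γ => ⟨fun hγ => ?_, fun hγ => hγ.elim⟩)
        obtain ⟨⟨x, hx, rfl⟩, h⟩ := mem_mul_ofOpen.1 hγ
        rw [𝒢.src_unit] at h
        exact Set.disjoint_left.1 hVW hx h
      rw [← map_mul, e, apply_empty] at h3
      exact h3
    exact hmono U _ hU hN hcov h
  · by_contra hn
    exact ha ⟨U, ⟨hU, hn⟩, h⟩

end ContinuousMorphism

namespace EtaleGroupoid

variable {G X H Y : Type*} [TopologicalSpace G] [TopologicalSpace X] [TopologicalSpace H]
  [TopologicalSpace Y] {𝒢 : EtaleGroupoid G X} {ℋ : EtaleGroupoid H Y}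
  {ρ : 𝒢.alternatingFullGroup →* ℋ.FullGroup}
  [CompactSpace X] [T2Space X] [TotallyDisconnectedSpace X] [Infinite X]
  [IsAlternatingAction 𝒢.alternatingFullGroup X] [CompactSpace Y] [T2Space Y]
  [MulAction 𝒢.alternatingFullGroup Y]
  (hL : IsStabilizerField (germStabilizer ρ))
  (hact : ∀ (a : 𝒢.alternatingFullGroup) (y : Y), a • y = ρ a • y)
  (heff : 𝒢.IsEffective) (hmin : 𝒢.IsMinimal)
  {Z : Set Y} (hZ : IsOpen Z) (hZL : ∀ y, y ∈ Z ↔ germStabilizer ρ y ≠ ⊤)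
  {r : ℕ} {q : Z → SymPow X r} (hq : ∀ y, (q y).1 = subgroupSupport X (germStabilizer ρ y))

/-! ### The extension -/

include hL hact hZL in
theorem smul_mem_iff (a : 𝒢.alternatingFullGroup) (y : Y) : a • y ∈ Z ↔ y ∈ Z := by
  rw [hZL, hZL, ne_eq, ne_eq, ← hL.support_eq_empty_iff (X := X),
    ← hL.support_eq_empty_iff (X := X), hL.image_support, image_eq_empty]

include hL hq in
theorem isOpen_setOf_isGermOver (T : (𝒢.symPow r).Bisection) :
    IsOpen {η : ℋ.RestrictArrow Z | ∃ Q ∈ T, IsGermOver ρ Q.1 η.1} := by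
  rw [isOpen_iff_mem_nhds]
  rintro η ⟨Q, hQT, g, hη, hg, hQ⟩
  let O : Set (SymPow X r) := SymPowArrow.src '' ((T : Set (𝒢.SymPowArrow r)) ∩ {P | P.1 ⊆ g.1.1})
  have hO : IsOpen O := SymPowArrow.isOpen_src_image g.1.1 T.isOpen
  have hc : Continuous fun η : ℋ.RestrictArrow Z => q ⟨ℋ.src η.1, η.2.1⟩ :=
    (hL.continuous_support hq).comp
      ((ℋ.isLocalHomeomorph_src.continuous.comp continuous_subtype_val).subtype_mk _)
  have hηO : q ⟨ℋ.src η.1, η.2.1⟩ ∈ O :=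
    ⟨Q, ⟨hQT, hg⟩, Subtype.ext (hQ.trans (hq ⟨ℋ.src η.1, η.2.1⟩).symm)⟩
  filter_upwards [hc.continuousAt (hO.mem_nhds hηO),
    continuous_subtype_val.continuousAt ((ρ g).1.isOpen.mem_nhds hη)] with η' h1 h2
  obtain ⟨Q', ⟨hQ'T, hg'⟩, e⟩ := h1
  exact ⟨Q', hQ'T, g, h2, hg', (congrArg Subtype.val e).trans (hq _)⟩

include hL heff in
theorem injOn_src_setOf_isGermOver (T : (𝒢.symPow r).Bisection) :
    InjOn ℋ.src {η : H | ∃ Q ∈ T, IsGermOver ρ Q.1 η} := by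
  rintro η ⟨Q, hQT, hQ⟩ η' ⟨Q', hQ'T, hQ'⟩ hs
  have e : Q = Q' := T.injOn_src hQT hQ'T (Subtype.ext (by
    obtain ⟨-, -, -, h⟩ := hQ
    obtain ⟨-, -, -, h'⟩ := hQ'
    exact h.trans (hs ▸ h'.symm)))
  subst e
  exact hQ.eq_of_src_eq hL heff hQ' hs

include hL hact heff in
theorem injOn_rng_setOf_isGermOver (T : (𝒢.symPow r).Bisection) :
    InjOn ℋ.rng {η : H | ∃ Q ∈ T, IsGermOver ρ Q.1 η} := by
  rintro η ⟨Q, hQT, hQ⟩ η' ⟨Q', hQ'T, hQ'⟩ hs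
  have e : Q = Q' := T.injOn_rng hQT hQ'T (Subtype.ext (by
    have h := hQ.rng_eq hL hact
    have h' := hQ'.rng_eq hL hact
    exact h.trans (hs ▸ h'.symm)))
  subst e
  have h := (hQ.inv hL hact).eq_of_src_eq hL heff (hQ'.inv hL hact)
    (by rw [ℋ.src_inv, ℋ.src_inv, hs])
  rw [← ℋ.inv_inv η, h, ℋ.inv_inv]

include hL hact heff hmin hZL hq in
/-- The map sending a bisection `T` of the symmetric power to the set of germs over elements of `T`
is a continuous morphism extending `ρ`. -/
theorem exists_continuousMorphism_extends :
    ∃ φ : ContinuousMorphism (𝒢.symPow r) (ℋ.restrict Z hZ), Extends ρ φ := by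
  let ψ : (𝒢.symPow r).Bisection → (ℋ.restrict Z hZ).Bisection := fun T =>
    { carrier := {η | ∃ Q ∈ T, IsGermOver ρ Q.1 η.1}
      isOpen := isOpen_setOf_isGermOver hL hq T
      injOn_src := fun η hη η' hη' h => Subtype.ext
        (injOn_src_setOf_isGermOver hL heff T hη hη' (congrArg Subtype.val h))
      injOn_rng := fun η hη η' hη' h => Subtype.ext
        (injOn_rng_setOf_isGermOver hL hact heff T hη hη' (congrArg Subtype.val h)) }
  have hone : ψ 1 = 1 := by
    refine Bisection.coe_ext (Set.ext fun η => ?_)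
    constructor
    · rintro ⟨Q, ⟨B, -, rfl⟩, hη⟩
      obtain ⟨g, -, -, hs⟩ := id hη
      have hB : B.1 = subgroupSupport X (germStabilizer ρ (ℋ.src η.1)) := by
        have := congrArg Subtype.val ((𝒢.symPow r).src_unit B)
        exact this.symm.trans hs
      have h1 := IsGermOver.unit (ρ := ρ) (ℋ.src η.1)
      rw [← hB] at h1
      exact ⟨⟨ℋ.src η.1, η.2.1⟩, trivial,
        Subtype.ext (h1.eq_of_src_eq hL heff hη (ℋ.src_unit _))⟩
    · rintro ⟨y, -, rfl⟩
      refine ⟨(𝒢.symPow r).unit (q y), ⟨_, trivial, rfl⟩, ?_⟩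
      have h1 := IsGermOver.unit (ρ := ρ) (y : Y)
      rw [← hq] at h1
      exact h1
  have hmul : ∀ T S, ψ (T * S) = ψ T * ψ S := by
    intro T S
    refine Bisection.coe_ext (Set.ext fun η => ?_)
    constructor
    · rintro ⟨_, ⟨Q, hQ, P, hP, hQP, rfl⟩, hη⟩
      have hs : 𝒢.src '' P.1 = subgroupSupport X (germStabilizer ρ (ℋ.src η.1)) := by
        obtain ⟨-, -, -, h⟩ := hη
        have := congrArg Subtype.val ((𝒢.symPow r).src_mul Q P hQP)
        exact this.symm.trans h
      have hQP' : 𝒢.src '' Q.1 = 𝒢.rng '' P.1 := congrArg Subtype.val hQP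
      -- The factors `P` and `Q` lie under germs of some `ρ g` and `ρ g'`, and the product of these
      -- germs lies over `Q * P`, so that it is equal to `η`.
      obtain ⟨g, hg⟩ := P.exists_alternatingFullGroup_subset heff hmin
      obtain ⟨g', hg'⟩ := Q.exists_alternatingFullGroup_subset heff hmin
      have h1 := IsGermOver.germ (ρ := ρ) hg hs
      have h1r := h1.rng_eq hL hact
      have h2 := IsGermOver.germ (ρ := ρ) hg' (hQP'.trans h1r)
      have hcomp := FullGroup.src_germ (ρ g') (ℋ.rng ((ρ g).germ (ℋ.src η.1)))
      have h3 := IsGermOver.mul hcomp h2 h1 hQP'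
      have e := h3.eq_of_src_eq hL heff hη ((ℋ.src_mul _ _ _).trans (FullGroup.src_germ _ _))
      have hsZ : ℋ.src ((ρ g).germ (ℋ.src η.1)) ∈ Z := by
        rw [FullGroup.src_germ]
        exact η.2.1
      have hrZ : ℋ.rng ((ρ g).germ (ℋ.src η.1)) ∈ Z := by
        rw [← smul_src_eq hact (FullGroup.germ_mem (ρ g) _), smul_mem_iff hL hact hZL]
        exact hsZ
      have hrZ' : ℋ.rng ((ρ g').germ (ℋ.rng ((ρ g).germ (ℋ.src η.1)))) ∈ Z := by
        rw [← smul_src_eq hact (FullGroup.germ_mem (ρ g') _), smul_mem_iff hL hact hZL, hcomp]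
        exact hrZ
      exact ⟨⟨_, by rw [hcomp]; exact hrZ, hrZ'⟩, ⟨Q, hQ, h2⟩, ⟨_, hsZ, hrZ⟩, ⟨P, hP, h1⟩,
        Subtype.ext hcomp, Subtype.ext e⟩
    · rintro ⟨a, ⟨Q, hQ, ha⟩, b, ⟨P, hP, hb⟩, hab, rfl⟩
      have hab' : ℋ.src a.1 = ℋ.rng b.1 := congrArg Subtype.val hab
      have hQP : 𝒢.src '' Q.1 = 𝒢.rng '' P.1 := by
        rw [hb.rng_eq hL hact, ← hab']
        exact ha.choose_spec.2.2
      exact ⟨_, ⟨Q, hQ, P, hP, Subtype.ext hQP, rfl⟩, IsGermOver.mul hab' ha hb hQP⟩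
  refine ⟨{ toFun := ψ, map_one' := hone, map_mul' := hmul, map_empty := ?_, map_sUnion := ?_ },
    fun g => ?_⟩
  · refine Bisection.coe_ext (Set.ext fun η => ⟨?_, fun h => h.elim⟩)
    rintro ⟨Q, hQ, -⟩
    exact hQ.elim
  · intro 𝒯 h𝒯
    ext η
    simp only [mem_iUnion]
    constructor
    · rintro ⟨Q, hQ, hη⟩
      obtain ⟨T, hT, hQT⟩ := mem_iUnion₂.1 hQ
      exact ⟨T, hT, Q, hQT, hη⟩
    · rintro ⟨T, hT, Q, hQT, hη⟩
      exact ⟨Q, mem_biUnion hT hQT, hη⟩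
  · have htop : ∀ y, y ∉ Z → ℋ.unit y ∈ (ρ g).1 := by
      intro y hy
      rw [hZL, not_not] at hy
      have : g ∈ germStabilizer ρ y := hy ▸ Subgroup.mem_top g
      exact this
    apply Subset.antisymm
    · intro η hη
      by_cases hy : ℋ.src η ∈ Z
      · refine Or.inl ⟨⟨η, hy, ?_⟩, ?_, rfl⟩
        · rw [← smul_src_eq hact hη, smul_mem_iff hL hact hZL]
          exact hy
        · have hsrc : 𝒢.src '' (g.1.germ '' (q ⟨_, hy⟩).1) = (q ⟨_, hy⟩).1 := by
            rw [image_image]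
            simp
          have hQg : g.1.germ '' (q ⟨_, hy⟩).1 ⊆ g.1.1 := by
            rintro _ ⟨x, -, rfl⟩
            exact g.1.germ_mem x
          obtain ⟨x, hx⟩ := (q ⟨_, hy⟩).2
          exact ⟨⟨g.1.germ '' (q ⟨_, hy⟩).1, ⟨g.1.germ ∘ x, by rw [range_comp, hx]⟩,
            g.1.1.injOn_src.mono hQg, g.1.1.injOn_rng.mono hQg⟩, hQg, g, hη, hQg,
            hsrc.trans (hq _)⟩
      · refine Or.inr ⟨_, hy, ?_⟩
        exact (FullGroup.germ_eq (htop _ hy) (ℋ.src_unit _)).symm.trans (FullGroup.germ_eq hη rfl)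
    · rintro _ (⟨η, ⟨Q, hQ, hη⟩, rfl⟩ | ⟨y, hy, rfl⟩)
      · rw [hη.eq_germ hL heff hQ]
        exact FullGroup.germ_mem _ _
      · exact htop y hy

/-! ### Uniqueness of the extension -/

theorem Extends.mem_iff {φ : ContinuousMorphism (𝒢.symPow r) (ℋ.restrict Z hZ)}
    (hφ : Extends ρ φ) {g : 𝒢.alternatingFullGroup} {η : ℋ.RestrictArrow Z} :
    η ∈ φ.toMonoidHom (g.1.1.symPow r) ↔ η.1 ∈ (ρ g).1 := by
  change _ ↔ η.1 ∈ ((ρ g).1 : Set H)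
  rw [hφ g]
  constructor
  · intro h
    exact Or.inl ⟨η, h, rfl⟩
  · rintro (⟨η', h, e⟩ | ⟨y, hy, e⟩)
    · rw [← Subtype.ext e]
      exact h
    · refine absurd ?_ hy
      have := η.2.1
      rwa [← e, ℋ.src_unit] at this

include hL heff hq in
/-- On idempotents, an extension is given by the supports. -/
theorem Extends.unit_mem_iff {φ : ContinuousMorphism (𝒢.symPow r) (ℋ.restrict Z hZ)}
    (hφ : Extends ρ φ) (y : Z) (U : Set (SymPow X r)) (hU : IsOpen U) :
    (ℋ.restrict Z hZ).unit y ∈ φ.toMonoidHom (Bisection.ofOpen U hU) ↔ q y ∈ U := by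
  obtain ⟨a, ha⟩ := φ.exists_forall_unit_mem_iff y
  suffices a = q y by rw [← this, ha]
  refine Subtype.ext (Subset.antisymm (fun p hp => ?_) fun x hx => ?_)
  · -- The stabilizer of the germs at `y` cannot move a point of `a` outside the support.
    by_contra hpq
    obtain ⟨W, hW, hpW, hWq⟩ :=
      compact_exists_isClopen_in_isOpen (q y).finite.isClosed.isOpen_compl hpq
    obtain ⟨b, hbW, hba⟩ := exists_smul_mem 𝒢.alternatingFullGroup p hW.isOpen ⟨p, hpW⟩ a.finite
    obtain ⟨g, hgW, hgb⟩ := exists_mem_altRist_eventuallyEq hW.isOpen hpW hbW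
    rw [← hgb.self_of_nhds] at hba
    have hgy : g ∈ germStabilizer ρ (y : Y) := hL.altRist_le hW (by
      rw [← hq, Set.disjoint_left]
      exact hWq) hgW
    obtain ⟨N, hN, hpN, hNa⟩ :=
      compact_exists_isClopen_in_isOpen a.finite.isClosed.isOpen_compl hba
    have hU₁ : IsOpen {B : SymPow X r | (B.1 ∩ (fun z => g • z) ⁻¹' N).Nonempty} :=
      SymPow.isOpen_inter (hN.isOpen.preimage (continuous_const_smul g))
    have hU₂ : IsOpen {B : SymPow X r | B.1 ⊆ Nᶜ} := SymPow.isOpen_subset hN.compl.isOpen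
    have h1 := (ha _ hU₁).2 ⟨p, hp, hpN⟩
    have h2 := (ha _ hU₂).2 fun z hz hzN => hNa hzN hz
    have h3 : (ℋ.restrict Z hZ).unit y ∈ φ.toMonoidHom (g.1.1.symPow r) :=
      (hφ.mem_iff hZ).2 hgy
    have h4 := Bisection.unit_mem_mul (Bisection.unit_mem_mul h2 h3) h1
    rw [← map_mul, ← map_mul] at h4
    have e : Bisection.ofOpen _ hU₂ * g.1.1.symPow r * Bisection.ofOpen _ hU₁ = ∅ := by
      refine Bisection.coe_ext (Set.ext fun Q => ⟨fun hQ => ?_, fun hQ => hQ.elim⟩)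
      obtain ⟨h5, h6⟩ := Bisection.mem_mul_ofOpen.1 hQ
      obtain ⟨h7, h8⟩ := Bisection.mem_ofOpen_mul.1 h5
      obtain ⟨_, ⟨γ, hγ, rfl⟩, hγN⟩ := h6
      refine h8 ⟨γ, hγ, rfl⟩ ?_
      rw [← FullGroup.smul_src (h7 hγ)]
      exact hγN
    rw [e, φ.apply_empty] at h4
    exact h4
  · -- Elements supported away from `a` have trivial germs at `y`.
    by_contra hxa
    obtain ⟨W, hW, hxW, hWa⟩ :=
      compact_exists_isClopen_in_isOpen a.finite.isClosed.isOpen_compl hxa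
    rw [hq] at hx
    refine hx W hW hxW fun g hg => ?_
    have hU : IsOpen {B : SymPow X r | B.1 ⊆ Wᶜ} := SymPow.isOpen_subset hW.compl.isOpen
    have h1 := (ha _ hU).2 fun z hz hzW => hWa hzW hz
    have e : g.1.1.symPow r * Bisection.ofOpen _ hU = Bisection.ofOpen _ hU := by
      have hunit : ∀ x ∈ Wᶜ, 𝒢.unit x ∈ g.1.1 := by
        intro x hx
        rw [FullGroup.unit_mem_iff heff]
        filter_upwards [hW.compl.isOpen.mem_nhds hx] with z hz
        exact smul_eq_of_mem_altRist hg z hz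
      have hsub : ∀ B : SymPow X r, B.1 ⊆ Wᶜ →
          ((𝒢.symPow r).unit B : 𝒢.SymPowArrow r) ∈ g.1.1.symPow r := by
        rintro B hB _ ⟨x, hx, rfl⟩
        exact hunit x (hB hx)
      refine Bisection.coe_ext (Set.ext fun Q => Bisection.mem_mul_ofOpen.trans ⟨?_, ?_⟩)
      · rintro ⟨h2, h3⟩
        exact ⟨_, h3, (g.1.1.symPow r).injOn_src (hsub _ h3) h2 ((𝒢.symPow r).src_unit _)⟩
      · rintro ⟨B, hB, rfl⟩
        refine ⟨hsub B hB, ?_⟩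
        rw [(𝒢.symPow r).src_unit]
        exact hB
    have h2 := h1
    rw [← e, map_mul] at h2
    obtain ⟨γ, hγ, δ, hδ, hγδ, e'⟩ := h2
    obtain ⟨z, rfl⟩ := Bisection.mem_unit_of_isIdempotentElem
      ((ContinuousMorphism.isIdempotentElem_ofOpen hU).map φ.toMonoidHom) hδ
    rw [(ℋ.restrict Z hZ).mul_unit_of rfl] at e'
    rw [e'] at hγ
    exact (hφ.mem_iff hZ).1 hγ

include hL heff hmin hq in
/-- A bisection of the symmetric power is the union of restrictions of bisections `g^{[r]}`, so that
an extension is determined by its values on these and on idempotents. -/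
theorem Extends.unique {φ φ' : ContinuousMorphism (𝒢.symPow r) (ℋ.restrict Z hZ)}
    (hφ : Extends ρ φ) (hφ' : Extends ρ φ') : φ = φ' := by
  refine ContinuousMorphism.ext_of_apply fun T => ?_
  have hidem : ∀ (U : Set (SymPow X r)) (hU : IsOpen U),
      φ.toMonoidHom (Bisection.ofOpen U hU) = φ'.toMonoidHom (Bisection.ofOpen U hU) := by
    intro U hU
    refine Bisection.coe_ext (Set.ext fun η => ⟨fun h => ?_, fun h => ?_⟩)
    · obtain ⟨y, rfl⟩ := Bisection.mem_unit_of_isIdempotentElem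
        ((ContinuousMorphism.isIdempotentElem_ofOpen hU).map φ.toMonoidHom) h
      exact (hφ'.unit_mem_iff hL heff hZ hq y U hU).2 ((hφ.unit_mem_iff hL heff hZ hq y U hU).1 h)
    · obtain ⟨y, rfl⟩ := Bisection.mem_unit_of_isIdempotentElem
        ((ContinuousMorphism.isIdempotentElem_ofOpen hU).map φ'.toMonoidHom) h
      exact (hφ.unit_mem_iff hL heff hZ hq y U hU).2 ((hφ'.unit_mem_iff hL heff hZ hq y U hU).1 h)
  have hgen : ∀ g : 𝒢.alternatingFullGroup,
      φ.toMonoidHom (g.1.1.symPow r) = φ'.toMonoidHom (g.1.1.symPow r) := fun g =>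
    Bisection.coe_ext (Set.ext fun η => (hφ.mem_iff hZ).trans (hφ'.mem_iff hZ).symm)
  let U : 𝒢.alternatingFullGroup → Set (SymPow X r) := fun g =>
    SymPowArrow.src '' ((T : Set (𝒢.SymPowArrow r)) ∩ {P | P.1 ⊆ g.1.1})
  have hU : ∀ g, IsOpen (U g) := fun g => SymPowArrow.isOpen_src_image g.1.1 T.isOpen
  let R : 𝒢.alternatingFullGroup → (𝒢.symPow r).Bisection := fun g =>
    g.1.1.symPow r * Bisection.ofOpen (U g) (hU g)
  have hR : ∀ g Q, Q ∈ R g ↔ Q ∈ T ∧ Q.1 ⊆ g.1.1 := by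
    intro g Q
    refine Bisection.mem_mul_ofOpen.trans ⟨?_, fun h => ⟨h.2, Q, h, rfl⟩⟩
    rintro ⟨h1, P, ⟨hPT, hPg⟩, e⟩
    have : P = Q := (g.1.1.symPow r).injOn_src hPg h1 e
    exact ⟨this ▸ hPT, h1⟩
  have hcomp : ∀ S ∈ range R, ∀ S' ∈ range R, Bisection.Compatible S S' := by
    rintro _ ⟨g, rfl⟩ _ ⟨g', rfl⟩
    exact Bisection.compatible_of_subset (R := T) (fun Q hQ => ((hR g Q).1 hQ).1)
      fun Q hQ => ((hR g' Q).1 hQ).1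
  have hT : T = Bisection.sUnion (range R) hcomp := by
    refine Bisection.coe_ext (Subset.antisymm (fun Q hQ => ?_) (iUnion₂_subset ?_))
    · obtain ⟨g, hg⟩ := SymPowArrow.exists_alternatingFullGroup_subset heff hmin Q
      exact mem_biUnion (mem_range_self g) ((hR g Q).2 ⟨hQ, hg⟩)
    · rintro _ ⟨g, rfl⟩ Q hQ
      exact ((hR g Q).1 hQ).1
  rw [hT]
  refine Bisection.coe_ext ?_
  rw [φ.coe_apply_sUnion, φ'.coe_apply_sUnion]
  refine iUnion₂_congr ?_
  rintro _ ⟨g, rfl⟩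
  simp only [R, map_mul, hidem, hgen]

end EtaleGroupoid

theorem mainTheorem3 {G X H Y : Type*} [TopologicalSpace G] [TopologicalSpace X]
    [TopologicalSpace H] [TopologicalSpace Y] [CompactSpace Y]
    (𝒢 : EtaleGroupoid G X) (ℋ : EtaleGroupoid H Y)
    (hX : Nonempty (X ≃ₜ (ℕ → Bool)))
    (hgen : 𝒢.IsCompactlyGenerated) (heff : 𝒢.IsEffective) (hmin : 𝒢.IsMinimal)
    (hdim : ∀ y, ℋ.leafAsdim y < ⊤)
    (ρ : 𝒢.alternatingFullGroup →* ℋ.FullGroup) (hρ : ρ ≠ 1) :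
    ∃ hZ : IsClopen (EtaleGroupoid.supportOf ρ.range), ∃ r : ℕ, 1 ≤ r ∧
      (r : ℕ∞) ≤ ⨆ y, ℋ.leafAsdim y ∧
      ∃! φ : ContinuousMorphism (𝒢.symPow r)
          (ℋ.restrict (EtaleGroupoid.supportOf ρ.range) hZ.isOpen),
        EtaleGroupoid.Extends ρ φ := by
  obtain ⟨e⟩ := hX
  have := 𝒢.t2
  have := ℋ.t2
  have : CompactSpace X := e.symm.compactSpace
  have : TotallyDisconnectedSpace X := e.symm.totallyDisconnectedSpace
  have : Infinite X := e.toEquiv.infinite_iff.2 inferInstance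
  have : IsAlternatingAction 𝒢.alternatingFullGroup X :=
    EtaleGroupoid.isAlternatingAction hgen heff hmin
  let _ : MulAction 𝒢.alternatingFullGroup Y := MulAction.compHom Y ρ
  have hact : ∀ (a : 𝒢.alternatingFullGroup) (y : Y), a • y = ρ a • y := fun _ _ => rfl
  have hL := EtaleGroupoid.isStabilizerField_germStabilizer hact hdim
  have hclopen : IsClopen {y | EtaleGroupoid.germStabilizer ρ y ≠ ⊤} := by
    have h1 := hL.isClopen_support_nonempty (X := X)
    simp only [nonempty_iff_ne_empty, ne_eq, hL.support_eq_empty_iff] at h1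
    exact h1
  have hZL : ∀ y, y ∈ EtaleGroupoid.supportOf ρ.range ↔ EtaleGroupoid.germStabilizer ρ y ≠ ⊤ :=
    fun y => EtaleGroupoid.mem_supportOf_range_iff hclopen.isClosed
  have hZ : IsClopen (EtaleGroupoid.supportOf ρ.range) := by
    rw [Set.ext hZL]
    exact hclopen
  obtain ⟨y, hy⟩ : ∃ y, EtaleGroupoid.germStabilizer ρ y ≠ ⊤ := by
    by_contra! hcon
    refine hρ (MonoidHom.ext fun a => (EtaleGroupoid.FullGroup.eq_of_subset ?_).symm)
    rintro _ ⟨y, -, rfl⟩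
    have : a ∈ EtaleGroupoid.germStabilizer ρ y := hcon y ▸ Subgroup.mem_top a
    exact this
  obtain ⟨r, hr, hSr, y₀, hy₀⟩ := hL.exists_encard_support_eq (X := X) hy
  have hq : ∀ y : EtaleGroupoid.supportOf ρ.range, ∃ S : SymPow X r,
      S.1 = subgroupSupport X (EtaleGroupoid.germStabilizer ρ y) := by
    intro y
    have hne : (subgroupSupport X (EtaleGroupoid.germStabilizer ρ (y : Y))).Nonempty := by
      rw [nonempty_iff_ne_empty, ne_eq, hL.support_eq_empty_iff]
      exact (hZL y).1 y.2
    obtain ⟨x, hx⟩ := SymPow.exists_range_eq hne (hSr y)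
    exact ⟨SymPow.mk x, hx⟩
  choose q hq using hq
  refine ⟨hZ, r, hr, ?_, ?_⟩
  · obtain ⟨n, hn, hn'⟩ := EtaleGroupoid.exists_asdimLE_of_leafAsdim_lt_top (hdim y₀)
    calc (r : ℕ∞) ≤ _ := hy₀
      _ ≤ n := encard_subgroupSupport_le (EtaleGroupoid.cosetDimLE_germStabilizer hn)
      _ ≤ ℋ.leafAsdim y₀ := hn'
      _ ≤ ⨆ y, ℋ.leafAsdim y := le_iSup _ y₀
  · obtain ⟨φ, hφ⟩ :=
      EtaleGroupoid.exists_continuousMorphism_extends hL hact heff hmin hZ.isOpen hZL hq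
    exact ⟨φ, hφ, fun φ' hφ' => hφ'.unique hL heff hmin hZ.isOpen hq hφ⟩
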